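/- Let $X$ be a locally compact Polish space, $m$ a Radon measure on $X$, and $X=X_1\sqcup X_2$ with $X_1,X_2$ Borel. Put $H=L^2(X,m)$ (complex), let $P_i$ be the orthogonal projection of $H$ onto $L^2(X_i,m)$, and for a bounded operator $A$ on $H$ put $A_{\mathrm{even}}=P_1AP_1+P_2AP_2$ and $A_{\mathrm{odd}}=P_1AP_2+P_2AP_1$. Let $\mathscr L_{1|2}(H)$ be the set of bounded operators $A$ with $A_{\mathrm{even}}$ trace class and $A_{\mathrm{odd}}$ Hilbert--Schmidt; for such $A$ let $\operatorname{Det}(1+A)=\operatorname{Det}\big((1+A)e^{-A}\big)\,e^{\operatorname{Tr}(A_{\mathrm{even}})}$, where the first factor on the right is a classical Fredholm determinant, $\operatorname{Det}(1+B)=1+\sum_{n\ge1}\operatorname{Tr}(\wedge^n B)$ for $B$ trace class. For a Borel set $\Delta$ let $P^\Delta$ be multiplication by the indicator function of $\Delta$ and $K^\Delta=P^\Delta KP^\Delta$. Let $K$ be a bounded operator on $H$ that is $J$-self-adjoint, i.e. $(JKf,g)=(Jf,Kg)$ for all $f,g\in H$ with $J=P_1-P_2$. Assume $P_1KP_1\ge0$,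 $P_2KP_2\ge0$, and $K^{\Delta}\in\mathscr L_{1|2}(H)$ for every pre-compact Borel set $\Delta\subset X$. Fix a pre-compact Borel set $\Delta$ and a bounded measurable function $\varphi:X\to\mathbb R$ that vanishes outside $\Delta$; write $\varphi$ also for the operator of multiplication by $\varphi$. Then $K^\Delta\varphi$ and $\operatorname{sgn}(\varphi)\sqrt{|\varphi|}\,K\sqrt{|\varphi|}$ belong to $\mathscr L_{1|2}(H)$, and $$\operatorname{Det}(1+K^\Delta\varphi)=\operatorname{Det}\big(1+\operatorname{sgn}(\varphi)\sqrt{|\varphi|}\,K\sqrt{|\varphi|}\,\big).$$ Moreover, let $K(x,y)$ be any measurable integral kernel of $K$ (that is, for each $f\in H$ vanishing outside a pre-compact set, $(Kf)(x)=\int_X K(x,y)f(y)\,m(dy)$ for $m$-a.e. $x$, with absolute convergence) such that: (i) $K(x,y)=\overline{K(y,x)}$ if $x,y\in X_1$ or $x,y\in X_2$, and $K(x,y)=-\overline{K(y,x)}$ if $x\in X_1$, $y\in X_2$; (ii) for $i=1,2$ and any $x_1,\dots,x_n\in X_i$ the matrix $[K(x_i,x_j)]_{i,j=1}^n$ is nonnegative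 definite; (iii) for each pre-compact Borel set $\Lambda$, the function $x\mapsto K(x,x)$ is integrable on $\Lambda$ and $\operatorname{Tr}(K^\Lambda_{\mathrm{even}})=\int_\Lambda K(x,x)\,m(dx)$. Then the integrals and the series below converge absolutely, and both determinants are equal to $$1+\sum_{n=1}^\infty\frac1{n!}\int_{X^n}\varphi(x_1)\cdots\varphi(x_n)\det[K(x_i,x_j)]_{i,j=1,\dots,n}\,m(dx_1)\cdots m(dx_n).$$ -/

import Mathlib

open MeasureTheory Set Filter Topology
open scoped ENNReal ComplexOrder InnerProductSpace

noncomputable section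

namespace JDet

/-! ### Trace class, Hilbert-Schmidt operators and determinants on a complex Hilbert space -/

section Hilbert

variable (H : Type*) [NormedAddCommGroup H] [InnerProductSpace ℂ H] [CompleteSpace H]

/-- The index set of a fixed orthonormal (Hilbert) basis of `H`. -/
def BasisIndex : Set H := (exists_hilbertBasis ℂ H).choose

/-- A fixed orthonormal (Hilbert) basis of `H`, in which traces and Hilbert-Schmidt norms are
computed. -/
def onBasis : HilbertBasis (BasisIndex H) ℂ H := (exists_hilbertBasis ℂ H).choose_spec.choose

variable {H}

/-- `A` is of trace class: `Tr |A| < ∞`, where `|A| = (A* A)^{1/2}`. -/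
def IsTraceClass (A : H →L[ℂ] H) : Prop :=
  Summable fun i => (⟪onBasis H i, CFC.abs A (onBasis H i)⟫_ℂ).re

/-- `A` is a Hilbert-Schmidt operator: `∑ ‖A e_i‖² < ∞`. -/
def IsHilbertSchmidt (A : H →L[ℂ] H) : Prop :=
  Summable fun i => ‖A (onBasis H i)‖ ^ 2

/-- The trace `∑ (A e_i, e_i)` (used for trace class `A`). -/
def trace (A : H →L[ℂ] H) : ℂ := ∑' i, ⟪onBasis H i, A (onBasis H i)⟫_ℂ

/-- The scalar product `⟨u₁ ∧ ⋯ ∧ uₙ, T⟩` on the `n`-th exterior power of `H`, conjugate linear in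
the first argument and normalised by `⟨u₁ ∧ ⋯ ∧ uₙ, v₁ ∧ ⋯ ∧ vₙ⟩ = det ⟨u_i, v_j⟩`. -/
def wedgeInner {n : ℕ} (u : Fin n → H) (T : ⋀[ℂ]^n H) : ℂ :=
  exteriorPower.pairingDual ℂ H n
    (exteriorPower.ιMulti ℂ n fun i => ((innerSL ℂ (u i) : H →L[ℂ] ℂ) : H →ₗ[ℂ] ℂ)) T

/-- `Tr (∧ⁿ A)`, computed in the orthonormal basis `e_{i₁} ∧ ⋯ ∧ e_{iₙ}` of the antisymmetric tensor
power.  The sum runs over all tuples `(i₁, …, iₙ)`: a tuple with a repetition contributes `0` and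
every `n`-element set of indices is listed `n!` times, with the same contribution each time,
whence the factor `1 / n!`. -/
def traceWedge (n : ℕ) (A : H →L[ℂ] H) : ℂ :=
  ((n.factorial : ℂ))⁻¹ * ∑' f : Fin n → BasisIndex H,
    wedgeInner (fun i => onBasis H (f i))
      (exteriorPower.map n (A : H →ₗ[ℂ] H)
        (exteriorPower.ιMulti ℂ n fun i => onBasis H (f i)))

/-- The classical Fredholm determinant `Det (1 + A) = 1 + ∑_{n ≥ 1} Tr (∧ⁿ A)`
(used for trace class `A`). -/
def fredholmDet (A : H →L[ℂ] H) : ℂ := 1 + ∑' n : ℕ, traceWedge (n + 1) A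

/-- The even (block diagonal) part of `A` with respect to the splitting `H = H₁ ⊕ H₂` with
orthogonal projections `P₁`, `P₂`. -/
def evenPart (P₁ P₂ A : H →L[ℂ] H) : H →L[ℂ] H := P₁ * A * P₁ + P₂ * A * P₂

/-- The odd (off-diagonal) part of `A`. -/
def oddPart (P₁ P₂ A : H →L[ℂ] H) : H →L[ℂ] H := P₁ * A * P₂ + P₂ * A * P₁

/-- The class `𝓛_{1|2}(H)`: the even part is of trace class and the odd part is
Hilbert-Schmidt. -/
def MemL12 (P₁ P₂ A : H →L[ℂ] H) : Prop :=
  IsTraceClass (evenPart P₁ P₂ A) ∧ IsHilbertSchmidt (oddPart P₁ P₂ A)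

/-- The extended Fredholm determinant
`Det (1 + A) = Det ((1 + A) e^{-A}) · e^{Tr A_even}` for `A ∈ 𝓛_{1|2}(H)`; the first factor is a
classical Fredholm determinant. -/
def extDet (P₁ P₂ A : H →L[ℂ] H) : ℂ :=
  fredholmDet ((1 + A) * NormedSpace.exp (-A) - 1) * Complex.exp (trace (evenPart P₁ P₂ A))

/-- `A` is self-adjoint for the indefinite scalar product `[f, g] = (J f, g)`, `J = P₁ - P₂`. -/
def IsJSelfAdjoint (P₁ P₂ A : H →L[ℂ] H) : Prop :=
  ∀ f g : H, ⟪(P₁ - P₂) (A f), g⟫_ℂ = ⟪(P₁ - P₂) f, A g⟫_ℂ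

end Hilbert

/-! ### Operators on `L²(X, m)` -/

section L2

variable {X : Type*} [MeasurableSpace X]

open Classical in
/-- The operator of multiplication by an (essentially) bounded measurable function `f` on
`L²(X, m)`. -/
def mulOp (m : Measure X) (f : X → ℂ) : Lp ℂ 2 m →L[ℂ] Lp ℂ 2 m :=
  if hf : MemLp f ∞ m then
    (ContinuousLinearMap.mul ℂ ℂ).holderL m ∞ 2 2 (hf.toLp f)
  else 0

theorem coeFn_mulOp {m : Measure X} {f : X → ℂ} (hf : MemLp f ∞ m) (g : Lp ℂ 2 m) :
    mulOp m f g =ᵐ[m] fun x => f x * g x := by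
  rw [mulOp, dif_pos hf]
  filter_upwards [(ContinuousLinearMap.mul ℂ ℂ).coeFn_holder (r := 2) (hf.toLp f) g,
    hf.coeFn_toLp] with x hx hx'
  rw [ContinuousLinearMap.holderL_apply_apply, hx, hx']
  rfl

/-- `P^S`: multiplication by the indicator function of `S`, the orthogonal projection of
`L²(X, m)` onto `L²(S, m)` (for measurable `S`). -/
def proj (m : Measure X) (S : Set X) : Lp ℂ 2 m →L[ℂ] Lp ℂ 2 m :=
  mulOp m (S.indicator fun _ => 1)

/-- `K^S = P^S K P^S`. -/
def compress (m : Measure X) (S : Set X) (K : Lp ℂ 2 m →L[ℂ] Lp ℂ 2 m) :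
    Lp ℂ 2 m →L[ℂ] Lp ℂ 2 m :=
  proj m S * K * proj m S

/-- The operator `K^S φ`. -/
def localOp (m : Measure X) (S : Set X) (K : Lp ℂ 2 m →L[ℂ] Lp ℂ 2 m) (φ : X → ℝ) :
    Lp ℂ 2 m →L[ℂ] Lp ℂ 2 m :=
  compress m S K * mulOp m (fun x => (φ x : ℂ))

/-- The operator `sgn(φ) √|φ| K √|φ|`. -/
def sqrtOp (m : Measure X) (K : Lp ℂ 2 m →L[ℂ] Lp ℂ 2 m) (φ : X → ℝ) :
    Lp ℂ 2 m →L[ℂ] Lp ℂ 2 m :=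
  mulOp m (fun x => ((Real.sign (φ x) * √|φ x| : ℝ) : ℂ)) * K *
    mulOp m (fun x => ((√|φ x| : ℝ) : ℂ))

/-- `φ(x₁) ⋯ φ(xₙ) det [k(x_i, x_j)]`. -/
def detIntegrand (φ : X → ℝ) (k : X → X → ℂ) (n : ℕ) (x : Fin n → X) : ℂ :=
  (∏ i, (φ (x i) : ℂ)) * (Matrix.of fun i j => k (x i) (x j)).det

/-- `(1 / n!) ∫ φ(x₁) ⋯ φ(xₙ) det [k(x_i, x_j)] m(dx₁) ⋯ m(dxₙ)`. -/
def detTerm (m : Measure X) (φ : X → ℝ) (k : X → X → ℂ) (n : ℕ) : ℂ :=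
  ((n.factorial : ℂ))⁻¹ * ∫ x, detIntegrand φ k n x ∂(Measure.pi fun _ : Fin n => m)

/-- Pre-compact Borel sets. -/
def IsPrecompactBorel [TopologicalSpace X] (S : Set X) : Prop :=
  MeasurableSet S ∧ IsCompact (closure S)

/-- `k` is an integral kernel of `K`: for square integrable `f` supported in a pre-compact set,
`(K f)(x) = ∫ k(x, y) f(y) m(dy)` for a.e. `x`, the integral being absolutely convergent. -/
def IsIntegralKernel [TopologicalSpace X] (m : Measure X) (K : Lp ℂ 2 m →L[ℂ] Lp ℂ 2 m)
    (k : X → X → ℂ) : Prop :=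
  Measurable (Function.uncurry k) ∧
    ∀ S : Set X, IsPrecompactBorel S → ∀ f : Lp ℂ 2 m, (∀ᵐ x ∂m, x ∉ S → f x = 0) →
      ∀ᵐ x ∂m, Integrable (fun y => k x y * f y) m ∧ K f x = ∫ y, k x y * f y ∂m

/-- The choice of integral kernel for an operator `K` on `L²(X, m)`, `X = X₁ ⊔ X₂`, `X₂ = X₁ᶜ`:
`k` is a kernel of `K` which is `J`-Hermitian, positive semidefinite on `X₁` and on `X₂`,
and gives the traces of the local even parts by integration over the diagonal. -/
structure IsGoodKernel [TopologicalSpace X] (m : Measure X) (X₁ : Set X)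
    (K : Lp ℂ 2 m →L[ℂ] Lp ℂ 2 m) (k : X → X → ℂ) : Prop where
  isIntegralKernel : IsIntegralKernel m K k
  hermitian₁ : ∀ x ∈ X₁, ∀ y ∈ X₁, k x y = star (k y x)
  hermitian₂ : ∀ x ∈ X₁ᶜ, ∀ y ∈ X₁ᶜ, k x y = star (k y x)
  antihermitian : ∀ x ∈ X₁, ∀ y ∈ X₁ᶜ, k x y = -star (k y x)
  posSemidef₁ : ∀ (n : ℕ) (x : Fin n → X), (∀ i, x i ∈ X₁) →
    (Matrix.of fun i j => k (x i) (x j)).PosSemidef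
  posSemidef₂ : ∀ (n : ℕ) (x : Fin n → X), (∀ i, x i ∈ X₁ᶜ) →
    (Matrix.of fun i j => k (x i) (x j)).PosSemidef
  integrableOn_diag : ∀ S : Set X, IsPrecompactBorel S → IntegrableOn (fun x => k x x) S m
  trace_eq : ∀ S : Set X, IsPrecompactBorel S →
    trace (evenPart (proj m X₁) (proj m X₁ᶜ) (compress m S K)) = ∫ x in S, k x x ∂m

end L2

end JDet

end

/-! The determinant depends only on a sequence of traces. For a Hilbert-Schmidt operator A put τ₀ =
Tr(A_even) and τ_l = Tr(A^(l+1)) for l ≥ 1; the number Tr(A_even) stands in for Tr A, which need not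
exist. Newton's recursion (`IsNewton`) turns τ into coefficients D_n, and `extDet_eq_tsum` shows
that Det(1 + A) = ∑ D_n. Everything else is a comparison of traces.

Why the sum is the determinant: compressing A to finitely many basis vectors gives matrices M for
which det(1 + zM) e^{z(t - Tr M)} is an entire function with Newton coefficients. It is bounded by
exp(Re(zt) + |z|²‖M‖²/2), with ‖M‖ the Hilbert-Schmidt norm, whatever the size of M. Cauchy's
estimate on |z| = 2 dominates the coefficients, so the limit may be taken termwise
(`IsNewton.tendsto_det`). The same argument applies to (1 + A)e^{-A} - 1, which is A · A times a
convergent power series in A, hence a product of two Hilbert-Schmidt operators. Its Fredholm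
coefficients Tr(∧ⁿ) obey Newton's recursion by Laplace expansion of determinants
(`IsFredholmKernel.isNewton` for counting measure on the basis).

Why the two determinants agree: with A = K^Δ, g = √|φ| and s = sgn(φ)√|φ| they belong to A g s and s
A g. Traces of powers of order at least 2 agree by cyclicity for Hilbert-Schmidt factors. For the
even traces, positivity of the diagonal blocks gives A_even = R² with R self-adjoint and
Hilbert-Schmidt, and then both equal Tr(R g s R).

Why the series is the determinant: the integrals (1/n!)∫ det obey Newton's recursion too, by the
same Laplace expansion, now for the measure m and the kernel s(x)k(x,y)g(y). This kernel is square
integrable because it agrees almost everywhere with the L² kernel of a Hilbert-Schmidt operator. Its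
iterates therefore compute Tr(B^(l+2)) (`integral_iterKernel_eq_trace`). The first trace ∫
φ(x)k(x,x) involves values on the diagonal, which the almost everywhere class of the kernel does not
control; here condition (iii), used on all measurable subsets of Δ, identifies k(x,x) with ∑|(R
e_i)(x)|² (`diag_ae_eq_hsDensity`). -/

noncomputable section

namespace JDet

/-! ### Hilbert-Schmidt norm: a two-sided ideal, traces of products, convergence. -/

section HilbertSchmidt

variable {H : Type*} [NormedAddCommGroup H] [InnerProductSpace ℂ H] [CompleteSpace H]

/-- The Hilbert-Schmidt norm, with values in `[0, ∞]`. -/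
def hs (A : H →L[ℂ] H) : ℝ≥0∞ := (∑' i, ‖A (onBasis H i)‖ₑ ^ (2 : ℝ)) ^ (1 / 2 : ℝ)

theorem tsum_mul_le_L2 {ι : Type*} (f g : ι → ℝ≥0∞) :
    ∑' i, f i * g i ≤
      (∑' i, f i ^ (2 : ℝ)) ^ (1 / 2 : ℝ) * (∑' i, g i ^ (2 : ℝ)) ^ (1 / 2 : ℝ) := by
  let : MeasurableSpace ι := ⊤
  have h := ENNReal.lintegral_mul_le_Lp_mul_Lq (Measure.count : Measure ι)
    Real.HolderConjugate.two_two (f := f) (g := g) measurable_from_top.aemeasurable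
    measurable_from_top.aemeasurable
  simpa [lintegral_count] using h

theorem tsum_add_le_L2 {ι : Type*} (f g : ι → ℝ≥0∞) :
    (∑' i, (f i + g i) ^ (2 : ℝ)) ^ (1 / 2 : ℝ) ≤
      (∑' i, f i ^ (2 : ℝ)) ^ (1 / 2 : ℝ) + (∑' i, g i ^ (2 : ℝ)) ^ (1 / 2 : ℝ) := by
  let : MeasurableSpace ι := ⊤
  have h := ENNReal.lintegral_Lp_add_le (μ := (Measure.count : Measure ι)) (f := f) (g := g)
    measurable_from_top.aemeasurable measurable_from_top.aemeasurable (one_le_two (α := ℝ))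
  simpa [lintegral_count] using h

theorem hs_sq (A : H →L[ℂ] H) : hs A ^ 2 = ∑' i, ‖A (onBasis H i)‖ₑ ^ 2 := by
  simp only [hs]
  rw [← ENNReal.rpow_natCast, ← ENNReal.rpow_mul]
  simp

theorem hs_eq_of_sq {A B : H →L[ℂ] H} (h : hs A ^ 2 = hs B ^ 2) : hs A = hs B :=
  (ENNReal.pow_right_strictMono two_ne_zero).injective h

theorem hs_mono_of_sq {A : H →L[ℂ] H} {c : ℝ≥0∞} (h : hs A ^ 2 ≤ c ^ 2) : hs A ≤ c :=
  (ENNReal.pow_right_strictMono two_ne_zero).le_iff_le.1 h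

theorem isHilbertSchmidt_iff {A : H →L[ℂ] H} : IsHilbertSchmidt A ↔ hs A ≠ ∞ := by
  have h1 : hs A ≠ ∞ ↔ hs A ^ 2 ≠ ∞ := by simp
  rw [h1, hs_sq, IsHilbertSchmidt]
  have h2 : ∀ i, ‖A (onBasis H i)‖ₑ ^ 2 = ((‖A (onBasis H i)‖₊ ^ 2 : NNReal) : ℝ≥0∞) := by
    intro i; simp [enorm]
  simp_rw [h2]
  rw [ENNReal.tsum_coe_ne_top_iff_summable, ← NNReal.summable_coe]
  simp

theorem hs_add_le (A B : H →L[ℂ] H) : hs (A + B) ≤ hs A + hs B := by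
  refine le_trans ?_ (tsum_add_le_L2 _ _)
  unfold hs
  gcongr with i
  exact enorm_add_le _ _

theorem hs_neg (A : H →L[ℂ] H) : hs (-A) = hs A := by simp [hs]

theorem hs_sub_le (A B : H →L[ℂ] H) : hs (A - B) ≤ hs A + hs B := by
  rw [sub_eq_add_neg, ← hs_neg B]; exact hs_add_le _ _

theorem hs_mul_left_le (C A : H →L[ℂ] H) : hs (C * A) ≤ ‖C‖ₑ * hs A := by
  refine hs_mono_of_sq ?_
  rw [mul_pow, hs_sq, hs_sq, ← ENNReal.tsum_mul_left]
  refine ENNReal.tsum_le_tsum fun i => ?_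
  rw [← mul_pow]
  gcongr
  exact C.le_opENorm _

theorem tsum_enorm_inner_sq (x : H) : ∑' i, ‖⟪onBasis H i, x⟫_ℂ‖ₑ ^ 2 = ‖x‖ₑ ^ 2 := by
  have h := (onBasis H).hasSum_inner_mul_inner x x
  have h2 : HasSum (fun i => ‖⟪onBasis H i, x⟫_ℂ‖ ^ 2) (‖x‖ ^ 2) := by
    have h3 := Complex.hasSum_re h
    rw [show (⟪x, x⟫_ℂ).re = ‖x‖ ^ 2 from inner_self_eq_norm_sq (𝕜 := ℂ) x] at h3
    convert h3 using 2 with i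
    rw [← inner_conj_symm x, ← Complex.normSq_eq_conj_mul_self, Complex.ofReal_re,
      Complex.normSq_eq_norm_sq]
  have h4 : HasSum (fun i => (‖⟪onBasis H i, x⟫_ℂ‖₊ ^ 2 : NNReal)) (‖x‖₊ ^ 2) := by
    rw [← NNReal.hasSum_coe]; simpa using h2
  have h5 := (ENNReal.hasSum_coe.2 h4).tsum_eq
  simpa [enorm] using h5

theorem enorm_inner_le {E : Type*} [NormedAddCommGroup E] [InnerProductSpace ℂ E] (x y : E) :
    ‖⟪x, y⟫_ℂ‖ₑ ≤ ‖x‖ₑ * ‖y‖ₑ := by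
  simp only [← ofReal_norm, ← ENNReal.ofReal_mul (norm_nonneg _)]
  exact ENNReal.ofReal_le_ofReal (norm_inner_le_norm _ _)

theorem enorm_inner_comm {E : Type*} [NormedAddCommGroup E] [InnerProductSpace ℂ E] (x y : E) :
    ‖⟪x, y⟫_ℂ‖ₑ = ‖⟪y, x⟫_ℂ‖ₑ := by
  rw [← inner_conj_symm, RCLike.enorm_conj]

theorem hs_sq_eq_tsum_tsum (A : H →L[ℂ] H) :
    hs A ^ 2 = ∑' i, ∑' j, ‖⟪onBasis H j, A (onBasis H i)⟫_ℂ‖ₑ ^ 2 := by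
  simp_rw [hs_sq, tsum_enorm_inner_sq]

/-- The squared norm is the sum of all |⟨e_j, A e_i⟩|², which is symmetric in i and j. Estimates for
right factors follow from those for left factors through this symmetry. -/
theorem hs_star (A : H →L[ℂ] H) : hs (star A) = hs A := by
  apply hs_eq_of_sq
  rw [hs_sq_eq_tsum_tsum, hs_sq_eq_tsum_tsum, ENNReal.tsum_comm]
  congr! 5 with i j
  rw [ContinuousLinearMap.star_eq_adjoint, ContinuousLinearMap.adjoint_inner_right,
    enorm_inner_comm]

theorem enorm_star_clm (C : H →L[ℂ] H) : ‖star C‖ₑ = ‖C‖ₑ := by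
  rw [← ofReal_norm, ← ofReal_norm, norm_star]

theorem hs_mul_right_le (A C : H →L[ℂ] H) : hs (A * C) ≤ hs A * ‖C‖ₑ := by
  rw [← hs_star, star_mul, ← hs_star A, mul_comm, ← enorm_star_clm C]
  exact hs_mul_left_le _ _

theorem enorm_le_hs (A : H →L[ℂ] H) : ‖A‖ₑ ≤ hs A := by
  refine ContinuousLinearMap.opENorm_le_bound _ fun x => ?_
  refine (ENNReal.pow_right_strictMono two_ne_zero).le_iff_le.1 ?_
  rw [← tsum_enorm_inner_sq, mul_pow, ← hs_star, hs_sq, ← ENNReal.tsum_mul_right]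
  refine ENNReal.tsum_le_tsum fun i => ?_
  rw [← mul_pow]
  gcongr
  rw [← ContinuousLinearMap.adjoint_inner_left, ContinuousLinearMap.star_eq_adjoint]
  exact enorm_inner_le _ _

theorem hs_mul_ne_top_left {A : H →L[ℂ] H} (C : H →L[ℂ] H) (hA : hs A ≠ ∞) : hs (C * A) ≠ ∞ :=
  ((hs_mul_left_le C A).trans_lt (ENNReal.mul_lt_top enorm_lt_top hA.lt_top)).ne

theorem hs_mul_ne_top_right {A : H →L[ℂ] H} (C : H →L[ℂ] H) (hA : hs A ≠ ∞) : hs (A * C) ≠ ∞ :=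
  ((hs_mul_right_le A C).trans_lt (ENNReal.mul_lt_top hA.lt_top enorm_lt_top)).ne

theorem hs_add_ne_top {A B : H →L[ℂ] H} (hA : hs A ≠ ∞) (hB : hs B ≠ ∞) : hs (A + B) ≠ ∞ :=
  ((hs_add_le A B).trans_lt (ENNReal.add_lt_top.2 ⟨hA.lt_top, hB.lt_top⟩)).ne

/-! ### Traces of products of Hilbert-Schmidt operators -/

/-- Write the diagonal entry as ⟨X* e_i, Y e_i⟩ and apply Cauchy-Schwarz, first in H and then over
i. -/
theorem tsum_enorm_inner_mul_le (X Y : H →L[ℂ] H) :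
    ∑' i, ‖⟪onBasis H i, (X * Y) (onBasis H i)⟫_ℂ‖ₑ ≤ hs X * hs Y := by
  rw [← hs_star X]
  refine le_trans (ENNReal.tsum_le_tsum fun i => ?_) (tsum_mul_le_L2 _ _)
  rw [mul_apply_eq_comp, ← ContinuousLinearMap.adjoint_inner_left,
    ContinuousLinearMap.star_eq_adjoint]
  exact enorm_inner_le _ _

theorem summable_of_tsum_enorm_ne_top {ι E : Type*} [NormedAddCommGroup E] [CompleteSpace E]
    {f : ι → E} (h : ∑' i, ‖f i‖ₑ ≠ ∞) : Summable f := by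
  refine Summable.of_nnnorm ?_
  exact ENNReal.tsum_coe_ne_top_iff_summable.1 h

theorem summable_inner_mul {X Y : H →L[ℂ] H} (hX : hs X ≠ ∞) (hY : hs Y ≠ ∞) :
    Summable fun i => ⟪onBasis H i, (X * Y) (onBasis H i)⟫_ℂ :=
  summable_of_tsum_enorm_ne_top
    ((tsum_enorm_inner_mul_le X Y).trans_lt (ENNReal.mul_lt_top hX.lt_top hY.lt_top)).ne

theorem enorm_trace_mul_le (X Y : H →L[ℂ] H) : ‖trace (X * Y)‖ₑ ≤ hs X * hs Y :=
  (enorm_tsum_le_tsum_enorm).trans (tsum_enorm_inner_mul_le X Y)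

theorem inner_mul_eq_tsum (X Y : H →L[ℂ] H) (x y : H) :
    ⟪x, (X * Y) y⟫_ℂ = ∑' j, ⟪x, X (onBasis H j)⟫_ℂ * ⟪onBasis H j, Y y⟫_ℂ := by
  rw [mul_apply_eq_comp, ← ContinuousLinearMap.adjoint_inner_left,
    ← (onBasis H).tsum_inner_mul_inner]
  simp_rw [ContinuousLinearMap.adjoint_inner_left]

/-- Both traces are iterated sums of X_ij Y_ji; the double series converges absolutely by
Cauchy-Schwarz over index pairs, so the order of summation may be exchanged. -/
theorem trace_mul_comm {X Y : H →L[ℂ] H} (hX : hs X ≠ ∞) (hY : hs Y ≠ ∞) :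
    trace (X * Y) = trace (Y * X) := by
  unfold trace
  simp_rw [inner_mul_eq_tsum]
  have hs' : Summable (Function.uncurry fun i j =>
      ⟪onBasis H i, X (onBasis H j)⟫_ℂ * ⟪onBasis H j, Y (onBasis H i)⟫_ℂ) := by
    refine summable_of_tsum_enorm_ne_top ?_
    rw [← lt_top_iff_ne_top]
    refine lt_of_le_of_lt ?_ (ENNReal.mul_lt_top hX.lt_top hY.lt_top)
    simp_rw [Function.uncurry, enorm_mul]
    refine (tsum_mul_le_L2 _ _).trans (le_of_eq ?_)
    have key : ∀ Z : H →L[ℂ] H, (∑' p : BasisIndex H × BasisIndex H,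
        ‖⟪onBasis H p.1, Z (onBasis H p.2)⟫_ℂ‖ₑ ^ (2 : ℝ)) ^ (1 / 2 : ℝ) = hs Z := by
      intro Z
      have : (∑' p : BasisIndex H × BasisIndex H,
        ‖⟪onBasis H p.1, Z (onBasis H p.2)⟫_ℂ‖ₑ ^ (2 : ℝ)) = hs Z ^ 2 := by
        rw [hs_sq_eq_tsum_tsum, ENNReal.tsum_prod', ENNReal.tsum_comm]
        simp
      rw [this, ← ENNReal.rpow_natCast, ← ENNReal.rpow_mul]
      simp
    congr 1
    · exact key X
    · rw [← key Y, ← (Equiv.prodComm _ _).tsum_eq]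
      rfl
  refine (Summable.tsum_comm hs').symm.trans ?_
  simp_rw [mul_comm]

theorem trace_add {A B : H →L[ℂ] H} (hA : Summable fun i => ⟪onBasis H i, A (onBasis H i)⟫_ℂ)
    (hB : Summable fun i => ⟪onBasis H i, B (onBasis H i)⟫_ℂ) :
    trace (A + B) = trace A + trace B := by
  simp [trace, hA.tsum_add hB]

theorem trace_sub {A B : H →L[ℂ] H} (hA : Summable fun i => ⟪onBasis H i, A (onBasis H i)⟫_ℂ)
    (hB : Summable fun i => ⟪onBasis H i, B (onBasis H i)⟫_ℂ) :
    trace (A - B) = trace A - trace B := by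
  simp [trace, hA.tsum_sub hB]

/-! ### Convergence in the Hilbert-Schmidt norm -/

/-- Convergence in the Hilbert-Schmidt norm to a Hilbert-Schmidt operator. -/
structure HSTendsto {σ : Type*} (T : σ → H →L[ℂ] H) (l : Filter σ) (A : H →L[ℂ] H) : Prop where
  hs_ne_top : ∀ s, hs (T s) ≠ ∞
  hs_lim_ne_top : hs A ≠ ∞
  tendsto : Tendsto (fun s => hs (T s - A)) l (𝓝 0)

theorem HSTendsto.tendsto_clm {σ : Type*} {T : σ → H →L[ℂ] H} {l : Filter σ} {A : H →L[ℂ] H}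
    (h : HSTendsto T l A) : Tendsto T l (𝓝 A) := by
  rw [tendsto_iff_edist_tendsto_0]
  refine tendsto_of_tendsto_of_tendsto_of_le_of_le tendsto_const_nhds h.tendsto
    (fun _ => zero_le) fun s => ?_
  rw [edist_eq_enorm_sub]
  exact enorm_le_hs _

/-- Convergence in operator norm suffices for the right factor, so power series in the approximants
can be attached there. -/
theorem HSTendsto.mul_right {σ : Type*} {T C : σ → H →L[ℂ] H} {l : Filter σ} {A B : H →L[ℂ] H}
    (h : HSTendsto T l A) (hC : Tendsto C l (𝓝 B)) :
    HSTendsto (fun s => T s * C s) l (A * B) := by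
  refine ⟨fun s => hs_mul_ne_top_right _ (h.hs_ne_top s), hs_mul_ne_top_right _ h.hs_lim_ne_top, ?_⟩
  have hC' : Tendsto (fun s => ‖C s‖ₑ) l (𝓝 ‖B‖ₑ) := (continuous_enorm.tendsto B).comp hC
  have hC2 : Tendsto (fun s => ‖C s - B‖ₑ) l (𝓝 0) := by
    simpa [edist_eq_enorm_sub] using tendsto_iff_edist_tendsto_0.1 hC
  have h1 : Tendsto (fun s => hs (T s - A) * ‖C s‖ₑ + hs A * ‖C s - B‖ₑ) l (𝓝 0) := by
    have := (ENNReal.Tendsto.mul h.tendsto (Or.inr enorm_ne_top) hC'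
      (Or.inr ENNReal.zero_ne_top)).add
      (ENNReal.Tendsto.const_mul hC2 (Or.inr h.hs_lim_ne_top))
    simpa using this
  refine tendsto_of_tendsto_of_tendsto_of_le_of_le tendsto_const_nhds h1
    (fun _ => zero_le) fun s => ?_
  have : T s * C s - A * B = (T s - A) * C s + A * (C s - B) := by noncomm_ring
  rw [this]
  exact (hs_add_le _ _).trans (add_le_add (hs_mul_right_le _ _) (hs_mul_right_le _ _))

theorem HSTendsto.tendsto_hs {σ : Type*} {T : σ → H →L[ℂ] H} {l : Filter σ} {A : H →L[ℂ] H}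
    (h : HSTendsto T l A) : ∀ᶠ s in l, hs (T s) ≤ hs A + 1 := by
  filter_upwards [h.tendsto.eventually (ge_mem_nhds one_pos)] with s hs'
  calc hs (T s) = hs (A + (T s - A)) := by congr 1; abel
    _ ≤ _ := (hs_add_le _ _).trans (by gcongr)

theorem HSTendsto.tendsto_trace_mul {σ : Type*} {T S : σ → H →L[ℂ] H} {l : Filter σ}
    {A B : H →L[ℂ] H} (h : HSTendsto T l A) (h' : HSTendsto S l B) :
    Tendsto (fun s => trace (T s * S s)) l (𝓝 (trace (A * B))) := by
  rw [tendsto_iff_edist_tendsto_0]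
  have h1 : Tendsto (fun s => hs (T s - A) * (hs B + 1) + hs A * hs (S s - B)) l (𝓝 0) := by
    have := (ENNReal.Tendsto.mul_const h.tendsto
      (Or.inr (ENNReal.add_ne_top.2 ⟨h'.hs_lim_ne_top, ENNReal.one_ne_top⟩))).add
      (ENNReal.Tendsto.const_mul h'.tendsto (Or.inr h.hs_lim_ne_top))
    simpa using this
  refine tendsto_of_tendsto_of_tendsto_of_le_of_le' tendsto_const_nhds h1
    (Eventually.of_forall fun _ => zero_le) ?_
  filter_upwards [h'.tendsto_hs] with s hb
  have hTA : hs (T s - A) ≠ ∞ := ((hs_sub_le _ _).trans_lt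
    (ENNReal.add_lt_top.2 ⟨(h.hs_ne_top s).lt_top, h.hs_lim_ne_top.lt_top⟩)).ne
  have hSB : hs (S s - B) ≠ ∞ := ((hs_sub_le _ _).trans_lt
    (ENNReal.add_lt_top.2 ⟨(h'.hs_ne_top s).lt_top, h'.hs_lim_ne_top.lt_top⟩)).ne
  have e1 : trace (T s * S s) - trace (A * B) =
      trace ((T s - A) * S s) + trace (A * (S s - B)) := by
    rw [← trace_add (summable_inner_mul hTA (h'.hs_ne_top s))
      (summable_inner_mul h.hs_lim_ne_top hSB),
      ← trace_sub (summable_inner_mul (h.hs_ne_top s) (h'.hs_ne_top s))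
      (summable_inner_mul h.hs_lim_ne_top h'.hs_lim_ne_top)]
    congr 1
    noncomm_ring
  rw [edist_eq_enorm_sub, e1]
  refine (enorm_add_le _ _).trans (add_le_add ((enorm_trace_mul_le _ _).trans ?_)
    (enorm_trace_mul_le _ _))
  gcongr

end HilbertSchmidt

/-! ### Products of two Hilbert-Schmidt operators are trace class; square roots. -/

section TraceClass

variable {H : Type*} [NormedAddCommGroup H] [InnerProductSpace ℂ H] [CompleteSpace H]

/-- Trace class refers to |T|, so an estimate for the diagonal of UV must be moved to |UV|. An
approximate polar decomposition does this: |T| is nearly W*T with W a contraction, and W*T = (W*U)V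
is again a product of Hilbert-Schmidt operators, with no larger bound. -/
theorem isTraceClass_mul {U V : H →L[ℂ] H} (hU : hs U ≠ ∞) (hV : hs V ≠ ∞) :
    IsTraceClass (U * V) := by
  set T := U * V with hT
  set a := CFC.abs T with ha
  have ha0 : 0 ≤ a := CFC.abs_nonneg T
  have haa : a * a = star T * T := CFC.abs_mul_abs T
  have hasa : IsSelfAdjoint a := ha0.isSelfAdjoint
  have hpos : ∀ i, 0 ≤ (⟪onBasis H i, a (onBasis H i)⟫_ℂ).re := fun i => by
    have := (ContinuousLinearMap.nonneg_iff_isPositive a).1 ha0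
    exact this.re_inner_nonneg_right _
  have hspec : ∀ x ∈ spectrum ℝ a, 0 ≤ x := fun x hx => spectrum_nonneg_of_nonneg ha0 hx
  -- The witness W = T(|T| + ε)⁻¹ replaces the partial isometry: W*W = |T|²/(|T| + ε)² ≤ 1, and W*T
  -- - |T| = -ε|T|/(|T| + ε) has norm at most ε.
  have key : ∀ ε : ℝ, 0 < ε → ∃ W : H →L[ℂ] H, ‖W‖ₑ ≤ 1 ∧ ‖star W * T - a‖ ≤ ε := by
    intro ε hε
    have hc : ContinuousOn (fun x : ℝ => (x + ε)⁻¹) (spectrum ℝ a) := by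
      refine ContinuousOn.inv₀ (by fun_prop) fun x hx => ?_
      have := hspec x hx
      positivity
    set r := cfc (fun x : ℝ => (x + ε)⁻¹) a with hr
    have hrs : star r = r := (cfc_predicate (p := IsSelfAdjoint) (fun x : ℝ => (x + ε)⁻¹) a).star_eq
    have hid : cfc (fun x : ℝ => x) a = a := cfc_id' ℝ a
    have h1 : star (T * r) * T = cfc (fun x : ℝ => (x + ε)⁻¹ * (x * x)) a := by
      rw [star_mul, hrs, mul_assoc, ← haa,
        cfc_mul (fun x : ℝ => (x + ε)⁻¹) (fun x => x * x) a hc (by fun_prop),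
        cfc_mul (fun x : ℝ => x) (fun x => x) a (by fun_prop) (by fun_prop), hid]
    refine ⟨T * r, ?_, ?_⟩
    · have h2 : star (T * r) * (T * r) = cfc (fun x : ℝ => (x + ε)⁻¹ * (x * x) * (x + ε)⁻¹) a := by
        rw [← mul_assoc, h1, cfc_mul (fun x : ℝ => (x + ε)⁻¹ * (x * x)) (fun x => (x + ε)⁻¹) a
          (hc.mul (by fun_prop)) hc]
      have h3 : ‖T * r‖ * ‖T * r‖ ≤ 1 := by
        rw [← CStarRing.norm_star_mul_self, h2]
        refine norm_cfc_le zero_le_one fun x hx => ?_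
        have hx0 := hspec x hx
        rw [Real.norm_of_nonneg (by positivity)]
        rw [mul_comm, ← mul_assoc, ← mul_inv, ← div_eq_inv_mul]
        exact div_le_one_of_le₀ (by nlinarith) (by positivity)
      rw [← ofReal_norm, ← ENNReal.ofReal_one]
      refine ENNReal.ofReal_le_ofReal ?_
      nlinarith [norm_nonneg (T * r)]
    · rw [h1]
      nth_rw 2 [← hid]
      rw [← cfc_sub (fun x : ℝ => (x + ε)⁻¹ * (x * x)) (fun x => x) a (hc.mul (by fun_prop))
        (by fun_prop)]
      refine norm_cfc_le hε.le fun x hx => ?_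
      have hx0 := hspec x hx
      have : (x + ε)⁻¹ * (x * x) - x = - (x * ε / (x + ε)) := by
        field_simp; ring
      rw [this, norm_neg, Real.norm_of_nonneg (by positivity), div_le_iff₀ (by positivity)]
      nlinarith
  have hbound : ∀ s : Finset (BasisIndex H), ∑ i ∈ s, (⟪onBasis H i, a (onBasis H i)⟫_ℂ).re ≤
      (hs U * hs V).toReal := by
    intro s
    have hfin : hs U * hs V ≠ ∞ := ENNReal.mul_ne_top hU hV
    refine le_of_forall_pos_le_add fun δ hδ => ?_
    -- The error is incurred once for each index in s, hence δ divided by the cardinality; the added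
    -- 1 covers the empty set.
    obtain ⟨W, hW, hWa⟩ := key (δ / (s.card + 1)) (by positivity)
    have hWU : hs (star W * U) ≤ hs U := by
      refine (hs_mul_left_le _ _).trans ?_
      rw [enorm_star_clm]
      exact mul_le_of_le_one_left zero_le hW
    have h1 : ∀ i ∈ s, (⟪onBasis H i, a (onBasis H i)⟫_ℂ).re ≤
        ‖⟪onBasis H i, (star W * U * V) (onBasis H i)⟫_ℂ‖ + δ / (s.card + 1) := by
      intro i _
      have e1 : ⟪onBasis H i, a (onBasis H i)⟫_ℂ = ⟪onBasis H i, (star W * U * V) (onBasis H i)⟫_ℂ -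
          ⟪onBasis H i, (star W * T - a) (onBasis H i)⟫_ℂ := by
        rw [← inner_sub_right, ← sub_apply, hT]
        congr 3
        noncomm_ring
      rw [e1]
      refine (Complex.re_le_norm _).trans ((norm_sub_le _ _).trans ?_)
      gcongr
      refine (norm_inner_le_norm _ _).trans ?_
      have hn : ‖onBasis H i‖ = 1 := (onBasis H).orthonormal.1 i
      rw [hn, one_mul]
      refine (ContinuousLinearMap.le_opNorm _ _).trans ?_
      rw [hn, mul_one]
      exact hWa
    refine (Finset.sum_le_sum h1).trans ?_
    rw [Finset.sum_add_distrib, Finset.sum_const, nsmul_eq_mul]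
    gcongr
    · have h2 : ∑ i ∈ s, ‖⟪onBasis H i, (star W * U * V) (onBasis H i)⟫_ℂ‖ₑ ≤ hs U * hs V :=
        (ENNReal.sum_le_tsum s).trans ((tsum_enorm_inner_mul_le _ _).trans (by gcongr))
      have h3 := ENNReal.toReal_mono hfin h2
      rwa [ENNReal.toReal_sum (fun _ _ => enorm_ne_top), Finset.sum_congr rfl
        (fun i _ => toReal_enorm _)] at h3
    · rw [mul_div_assoc', div_le_iff₀ (by positivity)]
      nlinarith
  exact summable_of_sum_le hpos hbound

/-- A positive trace class operator is the square of a self-adjoint Hilbert-Schmidt operator. -/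
theorem IsTraceClass.exists_sqrt {A : H →L[ℂ] H} (hA : IsTraceClass A) (h0 : 0 ≤ A) :
    ∃ R : H →L[ℂ] H, star R = R ∧ R * R = A ∧ hs R ≠ ∞ := by
  have hR : IsSelfAdjoint (CFC.sqrt A) := (CFC.sqrt_nonneg A).isSelfAdjoint
  refine ⟨CFC.sqrt A, hR.star_eq, CFC.sqrt_mul_sqrt_self A h0, ?_⟩
  rw [← isHilbertSchmidt_iff]
  rw [IsTraceClass, CFC.abs_of_nonneg A h0] at hA
  refine hA.congr fun i => ?_
  conv_lhs => rw [← CFC.sqrt_mul_sqrt_self A h0]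
  rw [mul_apply_eq_comp, ← ContinuousLinearMap.adjoint_inner_left,
    ← ContinuousLinearMap.star_eq_adjoint, hR.star_eq]
  exact inner_self_eq_norm_sq (𝕜 := ℂ) _

end TraceClass

/-! ### Newton's recursion and generating series. -/

section Newton

/-- Newton's recursion, which expresses the coefficients `D n` of `det (1 + z A)` through
`τ l = Tr (A ^ (l + 1))`. -/
def IsNewton (τ D : ℕ → ℂ) : Prop :=
  D 0 = 1 ∧ ∀ n : ℕ, ((n : ℂ) + 1) * D (n + 1) =
    ∑ l ∈ Finset.range (n + 1), (-1) ^ l * D (n - l) * τ l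

/-- Each D n is a fixed polynomial in finitely many τ l, so it depends continuously on them. -/
theorem IsNewton.tendsto {σ : Type*} {f : Filter σ} {τs Ds : σ → ℕ → ℂ} {τ D : ℕ → ℂ}
    (hs : ∀ s, IsNewton (τs s) (Ds s)) (h : IsNewton τ D)
    (hτ : ∀ l, Tendsto (fun s => τs s l) f (𝓝 (τ l))) (n : ℕ) :
    Tendsto (fun s => Ds s n) f (𝓝 (D n)) := by
  induction n using Nat.strong_induction_on with
  | _ n ih =>
    cases n with
    | zero => simp only [(hs _).1, h.1]; exact tendsto_const_nhds
    | succ n =>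
      have hn : (n : ℂ) + 1 ≠ 0 := Nat.cast_add_one_ne_zero n
      have e : ∀ {τ D : ℕ → ℂ}, IsNewton τ D → D (n + 1) =
          ((n : ℂ) + 1)⁻¹ * ∑ l ∈ Finset.range (n + 1), (-1) ^ l * D (n - l) * τ l := by
        intro τ D h
        rw [← h.2, inv_mul_cancel_left₀ hn]
      simp only [e h, fun s => e (hs s)]
      exact (tendsto_finsetSum _ fun l _ =>
        ((ih (n - l) (by omega)).const_mul _).mul (hτ l)).const_mul _

open PowerSeries in
-- The recursion is the coefficientwise form of the logarithmic derivative identity D' = D · ∑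
-- (-1)^l τ_l z^l.
theorem isNewton_iff_derivative {τ D : ℕ → ℂ} :
    IsNewton τ D ↔ D 0 = 1 ∧ derivative ℂ (PowerSeries.mk D) =
      PowerSeries.mk D * PowerSeries.mk fun l => (-1) ^ l * τ l := by
  refine and_congr_right fun _ => ?_
  rw [PowerSeries.ext_iff]
  refine forall_congr' fun n => ?_
  rw [PowerSeries.coeff_derivative, mul_comm (PowerSeries.mk D), PowerSeries.coeff_mul,
    Finset.Nat.sum_antidiagonal_eq_sum_range_succ_mk]
  simp only [coeff_mk, mul_comm (D (n + 1))]
  have e : ∑ l ∈ Finset.range n.succ, (-1) ^ l * τ l * D (n - l) =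
      ∑ l ∈ Finset.range (n + 1), (-1) ^ l * D (n - l) * τ l :=
    Finset.sum_congr rfl fun l _ => by ring
  rw [e, eq_comm]

/-- Multiplying `∑ D n z ^ n` by `exp (c z)` adds `c` to the first trace. -/
theorem IsNewton.mul_exp {τ D : ℕ → ℂ} (h : IsNewton τ D) (c : ℂ) :
    IsNewton (fun l => τ l + if l = 0 then c else 0)
      (fun n => ∑ p ∈ Finset.HasAntidiagonal.antidiagonal n,
        D p.1 * (c ^ p.2 / p.2.factorial)) := by
  rw [isNewton_iff_derivative] at h ⊢
  refine ⟨by simp [h.1], ?_⟩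
  set E : PowerSeries ℂ := PowerSeries.mk fun n => c ^ n / n.factorial with hE
  have h1 : (PowerSeries.mk fun n => ∑ p ∈ Finset.HasAntidiagonal.antidiagonal n,
      D p.1 * (c ^ p.2 / p.2.factorial)) = PowerSeries.mk D * E := by
    ext n; simp [PowerSeries.coeff_mul, hE]
  have h2 : PowerSeries.derivative ℂ E = PowerSeries.C c * E := by
    ext n
    rw [PowerSeries.coeff_derivative, PowerSeries.coeff_C_mul]
    simp only [hE, PowerSeries.coeff_mk, Nat.factorial_succ, Nat.cast_mul, pow_succ]
    have hn : (n : ℂ) + 1 ≠ 0 := Nat.cast_add_one_ne_zero n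
    have hf : (n.factorial : ℂ) ≠ 0 := Nat.cast_ne_zero.2 n.factorial_ne_zero
    push_cast
    field_simp
  have h3 : (PowerSeries.mk fun l => (-1 : ℂ) ^ l * (τ l + if l = 0 then c else 0)) =
      (PowerSeries.mk fun l => (-1) ^ l * τ l) + PowerSeries.C c := by
    ext n
    rw [PowerSeries.coeff_mk, map_add, PowerSeries.coeff_mk, PowerSeries.coeff_C]
    split_ifs with hn <;> simp [hn]
  rw [h1, h3, Derivation.leibniz, h.2, h2, smul_eq_mul, smul_eq_mul]
  ring

end Newton

/-! ### Finite matrices: Newton's identities and a size-independent determinant bound. -/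

section Matrix
open Polynomial Matrix

variable {n : Type*} [Fintype n] [DecidableEq n]

/-- Jacobi's formula: differentiate one row at a time, then expand each determinant along the
differentiated row. -/
theorem derivative_det {R : Type*} [CommRing R] (A : Matrix n n R[X]) :
    derivative A.det = (A.adjugate * A.map derivative).trace := by
  have h1 : derivative A.det = ∑ i, (A.updateRow i (fun j => derivative (A i j))).det := by
    simp only [det_apply', derivative_sum]
    rw [Finset.sum_comm]
    refine Finset.sum_congr rfl fun σ _ => ?_
    have hd : derivative (((Equiv.Perm.sign σ : ℤ) : R[X])) = 0 := derivative_intCast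
    rw [derivative_mul, hd, zero_mul, zero_add, ← Finset.mul_sum, derivative_prod_finset]
    congr 1
    rw [← Equiv.sum_comp σ (fun i => ∏ j, A.updateRow i (fun j => derivative (A i j)) (σ j) j)]
    refine Finset.sum_congr rfl fun i _ => ?_
    have hself : A.updateRow (σ i) (fun j => derivative (A (σ i) j)) (σ i) i =
        derivative (A (σ i) i) := by rw [updateRow_self]
    rw [← Finset.mul_prod_erase _ _ (Finset.mem_univ i), hself, mul_comm]
    congr 1
    refine Finset.prod_congr rfl fun j hj => ?_
    rw [updateRow_ne]
    exact fun h => (Finset.ne_of_mem_erase hj) (σ.injective h)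
  rw [h1, Matrix.trace_mul_comm, Matrix.trace]
  refine Finset.sum_congr rfl fun i _ => ?_
  rw [diag_apply, Matrix.mul_apply]
  have := det_eq_sum_mul_adjugate_row (A.updateRow i (fun j => derivative (A i j))) i
  rw [this]
  refine Finset.sum_congr rfl fun j _ => ?_
  rw [updateRow_self, map_apply, adjugate_apply, adjugate_apply, updateRow_idem]

/-- Let Q_k be the matrix coefficients of the adjugate of 1 + XM and p_k the coefficients of its
determinant. From adj(A) A = det(A) one gets Q_{k+1} = p_{k+1} - Q_k M, hence Q_k = ∑ (-1)^l p_{k-l}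
M^l. Jacobi's formula gives (k+1) p_{k+1} = Tr(Q_k M). -/
theorem isNewton_coeff_det (M : Matrix n n ℂ) :
    IsNewton (fun l => (M ^ (l + 1)).trace)
      (fun k => (det (1 + (X : ℂ[X]) • M.map C)).coeff k) := by
  set A : Matrix n n ℂ[X] := 1 + (X : ℂ[X]) • M.map C with hA
  set p := fun k => A.det.coeff k with hp
  let Q : ℕ → Matrix n n ℂ := fun k => Matrix.of fun i j => (A.adjugate i j).coeff k
  have hadj : A.adjugate + (X : ℂ[X]) • (A.adjugate * M.map C) = A.det • (1 : Matrix n n ℂ[X]) := by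
    rw [← adjugate_mul]
    rw [← Algebra.mul_smul_comm]
    nth_rw 4 [hA]
    rw [mul_add, mul_one]
  have hmul : ∀ i j k, ((A.adjugate * M.map C) i j).coeff k = (Q k * M) i j := by
    intro i j k
    simp [Matrix.mul_apply, Q]
  have hone : ∀ i j k,
      ((A.det • (1 : Matrix n n ℂ[X])) i j).coeff k = (p k • (1 : Matrix n n ℂ)) i j := by
    intro i j k
    by_cases hij : i = j <;> simp [hij, hp]
  have hQ0 : Q 0 = p 0 • 1 := by
    ext i j
    have := congrArg (fun B : Matrix n n ℂ[X] => (B i j).coeff 0) hadj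
    simp only [hone] at this
    rw [← this]
    simp [Q]
  have hQs : ∀ k, Q (k + 1) = p (k + 1) • 1 - Q k * M := by
    intro k
    ext i j
    have := congrArg (fun B : Matrix n n ℂ[X] => (B i j).coeff (k + 1)) hadj
    simp only [hone] at this
    rw [Matrix.sub_apply, ← this, ← hmul]
    simp [Q]
  have hQ : ∀ k, Q k = ∑ l ∈ Finset.range (k + 1), ((-1) ^ l * p (k - l)) • M ^ l := by
    intro k
    induction k with
    | zero => simp [hQ0]
    | succ k ih =>
      rw [hQs, ih, Finset.sum_range_succ' _ (k + 1), Finset.sum_mul, sub_eq_add_neg, add_comm,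
        ← Finset.sum_neg_distrib]
      congr 1
      · refine Finset.sum_congr rfl fun l _ => ?_
        rw [smul_mul_assoc, ← pow_succ, ← neg_smul, Nat.add_sub_add_right]
        congr 1
        ring
      · simp
  refine ⟨?_, fun k => ?_⟩
  · change A.det.coeff 0 = 1
    rw [coeff_zero_eq_eval_zero, ← coe_evalRingHom, RingHom.map_det]
    convert det_one (R := ℂ) (n := n)
    ext i j
    by_cases hij : i = j <;> simp [hA, hij, Matrix.one_apply]
  · have hder : A.map derivative = M.map C := by
      ext i j : 1
      by_cases hij : i = j <;> simp [hA, hij]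
    have h1 : ((k : ℂ) + 1) * p (k + 1) = (Q k * M).trace := by
      rw [mul_comm, hp, ← coeff_derivative, derivative_det, hder, Matrix.trace, Matrix.trace,
        finsetSum_coeff]
      exact Finset.sum_congr rfl fun i _ => hmul i i k
    rw [h1, hQ, Finset.sum_mul, Matrix.trace_sum]
    refine Finset.sum_congr rfl fun l _ => ?_
    rw [smul_mul_assoc, ← pow_succ, Matrix.trace_smul, smul_eq_mul]

theorem hasSum_coeff_det (M : Matrix n n ℂ) (z : ℂ) :
    HasSum (fun k => (det (1 + (X : ℂ[X]) • M.map C)).coeff k * z ^ k) (det (1 + z • M)) ∧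
    Summable (fun k => ‖(det (1 + (X : ℂ[X]) • M.map C)).coeff k * z ^ k‖) := by
  set q := det (1 + (X : ℂ[X]) • M.map C) with hq
  have h0 : ∀ k ∉ q.support, q.coeff k * z ^ k = 0 := fun k hk => by
    rw [notMem_support_iff.1 hk, zero_mul]
  constructor
  · have h1 : det (1 + z • M) = q.eval z := by
      rw [hq, ← coe_evalRingHom, RingHom.map_det]
      congr 1
      ext i j
      by_cases hij : i = j <;> simp [hij, mul_comm z]
    rw [h1, eval_eq_sum, Polynomial.sum]
    exact hasSum_sum_of_ne_finset_zero h0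
  · exact summable_of_ne_finset_zero (s := q.support) fun k hk => by rw [h0 k hk, norm_zero]

/-- The estimate `|det (1 + M)| ≤ exp (Re Tr M + ‖M‖²/2)`, with the Hilbert-Schmidt norm. -/
theorem norm_det_one_add_sq_le (M : Matrix n n ℂ) :
    ‖det (1 + M)‖ ^ 2 ≤ Real.exp (2 * M.trace.re + ∑ i, ∑ j, ‖M i j‖ ^ 2) := by
  -- P has determinant |det(1 + M)|², and its trace exceeds the size of the matrix by exactly the
  -- exponent. The bound then reduces to λ ≤ e^{λ-1} for each eigenvalue of P.
  set P : Matrix n n ℂ := (1 + M)ᴴ * (1 + M) with hP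
  have hpsd : P.PosSemidef := posSemidef_conjTranspose_mul_self _
  have h1 : P.det = ((‖det (1 + M)‖ ^ 2 : ℝ) : ℂ) := by
    rw [hP, det_mul, det_conjTranspose, mul_comm]
    simp [Complex.mul_conj, Complex.normSq_eq_norm_sq]
  have h2 : P.trace = ((Fintype.card n + (2 * M.trace.re + ∑ i, ∑ j, ‖M i j‖ ^ 2) : ℝ) : ℂ) := by
    have e : P = 1 + M + Mᴴ + Mᴴ * M := by
      rw [hP, conjTranspose_add, conjTranspose_one]; noncomm_ring
    have e2 : (Mᴴ * M).trace = ((∑ i, ∑ j, ‖M i j‖ ^ 2 : ℝ) : ℂ) := by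
      rw [Finset.sum_comm]
      simp only [Matrix.trace, diag_apply, Matrix.mul_apply, conjTranspose_apply]
      push_cast
      refine Finset.sum_congr rfl fun i _ => Finset.sum_congr rfl fun j _ => ?_
      rw [mul_comm]
      exact (Complex.mul_conj _).trans (by rw [Complex.normSq_eq_norm_sq]; push_cast; rfl)
    rw [e, Matrix.trace_add, Matrix.trace_add, Matrix.trace_add, Matrix.trace_one, e2,
      Matrix.trace_conjTranspose]
    have := Complex.add_conj M.trace
    push_cast
    rw [add_assoc (Fintype.card n : ℂ) M.trace,
      show star M.trace = (starRingEnd ℂ) M.trace from rfl, this]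
    push_cast
    ring
  have h3 := hpsd.isHermitian.det_eq_prod_eigenvalues
  have h4 := hpsd.isHermitian.trace_eq_sum_eigenvalues
  rw [h1] at h3
  rw [h2] at h4
  have h3' : ‖det (1 + M)‖ ^ 2 = ∏ i, hpsd.isHermitian.eigenvalues i := by
    apply Complex.ofReal_injective; rw [h3]; push_cast; rfl
  have h4' : Fintype.card n + (2 * M.trace.re + ∑ i, ∑ j, ‖M i j‖ ^ 2) =
      ∑ i, hpsd.isHermitian.eigenvalues i := by
    apply Complex.ofReal_injective; rw [h4]; push_cast; rfl
  have h5 : 2 * M.trace.re + ∑ i, ∑ j, ‖M i j‖ ^ 2 = ∑ i, (hpsd.isHermitian.eigenvalues i - 1) := by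
    rw [Finset.sum_sub_distrib, ← h4']; simp
  rw [h3', h5, Real.exp_sum]
  refine Finset.prod_le_prod (fun i _ => hpsd.eigenvalues_nonneg i) fun i _ => ?_
  have := Real.add_one_le_exp (hpsd.isHermitian.eigenvalues i - 1)
  linarith

/-- The exponential factor cancels Tr M, which may diverge as the matrices grow, and leaves only t
and the Hilbert-Schmidt norm. -/
theorem norm_det_mul_exp_le (M : Matrix n n ℂ) (t : ℂ) :
    ‖det (1 + M) * Complex.exp (t - M.trace)‖ ≤
      Real.exp (t.re + (∑ i, ∑ j, ‖M i j‖ ^ 2) / 2) := by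
  rw [norm_mul, Complex.norm_exp]
  have h := norm_det_one_add_sq_le M
  have h2 : ‖det (1 + M)‖ ≤ Real.exp (M.trace.re + (∑ i, ∑ j, ‖M i j‖ ^ 2) / 2) := by
    refine (sq_le_sq₀ (norm_nonneg _) (Real.exp_pos _).le).1 ?_
    rw [← Real.exp_nat_mul]
    refine h.trans (le_of_eq ?_)
    congr 1; push_cast; ring
  calc _ ≤ Real.exp (M.trace.re + (∑ i, ∑ j, ‖M i j‖ ^ 2) / 2) * Real.exp ((t - M.trace).re) := by
        gcongr
    _ = _ := by rw [← Real.exp_add]; congr 1; simp; ring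

end Matrix

/-! ### Limits of regularised determinants of finite matrices. -/

section FiniteApproximation

open Polynomial in
/-- Cauchy's estimate for the coefficients of an everywhere convergent power series. -/
theorem norm_coeff_le_of_hasSum {D : ℕ → ℂ} {G : ℂ → ℂ}
    (h : ∀ z, HasSum (fun n => D n * z ^ n) (G z)) {R C : ℝ} (hR : 0 < R)
    (hC : ∀ z, ‖z‖ = R → ‖G z‖ ≤ C) (n : ℕ) : ‖D n‖ ≤ C / R ^ n := by
  have hrad : ∀ r : NNReal, (r : ℝ≥0∞) ≤ (FormalMultilinearSeries.ofScalars ℂ D).radius := by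
    intro r
    refine FormalMultilinearSeries.le_radius_of_tendsto (l := 0) _ ?_
    have := (h r).summable.tendsto_atTop_zero.norm
    simp only [norm_mul, norm_pow, norm_zero] at this
    simpa [FormalMultilinearSeries.ofScalars_norm] using this
  have htop : (FormalMultilinearSeries.ofScalars ℂ D).radius = ∞ :=
    ENNReal.eq_top_of_forall_nnreal_le hrad
  have hG : HasFPowerSeriesOnBall G (FormalMultilinearSeries.ofScalars ℂ D) 0 ∞ := by
    refine ⟨htop.ge, by simp, fun {y} _ => ?_⟩
    rw [zero_add]
    convert! h y using 2 with n
    rw [FormalMultilinearSeries.ofScalars_apply_eq, smul_eq_mul]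
  have hd : Differentiable ℂ G := by
    have := hG.differentiableOn
    rw [Metric.eball_top, differentiableOn_univ] at this
    exact this
  lift R to NNReal using hR.le
  have hcau := (hd.differentiableOn (s := Metric.closedBall 0 R)).hasFPowerSeriesOnBall
    (by exact_mod_cast hR)
  -- Uniqueness of the expansion at 0 identifies the D n with the Cauchy integrals of G over the
  -- circle of radius R.
  have heq := hG.hasFPowerSeriesAt.eq_formalMultilinearSeries hcau.hasFPowerSeriesAt
  have hn := norm_cauchyPowerSeries_le G 0 R n
  rw [← heq, FormalMultilinearSeries.ofScalars_norm, abs_of_pos hR] at hn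
  refine hn.trans ?_
  rw [inv_pow, ← div_eq_mul_inv]
  gcongr
  have h2 : ‖∫ θ in (0 : ℝ)..2 * Real.pi, ‖G (circleMap 0 R θ)‖‖ ≤ C * |2 * Real.pi - 0| := by
    refine intervalIntegral.norm_integral_le_of_norm_le_const fun θ _ => ?_
    rw [norm_norm]
    exact hC _ (by simp)
  rw [sub_zero, abs_of_pos Real.two_pi_pos] at h2
  rw [inv_mul_le_iff₀ Real.two_pi_pos, mul_comm (2 * Real.pi)]
  exact (Real.le_norm_self _).trans h2

open Polynomial in
/-- The coefficients of the entire function `det (1 + z M) exp (c z)`. -/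
theorem exists_isNewton_hasSum {n : Type*} [Fintype n] [DecidableEq n] (M : Matrix n n ℂ) (c : ℂ) :
    ∃ D : ℕ → ℂ, IsNewton (fun l => (M ^ (l + 1)).trace + if l = 0 then c else 0) D ∧
      ∀ z, HasSum (fun k => D k * z ^ k) ((1 + z • M).det * Complex.exp (z * c)) := by
  refine ⟨_, (isNewton_coeff_det M).mul_exp c, fun z => ?_⟩
  obtain ⟨h1, h1'⟩ := hasSum_coeff_det M z
  have h2 : HasSum (fun k => (z * c) ^ k / k.factorial) (Complex.exp (z * c)) := by
    rw [Complex.exp_eq_exp_ℂ]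
    exact NormedSpace.expSeries_div_hasSum_exp _
  have h2' : Summable (fun k => ‖(z * c) ^ k / k.factorial‖) := h2.summable.norm
  have h3 := tsum_mul_tsum_eq_tsum_sum_antidiagonal_of_summable_norm h1' h2'
  have h4 := (summable_norm_sum_mul_antidiagonal_of_summable_norm h1' h2').of_norm
  rw [h1.tsum_eq, h2.tsum_eq] at h3
  rw [h3]
  convert! h4.hasSum using 2 with k
  rw [Finset.sum_mul]
  refine Finset.sum_congr rfl fun p hp => ?_
  rw [← Finset.HasAntidiagonal.mem_antidiagonal.1 hp, mul_pow, pow_add]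
  ring

/-- If finite matrices `M s` are bounded in the Hilbert-Schmidt norm, their regularised traces `t s`
converge to `τ 0`, and the traces of `(M s) ^ (l + 1)` converge to `τ l` for `l ≥ 1`, then
the determinants `det (1 + M s) exp (t s - Tr (M s))` converge to `∑ D n`. -/
theorem IsNewton.tendsto_det {σ : Type*} {f : Filter σ} [f.NeBot] {ι : σ → Type*}
    [∀ s, Fintype (ι s)] [∀ s, DecidableEq (ι s)] (M : ∀ s, Matrix (ι s) (ι s) ℂ) (t : σ → ℂ)
    {τ D : ℕ → ℂ} (hD : IsNewton τ D) (ht : Tendsto t f (𝓝 (τ 0)))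
    (hτ : ∀ l, Tendsto (fun s => (M s ^ (l + 2)).trace) f (𝓝 (τ (l + 1)))) {C : ℝ}
    (hC : ∀ᶠ s in f, ∑ i, ∑ j, ‖M s i j‖ ^ 2 ≤ C) :
    Summable D ∧ Tendsto (fun s => (1 + M s).det * Complex.exp (t s - (M s).trace)) f
      (𝓝 (∑' n, D n)) := by
  choose Ds hDs hsum using fun s => exists_isNewton_hasSum (M s) (t s - (M s).trace)
  have hlim : ∀ n, Tendsto (fun s => Ds s n) f (𝓝 (D n)) := by
    refine IsNewton.tendsto hDs hD fun l => ?_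
    cases l with
    | zero => simpa using ht
    | succ l => simpa using hτ l
  -- K bounds the entire functions on |z| = 2: there Re(zt) ≤ 2(‖τ 0‖ + 1) eventually, and |z|²C/2 =
  -- 2C. A radius larger than 1 makes the Cauchy bounds K/2ⁿ summable.
  set K := Real.exp (2 * (‖τ 0‖ + 1) + 2 * C) with hK
  have hb : ∀ᶠ s in f, ∀ n, ‖Ds s n‖ ≤ K / 2 ^ n := by
    have h1 : ∀ᶠ s in f, ‖t s‖ ≤ ‖τ 0‖ + 1 :=
      ht.norm.eventually (ge_mem_nhds (lt_add_one _))
    filter_upwards [hC, h1] with s hs h1 n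
    refine norm_coeff_le_of_hasSum (hsum s) two_pos (fun z hz => ?_) n
    have h2 := norm_det_mul_exp_le (z • M s) (z * t s)
    rw [Matrix.trace_smul, smul_eq_mul, ← mul_sub] at h2
    refine h2.trans (Real.exp_le_exp.2 ?_)
    have h3 : (z * t s).re ≤ 2 * (‖τ 0‖ + 1) := by
      refine (Complex.re_le_norm _).trans ?_
      rw [norm_mul, hz]
      gcongr
    have h4 : ∑ i, ∑ j, ‖(z • M s) i j‖ ^ 2 = 4 * ∑ i, ∑ j, ‖M s i j‖ ^ 2 := by
      simp_rw [Finset.mul_sum, Matrix.smul_apply, norm_smul, hz, mul_pow]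
      norm_num
    rw [h4]
    linarith
  have hgeo : Summable fun n : ℕ => K / 2 ^ n := by
    simpa [div_eq_mul_inv] using (summable_geometric_two.mul_left K)
  have hb' : ∀ n, ‖D n‖ ≤ K / 2 ^ n := fun n =>
    le_of_tendsto (hlim n).norm (hb.mono fun s hs => hs n)
  refine ⟨Summable.of_norm_bounded hgeo hb', ?_⟩
  have h5 := tendsto_tsum_of_dominated_convergence hgeo hlim hb
  refine h5.congr fun s => ?_
  simpa using (hsum s 1).tsum_eq

section DetExp
attribute [local instance] Matrix.linftyOpNormedRing Matrix.linftyOpNormedAlgebra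

variable {n : Type*} [Fintype n] [DecidableEq n]

theorem hasDerivAt_det_one_add_smul (M : Matrix n n ℂ) :
    HasDerivAt (fun z : ℂ => (1 + z • M).det) M.trace 0 := by
  have h : (fun z : ℂ => (1 + z • M).det) = fun z => (Polynomial.eval z
      (Matrix.det (1 + (Polynomial.X : Polynomial ℂ) • M.map Polynomial.C))) := by
    funext z
    rw [← Polynomial.coe_evalRingHom, RingHom.map_det]
    congr 1
    ext i j
    by_cases hij : i = j <;> simp [hij, mul_comm z]
  rw [h, ← Matrix.derivative_det_one_add_X_smul]
  exact Polynomial.hasDerivAt _ _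

theorem differentiable_det : Differentiable ℂ (Matrix.det : Matrix n n ℂ → ℂ) := by
  have he : ∀ i j, ContDiff ℂ 1 (fun A : Matrix n n ℂ => A i j) := fun i j =>
    ((Matrix.entryLinearMap ℂ ℂ i j).toContinuousLinearMap).contDiff
  have : (Matrix.det : Matrix n n ℂ → ℂ) =
      fun A => ∑ σ : Equiv.Perm n, ((Equiv.Perm.sign σ : ℤ) : ℂ) * ∏ i, A (σ i) i := by
    funext A; exact Matrix.det_apply' A
  rw [this]
  refine Differentiable.fun_sum fun σ _ => Differentiable.const_mul ?_ _
  exact (contDiff_prod (n := 1) fun i _ => he (σ i) i).differentiable one_ne_zero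

/-- The function z ↦ det exp(zM) is multiplicative with derivative Tr M at 0, so it solves f' = f ·
Tr M, and f(z)e^{-z Tr M} is constant. -/
theorem det_exp (M : Matrix n n ℂ) :
    (NormedSpace.exp M).det = Complex.exp M.trace := by
  -- The curves exp(zM) and 1 + zM pass through 1 with the same velocity M, so the known derivative
  -- along the second is also the derivative along the first.
  have h0 : HasDerivAt (fun z : ℂ => (NormedSpace.exp (z • M)).det) M.trace 0 := by
    have h1 : HasDerivAt (fun z : ℂ => NormedSpace.exp (z • M)) M 0 := by
      have := hasDerivAt_exp_smul_const (𝕂 := ℂ) M (0 : ℂ)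
      simp only [zero_smul, NormedSpace.exp_zero, one_mul] at this
      exact this
    have h2 : HasDerivAt (fun z : ℂ => 1 + z • M) M 0 := by
      have := ((hasDerivAt_id (0 : ℂ)).smul_const M).const_add 1
      rw [one_smul] at this
      exact this
    have hd1 : HasFDerivAt (Matrix.det : Matrix n n ℂ → ℂ)
        (fderiv ℂ Matrix.det (1 : Matrix n n ℂ)) (NormedSpace.exp ((0 : ℂ) • M)) := by
      rw [zero_smul, NormedSpace.exp_zero]
      exact (differentiable_det 1).hasFDerivAt
    have hd2 : HasFDerivAt (Matrix.det : Matrix n n ℂ → ℂ)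
        (fderiv ℂ Matrix.det (1 : Matrix n n ℂ)) (1 + (0 : ℂ) • M) := by
      rw [zero_smul, add_zero]
      exact (differentiable_det 1).hasFDerivAt
    have h3 := hd1.comp_hasDerivAt (0 : ℂ) h1
    have h4 := hd2.comp_hasDerivAt (0 : ℂ) h2
    rw [HasDerivAt.unique h4 (hasDerivAt_det_one_add_smul M)] at h3
    exact h3
  have hmul : ∀ z w : ℂ, (NormedSpace.exp ((z + w) • M)).det =
      (NormedSpace.exp (z • M)).det * (NormedSpace.exp (w • M)).det := by
    intro z w
    rw [add_smul, Matrix.exp_add_of_commute _ _ ((Commute.refl M).smul_left z |>.smul_right w),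
      Matrix.det_mul]
  have hder : ∀ z : ℂ, HasDerivAt (fun z : ℂ => (NormedSpace.exp (z • M)).det)
      ((NormedSpace.exp (z • M)).det * M.trace) z := by
    intro z
    have h1 : HasDerivAt (fun w : ℂ => (NormedSpace.exp (z • M)).det *
        (NormedSpace.exp ((w - z) • M)).det) ((NormedSpace.exp (z • M)).det * M.trace) z := by
      refine HasDerivAt.const_mul _ ?_
      have h0' : HasDerivAt (fun z : ℂ => (NormedSpace.exp (z • M)).det) M.trace (z - z) := by
        rwa [sub_self]
      exact h0'.comp_sub_const z z
    refine h1.congr_of_eventuallyEq (Eventually.of_forall fun w => ?_)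
    simp only
    rw [← hmul, add_sub_cancel]
  have hconst : ∀ z : ℂ, HasDerivAt (fun z : ℂ => (NormedSpace.exp (z • M)).det *
      Complex.exp (-(z * M.trace))) 0 z := by
    intro z
    have h2 : HasDerivAt (fun z : ℂ => Complex.exp (-(z * M.trace)))
        (Complex.exp (-(z * M.trace)) * -(1 * M.trace)) z :=
      (((hasDerivAt_id z).mul_const _).neg).cexp
    convert! (hder z).mul h2 using 1
    ring
  have h1 := is_const_of_deriv_eq_zero (fun z => (hconst z).differentiableAt)
    (fun z => (hconst z).deriv) 1 0
  simp only [one_smul, one_mul, zero_smul, zero_mul, NormedSpace.exp_zero, Matrix.det_one, neg_zero,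
    Complex.exp_zero] at h1
  rw [Complex.exp_neg] at h1
  exact (mul_inv_eq_one₀ (Complex.exp_ne_zero _)).1 h1

end DetExp
end FiniteApproximation

/-! ### The regularisation (1 + T)e^{-T} - 1. -/

section RegExp

/-- The coefficients of `((1 + z) e^{-z} - 1) / z ^ 2`. -/
def regCoeff (n : ℕ) : ℂ := (-1) ^ n / (n + 2).factorial - (-1) ^ n / (n + 1).factorial

theorem norm_regCoeff_le (n : ℕ) : ‖regCoeff n‖ ≤ 2 / n.factorial := by
  have h : ∀ k, n ≤ k → ‖(-1 : ℂ) ^ n / k.factorial‖ ≤ 1 / n.factorial := by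
    intro k hk
    rw [norm_div, norm_pow, norm_neg, norm_one, one_pow, Complex.norm_natCast]
    have := Nat.factorial_le hk
    gcongr
  have h1 := h (n + 2) (by omega)
  have h2 := h (n + 1) (by omega)
  refine (norm_sub_le _ _).trans ((add_le_add h1 h2).trans (le_of_eq ?_))
  ring

variable {𝔸 : Type*} [NormedRing 𝔸] [NormedAlgebra ℂ 𝔸] [CompleteSpace 𝔸]

/-- `((1 + T) e^{-T} - 1) / T ^ 2` as a power series. -/
def regQuot (T : 𝔸) : 𝔸 := ∑' n, regCoeff n • T ^ n

omit [CompleteSpace 𝔸] in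
theorem norm_regCoeff_smul_le {T : 𝔸} {r : ℝ} (hr : ‖T‖ ≤ r) (n : ℕ) :
    ‖regCoeff n • T ^ n‖ ≤ 2 * (‖(1 : 𝔸)‖ + 1) * (r ^ n / n.factorial) := by
  -- The factor ‖1‖ + 1 covers both n = 0, where T^0 = 1 need not have norm 1, and n ≥ 1, where a
  -- factor 1 is enough.
  have h : ‖T ^ n‖ ≤ (‖(1 : 𝔸)‖ + 1) * r ^ n := by
    rcases n.eq_zero_or_pos with rfl | hn
    · simp
    · calc ‖T ^ n‖ ≤ 1 * r ^ n := by
            rw [one_mul]; exact (norm_pow_le' _ hn).trans (by gcongr)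
        _ ≤ _ := by
          have : 0 ≤ r := (norm_nonneg _).trans hr
          gcongr
          linarith [norm_nonneg (1 : 𝔸)]
  rw [norm_smul]
  calc _ ≤ 2 / n.factorial * ((‖(1 : 𝔸)‖ + 1) * r ^ n) :=
        mul_le_mul (norm_regCoeff_le n) h (norm_nonneg _) (by positivity)
    _ = _ := by ring

theorem summable_regQuot (T : 𝔸) : Summable fun n => regCoeff n • T ^ n :=
  Summable.of_norm_bounded ((Real.summable_pow_div_factorial ‖T‖).mul_left (2 * (‖(1 : 𝔸)‖ + 1)))
    (norm_regCoeff_smul_le le_rfl)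

theorem tendsto_regQuot {σ : Type*} {f : Filter σ} {T : σ → 𝔸} {A : 𝔸}
    (h : Tendsto T f (𝓝 A)) : Tendsto (fun s => regQuot (T s)) f (𝓝 (regQuot A)) := by
  refine tendsto_tsum_of_dominated_convergence
    ((Real.summable_pow_div_factorial (‖A‖ + 1)).mul_left (2 * (‖(1 : 𝔸)‖ + 1)))
    (fun n => (h.pow n).const_smul _) ?_
  filter_upwards [h.norm.eventually (ge_mem_nhds (lt_add_one _))] with s hs n
  exact norm_regCoeff_smul_le hs n

/-- `(1 + T) e^{-T} - 1`. -/
def regExp (T : 𝔸) : 𝔸 := (1 + T) * NormedSpace.exp (-T) - 1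

/-- The linear terms of (1 + T)e^{-T} cancel, so T² splits off. Bracketed as T times (T times a
series), this is a product of two Hilbert-Schmidt operators whenever T is one, so the trace lemmas
apply. -/
theorem regExp_eq (T : 𝔸) : regExp T = T * (T * regQuot T) := by
  have h := NormedSpace.exp_series_hasSum_exp' (𝕂 := ℂ) (-T)
  set E := NormedSpace.exp (-T) with hE
  set a : ℕ → 𝔸 := fun n => ((n.factorial : ℂ)⁻¹) • (-T) ^ n with ha
  have h1 : HasSum (fun n => T * a (n + 1)) (T * (E - 1)) := by
    refine HasSum.mul_left T ?_
    have := (hasSum_nat_add_iff' 1).2 h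
    simpa [ha] using this
  have h2 : HasSum (fun n => a (n + 2)) (E - (1 - T)) := by
    have := (hasSum_nat_add_iff' 2).2 h
    simpa [ha, Finset.sum_range_succ, sub_eq_add_neg] using this
  have h3 : HasSum (fun n => T * (T * (regCoeff n • T ^ n))) (T * (T * regQuot T)) :=
    ((summable_regQuot T).hasSum.mul_left T).mul_left T
  have h4 : ∀ n, a (n + 2) + T * a (n + 1) = T * (T * (regCoeff n • T ^ n)) := by
    intro n
    have e : ∀ k, (-T) ^ k = (-1 : ℂ) ^ k • T ^ k := fun k => by
      rw [← smul_pow, neg_one_smul]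
    simp only [ha, e, mul_smul_comm, smul_smul, ← pow_succ']
    rw [← add_smul]
    congr 1
    simp only [regCoeff]
    ring
  have h5 := h2.add h1
  simp only [h4] at h5
  rw [← h5.unique h3, regExp]
  noncomm_ring

end RegExp

/-! ### Compression to finitely many basis vectors and passage to the limit. -/

section Compression
open scoped Classical

variable {H : Type*} [NormedAddCommGroup H] [InnerProductSpace ℂ H] [CompleteSpace H]

/-- The orthogonal projection onto the span of finitely many basis vectors. -/
def finProj (s : Finset (BasisIndex H)) : H →L[ℂ] H :=
  ∑ i ∈ s, (innerSL ℂ (onBasis H i)).smulRight (onBasis H i)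

theorem finProj_apply (s : Finset (BasisIndex H)) (x : H) :
    finProj s x = ∑ i ∈ s, ⟪onBasis H i, x⟫_ℂ • onBasis H i := by
  simp [finProj]

theorem inner_finProj (s : Finset (BasisIndex H)) (x : H) (i : BasisIndex H) :
    ⟪onBasis H i, finProj s x⟫_ℂ = if i ∈ s then ⟪onBasis H i, x⟫_ℂ else 0 := by
  rw [finProj_apply, inner_sum]
  simp [inner_smul_right, orthonormal_iff_ite.1 (onBasis H).orthonormal]

theorem star_finProj (s : Finset (BasisIndex H)) : star (finProj s) = finProj s := by
  rw [ContinuousLinearMap.star_eq_adjoint, eq_comm, ContinuousLinearMap.eq_adjoint_iff]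
  intro x y
  simp only [finProj_apply, sum_inner, inner_sum, inner_smul_left, inner_smul_right]
  refine Finset.sum_congr rfl fun i _ => ?_
  rw [inner_conj_symm, mul_comm]

theorem finProj_onBasis (s : Finset (BasisIndex H)) (i : BasisIndex H) :
    finProj s (onBasis H i) = if i ∈ s then onBasis H i else 0 := by
  rw [finProj_apply]
  simp [orthonormal_iff_ite.1 (onBasis H).orthonormal]

/-- The squared norm of the difference is the tail ∑_{i ∉ s} ‖B* e_i‖² of a convergent series. -/
theorem hsTendsto_finProj_mul {B : H →L[ℂ] H} (hB : hs B ≠ ∞) :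
    HSTendsto (fun s => finProj s * B) atTop B := by
  refine ⟨fun s => hs_mul_ne_top_left _ hB, hB, ?_⟩
  have hB' : ∑' i, ‖star B (onBasis H i)‖ₑ ^ 2 ≠ ∞ := by
    rw [← hs_sq, hs_star]; exact ENNReal.pow_ne_top hB
  have h1 := ENNReal.tendsto_tsum_compl_atTop_zero hB'
  have h2 : ∀ s, hs (finProj s * B - B) ^ 2 =
      ∑' i : {i // i ∉ s}, ‖star B (onBasis H i)‖ₑ ^ 2 := by
    intro s
    rw [← hs_star, hs_sq, star_sub, star_mul, star_finProj]
    refine Eq.trans ?_ (tsum_subtype {i | i ∉ s} (fun i => ‖star B (onBasis H i)‖ₑ ^ 2)).symm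
    refine tsum_congr fun i => ?_
    rw [sub_apply, mul_apply_eq_comp, finProj_onBasis]
    by_cases hi : i ∈ s <;> simp [hi]
  have h3 : Tendsto (fun s => hs (finProj s * B - B) ^ 2) atTop (𝓝 0) := by
    simpa only [h2] using h1
  have h4 := (ENNReal.continuous_rpow_const (y := 1 / 2)).tendsto 0 |>.comp h3
  simp only [ENNReal.zero_rpow_of_pos (one_half_pos (α := ℝ))] at h4
  refine h4.congr fun s => ?_
  simp only [Function.comp]
  rw [← ENNReal.rpow_natCast, ← ENNReal.rpow_mul]
  simp

/-- The matrix of `A` in finitely many basis vectors. -/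
def finMat (s : Finset (BasisIndex H)) : (H →L[ℂ] H) →ₗ[ℂ] Matrix s s ℂ where
  toFun A := Matrix.of fun i j => ⟪onBasis H i, A (onBasis H j)⟫_ℂ
  map_add' A B := by ext; simp
  map_smul' c A := by ext; simp

theorem finMat_apply (s : Finset (BasisIndex H)) (A : H →L[ℂ] H) (i j : s) :
    finMat s A i j = ⟪onBasis H i, A (onBasis H j)⟫_ℂ := rfl

theorem continuous_finMat (s : Finset (BasisIndex H)) : Continuous (finMat s) := by
  refine continuous_matrix fun i j => ?_
  simp only [finMat_apply]
  fun_prop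

theorem finMat_one (s : Finset (BasisIndex H)) : finMat s 1 = 1 := by
  ext i j
  rw [finMat_apply, one_apply_eq_self,
    orthonormal_iff_ite.1 (onBasis H).orthonormal, Matrix.one_apply]
  simp only [Subtype.ext_iff]

theorem finMat_finProj_mul (s : Finset (BasisIndex H)) (A : H →L[ℂ] H) :
    finMat s (finProj s * A) = finMat s A := by
  ext i j
  simp [finMat_apply, inner_finProj]

/-- Compression is not multiplicative in general, but it is when the right factor starts with the
projection. This is why B is approximated by `finProj s * B`. -/
theorem finMat_mul_finProj_mul (s : Finset (BasisIndex H)) (A B : H →L[ℂ] H) :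
    finMat s (A * (finProj s * B)) = finMat s A * finMat s B := by
  ext i j
  simp only [Matrix.mul_apply, finMat_apply, mul_apply_eq_comp, finProj_apply, map_sum, map_smul,
    inner_sum, inner_smul_right]
  rw [← Finset.sum_coe_sort]
  exact Finset.sum_congr rfl fun k _ => mul_comm _ _

theorem finMat_pow (s : Finset (BasisIndex H)) (B : H →L[ℂ] H) (n : ℕ) :
    finMat s ((finProj s * B) ^ n) = finMat s B ^ n := by
  induction n with
  | zero => simp [finMat_one]
  | succ n ih => rw [pow_succ, finMat_mul_finProj_mul, ih, pow_succ]

theorem trace_finMat (s : Finset (BasisIndex H)) (A : H →L[ℂ] H) :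
    (finMat s A).trace = trace (finProj s * A) := by
  rw [trace, tsum_eq_sum (s := s)]
  · rw [← Finset.sum_coe_sort]
    refine Finset.sum_congr rfl fun i _ => ?_
    rw [mul_apply_eq_comp, inner_finProj, if_pos i.2]
    rfl
  · intro i hi
    rw [mul_apply_eq_comp, inner_finProj, if_neg hi]

theorem trace_finMat_pow (s : Finset (BasisIndex H)) (B : H →L[ℂ] H) (n : ℕ) :
    (finMat s B ^ (n + 1)).trace = trace ((finProj s * B) ^ (n + 1)) := by
  rw [← finMat_pow, pow_succ', mul_assoc, finMat_finProj_mul, trace_finMat]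

theorem sum_norm_finMat_sq_le (s : Finset (BasisIndex H)) {A : H →L[ℂ] H} (hA : hs A ≠ ∞) :
    ∑ i, ∑ j, ‖finMat s A i j‖ ^ 2 ≤ (hs A ^ 2).toReal := by
  have h : ∑ j : s, ∑ i : s, ‖finMat s A i j‖ₑ ^ 2 ≤ hs A ^ 2 := by
    simp only [hs_sq_eq_tsum_tsum, finMat_apply]
    rw [Finset.sum_coe_sort s (fun j => ∑ i : s, ‖⟪onBasis H i, A (onBasis H j)⟫_ℂ‖ₑ ^ 2)]
    refine (Finset.sum_le_sum fun j _ => ?_).trans (ENNReal.sum_le_tsum s)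
    rw [Finset.sum_coe_sort s (fun i => ‖⟪onBasis H i, A (onBasis H j)⟫_ℂ‖ₑ ^ 2)]
    exact ENNReal.sum_le_tsum s
  have h2 := ENNReal.toReal_mono (ENNReal.pow_ne_top hA) h
  rw [Finset.sum_comm]
  refine le_trans (le_of_eq ?_) h2
  rw [ENNReal.toReal_sum (fun _ _ => by simp)]
  refine Finset.sum_congr rfl fun j _ => ?_
  rw [ENNReal.toReal_sum (fun _ _ => by simp)]
  simp

section
attribute [local instance] Matrix.linftyOpNormedRing Matrix.linftyOpNormedAlgebra

theorem finMat_exp (s : Finset (BasisIndex H)) (B : H →L[ℂ] H) :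
    finMat s (NormedSpace.exp (finProj s * B)) = NormedSpace.exp (finMat s B) := by
  have h1 := NormedSpace.exp_series_hasSum_exp' (𝕂 := ℂ) (finProj s * B)
  have h2 := h1.map (finMat s) (continuous_finMat s)
  have h3 := NormedSpace.exp_series_hasSum_exp' (𝕂 := ℂ) (finMat s B)
  refine HasSum.unique ?_ h3
  refine h2.congr_fun fun n => ?_
  simp only [Function.comp, map_smul, finMat_pow]

end

theorem det_one_add_finMat_regExp (s : Finset (BasisIndex H)) (B : H →L[ℂ] H) :
    (1 + finMat s (regExp (finProj s * B))).det =
      (1 + finMat s B).det * Complex.exp (-(finMat s B).trace) := by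
  set T := finProj s * B with hT
  have hneg : -T = finProj s * (-B) := by rw [hT, mul_neg]
  -- The factors are swapped so that T, which begins with the projection, stands on the right, as
  -- `finMat_mul_finProj_mul` requires.
  have hc : Commute (1 + T) (NormedSpace.exp (-T)) := by
    have : Commute (1 + T) (-T) := ((Commute.one_left T).add_left (Commute.refl T)).neg_right
    exact this.exp_right
  have h1 : finMat s (regExp T) = NormedSpace.exp (-finMat s B) * (1 + finMat s B) - 1 := by
    rw [regExp, hc.eq, map_sub, finMat_one, mul_add, mul_one, map_add]
    nth_rw 3 [hT]
    rw [finMat_mul_finProj_mul, hneg, finMat_exp, map_neg, mul_add, mul_one]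
  rw [h1, add_sub_cancel, Matrix.det_mul, det_exp, Matrix.trace_neg, mul_comm]

theorem hsTendsto_regExp {σ : Type*} {f : Filter σ} {T : σ → H →L[ℂ] H} {B : H →L[ℂ] H}
    (h : HSTendsto T f B) :
    HSTendsto (fun s => T s * regQuot (T s)) f (B * regQuot B) ∧
      HSTendsto (fun s => regExp (T s)) f (regExp B) := by
  have h1 := h.mul_right (tendsto_regQuot h.tendsto_clm)
  refine ⟨h1, ?_⟩
  simp only [regExp_eq]
  exact h.mul_right h1.tendsto_clm

/-- The regularised determinant in terms of Newton's recursion. -/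
theorem tsum_newton_eq_mul_exp {B : H →L[ℂ] H} (hB : hs B ≠ ∞)
    {τ D D' : ℕ → ℂ} (hτ : ∀ l, τ (l + 1) = trace (B ^ (l + 2))) (hD : IsNewton τ D)
    (hD' : IsNewton (fun l => trace (regExp B ^ (l + 1))) D') :
    Summable D ∧ Summable D' ∧ ∑' n, D n = (∑' n, D' n) * Complex.exp (τ 0) := by
  have hT := hsTendsto_finProj_mul hB
  obtain ⟨hS, hF⟩ := hsTendsto_regExp hT
  have h1 := hD.tendsto_det (f := atTop) (fun s => finMat s B) (fun _ => τ 0)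
    tendsto_const_nhds (C := (hs B ^ 2).toReal) (fun l => by
      simp only [fun s => trace_finMat_pow s B (l + 1), hτ]
      simp only [pow_succ' _ (l + 1)]
      exact hT.tendsto_trace_mul (by
        simpa only [pow_succ'] using hT.mul_right (hT.tendsto_clm.pow l)))
    (Eventually.of_forall fun s => sum_norm_finMat_sq_le s hB)
  have hmat : ∀ (s : Finset (BasisIndex H)) (l : ℕ),
      (finMat s (regExp (finProj s * B)) ^ (l + 1)).trace =
        trace (regExp (finProj s * B) ^ (l + 1)) := by
    intro s l
    -- `regExp (finProj s * B)` begins with the projection, so the traces of its powers are computed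
    -- exactly by the compressed matrix.
    have e : regExp (finProj s * B) =
        finProj s * (B * (finProj s * B * regQuot (finProj s * B))) := by
      rw [regExp_eq]; noncomm_ring
    rw [e, finMat_finProj_mul, trace_finMat_pow]
  have htr : ∀ l, Tendsto (fun s => trace (regExp (finProj s * B) ^ (l + 1))) atTop
      (𝓝 (trace (regExp B ^ (l + 1)))) := by
    intro l
    have := hT.tendsto_trace_mul (hS.mul_right (hF.tendsto_clm.pow l))
    convert! this using 3
    · rw [pow_succ', regExp_eq]; noncomm_ring
    · rw [pow_succ', regExp_eq]; noncomm_ring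
  -- The regularised trace is chosen equal to the actual matrix trace, so the exponential factor is
  -- 1 here, whereas in `h1` the constant τ 0 leaves e^{τ 0 - Tr M}. The quotient of the two limits
  -- is e^{τ 0}.
  have h2 := hD'.tendsto_det (f := atTop) (fun s => finMat s (regExp (finProj s * B)))
    (fun s => trace (regExp (finProj s * B))) (C := ((hs (regExp B) + 1) ^ 2).toReal)
    (by simpa using htr 0) (fun l => by simp only [hmat _ (l + 1)]; exact htr (l + 1)) (by
      filter_upwards [hF.tendsto_hs] with s hs'
      refine (sum_norm_finMat_sq_le s (hF.hs_ne_top s)).trans ?_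
      refine ENNReal.toReal_mono (ENNReal.pow_ne_top
        (ENNReal.add_ne_top.2 ⟨hF.hs_lim_ne_top, ENNReal.one_ne_top⟩)) ?_
      gcongr)
  refine ⟨h1.1, h2.1, tendsto_nhds_unique h1.2 ?_⟩
  refine (h2.2.mul_const (Complex.exp (τ 0))).congr fun s => ?_
  have e := hmat s 0
  simp only [zero_add, pow_one] at e
  rw [e, sub_self, Complex.exp_zero, mul_one, det_one_add_finMat_regExp, mul_assoc,
    ← Complex.exp_add]
  congr 2
  ring

end Compression

/-! ### Fredholm's recursion for determinants of kernels over a σ-finite measure. -/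

section FredholmRecursion

variable {X : Type*} [MeasurableSpace X]

/-- `det [κ(z_i, z_j)]`. -/
def kdet (κ : X → X → ℂ) {n : ℕ} (z : Fin n → X) : ℂ := (Matrix.of fun i j => κ (z i) (z j)).det

/-- The determinant with rows `x, z₁, …, zₙ` and columns `y, z₁, …, zₙ`. -/
def kminor (κ : X → X → ℂ) {n : ℕ} (x y : X) (z : Fin n → X) : ℂ :=
  (Matrix.of fun i j : Fin (n + 1) =>
    κ (Fin.cons (α := fun _ => X) x z i) (Fin.cons (α := fun _ => X) y z j)).det

omit [MeasurableSpace X] in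
theorem kdet_succ (κ : X → X → ℂ) {n : ℕ} (z : Fin (n + 1) → X) :
    kdet κ z = kminor κ (z 0) (z 0) fun i => z ((0 : Fin (n + 1)).succAbove i) := by
  have h : Fin.cons (α := fun _ => X) (z 0) (fun i => z ((0 : Fin (n + 1)).succAbove i)) = z := by
    funext i
    refine Fin.cases ?_ (fun i => ?_) i <;> simp
  rw [kdet, kminor, h]

omit [MeasurableSpace X] in
theorem kminor_zero (κ : X → X → ℂ) (x y : X) (z : Fin 0 → X) : kminor κ x y z = κ x y := by
  simp [kminor]

omit [MeasurableSpace X] in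
/-- Laplace expansion along the first row. -/
theorem kminor_succ (κ : X → X → ℂ) {n : ℕ} (x y : X) (z : Fin (n + 1) → X) :
    kminor κ x y z = κ x y * kdet κ z -
      ∑ j, κ x (z j) * kminor κ (z j) y fun i => z (j.succAbove i) := by
  unfold kminor
  rw [Matrix.det_succ_row_zero, Fin.sum_univ_succ, sub_eq_add_neg, ← Finset.sum_neg_distrib]
  congr 1
  · simp [kdet, Matrix.submatrix]
  · refine Finset.sum_congr rfl fun k _ => ?_
    -- Deleting row x and column z_k leaves the rows in their original order; a cycle brings row z_k
    -- to the top. Its sign (-1)^k turns the cofactor sign (-1)^(k+1) into -1.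
    have h : (Matrix.of fun i j : Fin (n + 1) => κ (Fin.cons (α := fun _ => X) (z k)
        (fun i => z (k.succAbove i)) i) (Fin.cons (α := fun _ => X) y
        (fun i => z (k.succAbove i)) j)) =
        ((Matrix.of fun i j : Fin (n + 2) => κ (Fin.cons (α := fun _ => X) x z i)
          (Fin.cons (α := fun _ => X) y z j)).submatrix Fin.succ (Fin.succAbove k.succ)).submatrix
          (k.cycleRange.symm) id := by
      ext i j
      simp only [Matrix.of_apply, Matrix.submatrix_apply, Fin.cons_succ, id]
      congr 1
      · refine Fin.cases ?_ (fun i => ?_) i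
        · simp [Fin.cycleRange_symm_zero]
        · simp [Fin.cycleRange_symm_succ]
      · refine Fin.cases ?_ (fun j => ?_) j
        · simp
        · simp
    rw [h, Matrix.det_permute]
    simp only [Equiv.Perm.sign_symm, Fin.sign_cycleRange, Fin.val_succ, Matrix.of_apply,
      Fin.cons_zero, Fin.cons_succ]
    have h1 : ((-1 : ℂ) ^ (k : ℕ)) * (-1) ^ (k : ℕ) = 1 := by
      rw [← mul_pow]; simp
    push_cast
    rw [pow_succ]
    ring

theorem measurable_det_of {Y : Type*} [MeasurableSpace Y] {n : ℕ} {f : Y → Fin n → Fin n → ℂ}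
    (hf : ∀ i j, Measurable fun y => f y i j) :
    Measurable fun y => (Matrix.of (f y)).det := by
  simp only [Matrix.det_apply']
  refine Finset.measurable_fun_sum _ fun σ _ => Measurable.const_mul ?_ _
  exact Finset.measurable_fun_prod _ fun i _ => hf _ _

theorem measurable_kdet {κ : X → X → ℂ} (hκ : Measurable (Function.uncurry κ)) (n : ℕ) :
    Measurable fun z : Fin n → X => kdet κ z :=
  measurable_det_of fun i j => by
    have := hκ.comp ((measurable_pi_apply (X := fun _ : Fin n => X) i).prodMk
      (measurable_pi_apply j))
    exact this

theorem measurable_cons {Y : Type*} [MeasurableSpace Y] {n : ℕ} {x : Y → X} {z : Y → Fin n → X}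
    (hx : Measurable x) (hz : Measurable z) (i : Fin (n + 1)) :
    Measurable fun t => Fin.cons (α := fun _ => X) (x t) (z t) i := by
  refine Fin.cases ?_ (fun i => ?_) i
  · simpa using hx
  · have := (measurable_pi_apply i).comp hz
    simp only [Fin.cons_succ]
    exact this

theorem measurable_kminor {κ : X → X → ℂ} (hκ : Measurable (Function.uncurry κ)) {n : ℕ}
    {Y : Type*} [MeasurableSpace Y] {x y : Y → X} {z : Y → Fin n → X} (hx : Measurable x)
    (hy : Measurable y) (hz : Measurable z) :
    Measurable fun t => kminor κ (x t) (y t) (z t) :=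
  measurable_det_of fun i j => hκ.comp ((measurable_cons hx hz i).prodMk (measurable_cons hy hz j))

variable {μ : Measure X} [SigmaFinite μ]

theorem lintegral_pi_succAbove {n : ℕ} (j : Fin (n + 1)) {F : X × (Fin n → X) → ℝ≥0∞}
    (hF : Measurable F) :
    ∫⁻ z : Fin (n + 1) → X, F (z j, fun i => z (j.succAbove i)) ∂(Measure.pi fun _ => μ) =
      ∫⁻ w, ∫⁻ z, F (w, z) ∂(Measure.pi fun _ => μ) ∂μ := by
  have h := measurePreserving_piFinSuccAbove (fun _ : Fin (n + 1) => μ) j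
  rw [← lintegral_prod _ hF.aemeasurable, ← h.lintegral_comp hF]
  rfl

theorem integrable_pi_succAbove {n : ℕ} (j : Fin (n + 1)) {F : X × (Fin n → X) → ℂ}
    (hF : Integrable F (μ.prod (Measure.pi fun _ => μ))) :
    Integrable (fun z : Fin (n + 1) → X => F (z j, fun i => z (j.succAbove i)))
      (Measure.pi fun _ => μ) :=
  (measurePreserving_piFinSuccAbove (fun _ : Fin (n + 1) => μ) j).integrable_comp_of_integrable hF

theorem integral_pi_succAbove {n : ℕ} (j : Fin (n + 1)) {F : X × (Fin n → X) → ℂ}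
    (hF : Integrable F (μ.prod (Measure.pi fun _ => μ))) :
    ∫ z : Fin (n + 1) → X, F (z j, fun i => z (j.succAbove i)) ∂(Measure.pi fun _ => μ) =
      ∫ w, ∫ z, F (w, z) ∂(Measure.pi fun _ => μ) ∂μ := by
  have h := measurePreserving_piFinSuccAbove (fun _ : Fin (n + 1) => μ) j
  rw [← integral_prod _ hF, ← h.integral_comp (MeasurableEquiv.measurableEmbedding _)]
  rfl

/-- The norms in `L²(μ)` of the rows of a kernel. -/
def rowNorm (μ : Measure X) (κ : X → X → ℂ) (x : X) : ℝ≥0∞ :=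
  (∫⁻ z, ‖κ x z‖ₑ ^ (2 : ℝ) ∂μ) ^ (1 / 2 : ℝ)

/-- The norms in `L²(μ)` of the columns of a kernel. -/
def colNorm (μ : Measure X) (κ : X → X → ℂ) (y : X) : ℝ≥0∞ :=
  (∫⁻ z, ‖κ z y‖ₑ ^ (2 : ℝ) ∂μ) ^ (1 / 2 : ℝ)

/-- Square integrable kernels with square integrable rows and columns and integrable diagonal. -/
structure IsFredholmKernel (μ : Measure X) (κ : X → X → ℂ) : Prop where
  measurable : Measurable (Function.uncurry κ)
  row : ∀ x, rowNorm μ κ x ≠ ∞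
  col : ∀ y, colNorm μ κ y ≠ ∞
  sq : ∫⁻ x, ∫⁻ y, ‖κ x y‖ₑ ^ (2 : ℝ) ∂μ ∂μ ≠ ∞
  diag : ∫⁻ x, ‖κ x x‖ₑ ∂μ ≠ ∞

/-- The iterated kernels, starting with `κ`. -/
def iterKernel (μ : Measure X) (κ : X → X → ℂ) : ℕ → X → X → ℂ
  | 0 => κ
  | l + 1 => fun x y => ∫ z, κ x z * iterKernel μ κ l z y ∂μ

/-- The bound for iterated kernels and minors. -/
def kbound (μ : Measure X) (κ : X → X → ℂ) (x y : X) : ℝ≥0∞ :=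
  ‖κ x y‖ₑ + rowNorm μ κ x * colNorm μ κ y

namespace IsFredholmKernel

variable {κ : X → X → ℂ} (hκ : IsFredholmKernel μ κ)
include hκ

theorem measurable_rowNorm : Measurable (rowNorm μ κ) :=
  (Measurable.lintegral_prod_right' (f := fun p : X × X => ‖κ p.1 p.2‖ₑ ^ (2 : ℝ))
    (hκ.measurable.enorm.pow_const _)).pow_const _

theorem measurable_colNorm : Measurable (colNorm μ κ) :=
  (Measurable.lintegral_prod_left' (f := fun p : X × X => ‖κ p.1 p.2‖ₑ ^ (2 : ℝ))
    (hκ.measurable.enorm.pow_const _)).pow_const _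

omit [SigmaFinite μ] in
theorem measurable_row (x : X) : Measurable (κ x) :=
  hκ.measurable.comp (measurable_const.prodMk measurable_id)

omit [SigmaFinite μ] in
theorem measurable_col (y : X) : Measurable fun x => κ x y :=
  hκ.measurable.comp (measurable_id.prodMk measurable_const)

omit [SigmaFinite μ] in
theorem kbound_ne_top (x y : X) : kbound μ κ x y ≠ ∞ :=
  ENNReal.add_ne_top.2 ⟨enorm_ne_top, ENNReal.mul_ne_top (hκ.row x) (hκ.col y)⟩

omit [SigmaFinite μ] in
theorem lintegral_rowNorm_sq : ∫⁻ x, rowNorm μ κ x ^ (2 : ℝ) ∂μ ≠ ∞ := by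
  convert hκ.sq using 3 with x
  rw [rowNorm, ← ENNReal.rpow_mul]; simp

theorem lintegral_colNorm_sq : ∫⁻ x, colNorm μ κ x ^ (2 : ℝ) ∂μ ≠ ∞ := by
  have h := hκ.sq
  rw [lintegral_lintegral_swap (hκ.measurable.enorm.pow_const _).aemeasurable] at h
  convert h using 3 with x
  rw [colNorm, ← ENNReal.rpow_mul]; simp

omit [SigmaFinite μ] in
theorem lintegral_row_mul_le (x : X) {f : X → ℝ≥0∞} (hf : Measurable f) :
    ∫⁻ z, ‖κ x z‖ₑ * f z ∂μ ≤ rowNorm μ κ x * (∫⁻ z, f z ^ (2 : ℝ) ∂μ) ^ (1 / 2 : ℝ) :=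
  ENNReal.lintegral_mul_le_Lp_mul_Lq μ Real.HolderConjugate.two_two
    (hκ.measurable_row x).enorm.aemeasurable hf.aemeasurable

/-- Cauchy-Schwarz bounds the integrals of both summands of `kbound` by a multiple of the product of
row norm at x and column norm at y; the constant is 1 plus the L² norm of the row norms. The shape
of the bound is reproduced, so it can be iterated, and it holds at every point. -/
theorem exists_lintegral_row_kbound : ∃ A : ℝ≥0∞, A ≠ ∞ ∧
    ∀ x y, ∫⁻ z, ‖κ x z‖ₑ * kbound μ κ z y ∂μ ≤ A * kbound μ κ x y := by
  refine ⟨1 + (∫⁻ z, rowNorm μ κ z ^ (2 : ℝ) ∂μ) ^ (1 / 2 : ℝ), ?_, fun x y => ?_⟩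
  · exact ENNReal.add_ne_top.2 ⟨ENNReal.one_ne_top,
      ENNReal.rpow_ne_top_of_nonneg (by norm_num) hκ.lintegral_rowNorm_sq⟩
  · simp only [kbound, mul_add]
    have hm : Measurable fun z => ‖κ x z‖ₑ * ‖κ z y‖ₑ :=
      (hκ.measurable_row x).enorm.mul (hκ.measurable_col y).enorm
    rw [lintegral_add_left hm]
    have h1 := hκ.lintegral_row_mul_le x (hκ.measurable_col y).enorm
    have h2 : ∫⁻ z, ‖κ x z‖ₑ * (rowNorm μ κ z * colNorm μ κ y) ∂μ ≤ (rowNorm μ κ x *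
        (∫⁻ z, rowNorm μ κ z ^ (2 : ℝ) ∂μ) ^ (1 / 2 : ℝ)) * colNorm μ κ y := by
      simp only [← mul_assoc]
      have hm2 : Measurable fun z => ‖κ x z‖ₑ * rowNorm μ κ z :=
        (hκ.measurable_row x).enorm.mul hκ.measurable_rowNorm
      rw [lintegral_mul_const _ hm2]
      gcongr
      exact hκ.lintegral_row_mul_le x hκ.measurable_rowNorm
    refine (add_le_add h1 h2).trans ?_
    refine le_trans (le_of_eq ?_) le_add_self
    rw [show (∫⁻ z, ‖κ z y‖ₑ ^ (2 : ℝ) ∂μ) ^ (1 / 2 : ℝ) = colNorm μ κ y from rfl]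
    ring

theorem lintegral_diag_kbound : ∫⁻ x, kbound μ κ x x ∂μ ≠ ∞ := by
  simp only [kbound]
  have hm : Measurable fun x => rowNorm μ κ x * colNorm μ κ x :=
    hκ.measurable_rowNorm.mul hκ.measurable_colNorm
  rw [lintegral_add_right _ hm]
  refine ENNReal.add_ne_top.2 ⟨hκ.diag, ne_top_of_le_ne_top ?_
    (ENNReal.lintegral_mul_le_Lp_mul_Lq μ Real.HolderConjugate.two_two
      hκ.measurable_rowNorm.aemeasurable hκ.measurable_colNorm.aemeasurable)⟩
  exact ENNReal.mul_ne_top (ENNReal.rpow_ne_top_of_nonneg (by norm_num) hκ.lintegral_rowNorm_sq)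
    (ENNReal.rpow_ne_top_of_nonneg (by norm_num) hκ.lintegral_colNorm_sq)

theorem measurable_iterKernel (l : ℕ) : Measurable (Function.uncurry (iterKernel μ κ l)) := by
  induction l with
  | zero => exact hκ.measurable
  | succ l ih =>
    refine StronglyMeasurable.measurable ?_
    refine StronglyMeasurable.integral_prod_right'
      (f := fun p : (X × X) × X => κ p.1.1 p.2 * iterKernel μ κ l p.2 p.1.2) ?_
    exact ((hκ.measurable.comp ((measurable_fst.comp measurable_fst).prodMk measurable_snd)).mul
      (ih.comp (measurable_snd.prodMk (measurable_snd.comp measurable_fst)))).stronglyMeasurable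

theorem exists_iterKernel_le (l : ℕ) : ∃ C : ℝ≥0∞, C ≠ ∞ ∧
    ∀ x y, ‖iterKernel μ κ l x y‖ₑ ≤ C * kbound μ κ x y := by
  induction l with
  | zero => exact ⟨1, ENNReal.one_ne_top, fun x y => by
      rw [one_mul]; exact le_self_add⟩
  | succ l ih =>
    obtain ⟨C, hC, h⟩ := ih
    obtain ⟨A, hA, h'⟩ := hκ.exists_lintegral_row_kbound
    refine ⟨C * A, ENNReal.mul_ne_top hC hA, fun x y => ?_⟩
    refine (enorm_integral_le_lintegral_enorm _).trans ?_
    simp only [enorm_mul]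
    calc ∫⁻ z, ‖κ x z‖ₑ * ‖iterKernel μ κ l z y‖ₑ ∂μ
        ≤ ∫⁻ z, C * (‖κ x z‖ₑ * kbound μ κ z y) ∂μ := by
          refine lintegral_mono fun z => ?_
          rw [mul_left_comm]
          gcongr
          exact h z y
      _ ≤ _ := by
          rw [lintegral_const_mul' _ _ hC, mul_assoc]
          gcongr
          exact h' x y

theorem integrable_row_mul_iterKernel (l : ℕ) (x y : X) :
    Integrable (fun z => κ x z * iterKernel μ κ l z y) μ := by
  obtain ⟨C, hC, h⟩ := hκ.exists_iterKernel_le l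
  obtain ⟨A, hA, h'⟩ := hκ.exists_lintegral_row_kbound
  refine ⟨((hκ.measurable_row x).mul ((hκ.measurable_iterKernel l).comp
    (measurable_id.prodMk measurable_const))).aestronglyMeasurable, ?_⟩
  refine lt_of_le_of_lt ?_ (ENNReal.mul_ne_top hC
    (ENNReal.mul_ne_top hA (hκ.kbound_ne_top x y))).lt_top
  refine le_trans ?_ (mul_le_mul_right (h' x y) C)
  rw [← lintegral_const_mul' _ _ hC]
  refine lintegral_mono fun z => ?_
  rw [enorm_mul, mul_left_comm]
  gcongr
  exact h z y

theorem integrable_iterKernel_diag (l : ℕ) : Integrable (fun z => iterKernel μ κ l z z) μ := by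
  obtain ⟨C, hC, h⟩ := hκ.exists_iterKernel_le l
  refine ⟨((hκ.measurable_iterKernel l).comp
    (measurable_id.prodMk measurable_id)).aestronglyMeasurable, ?_⟩
  refine lt_of_le_of_lt (lintegral_mono fun z => h z z) ?_
  rw [lintegral_const_mul' _ _ hC]
  exact (ENNReal.mul_ne_top hC hκ.lintegral_diag_kbound).lt_top

/-- Induction along the first-row expansion: the term with the smaller determinant is controlled by
the diagonal integral of `kbound`, the others by integrating κ(x, ·) against the previous bound. -/
theorem exists_lintegral_kminor_le (n : ℕ) : ∃ C : ℝ≥0∞, C ≠ ∞ ∧ ∀ x y,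
    ∫⁻ z : Fin n → X, ‖kminor κ x y z‖ₑ ∂(Measure.pi fun _ => μ) ≤ C * kbound μ κ x y := by
  induction n with
  | zero =>
    refine ⟨1, ENNReal.one_ne_top, fun x y => ?_⟩
    simp only [kminor_zero, lintegral_const, one_mul]
    rw [Measure.pi_of_empty]
    simp [kbound]
  | succ n ih =>
    obtain ⟨C, hC, h⟩ := ih
    obtain ⟨A, hA, h'⟩ := hκ.exists_lintegral_row_kbound
    set I := ∫⁻ x, kbound μ κ x x ∂μ with hI
    have hI' : I ≠ ∞ := hκ.lintegral_diag_kbound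
    have hdet : ∫⁻ z : Fin (n + 1) → X, ‖kdet κ z‖ₑ ∂(Measure.pi fun _ => μ) ≤ C * I := by
      simp only [kdet_succ]
      rw [lintegral_pi_succAbove (μ := μ) 0 (F := fun p => ‖kminor κ p.1 p.1 p.2‖ₑ)
        (measurable_kminor hκ.measurable measurable_fst measurable_fst measurable_snd).enorm,
        hI, ← lintegral_const_mul' _ _ hC]
      exact lintegral_mono fun w => h w w
    refine ⟨C * I + (n + 1) * (C * A), ?_, fun x y => ?_⟩
    · exact ENNReal.add_ne_top.2 ⟨ENNReal.mul_ne_top hC hI', ENNReal.mul_ne_top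
        (by exact_mod_cast ENNReal.natCast_ne_top (n + 1)) (ENNReal.mul_ne_top hC hA)⟩
    have hmeas : ∀ j : Fin (n + 1), Measurable fun p : X × (Fin n → X) =>
        ‖κ x p.1‖ₑ * ‖kminor κ p.1 y p.2‖ₑ := fun j =>
      ((hκ.measurable_row x).comp measurable_fst).enorm.mul
        (measurable_kminor hκ.measurable measurable_fst measurable_const measurable_snd).enorm
    have hterm : ∀ j : Fin (n + 1), ∫⁻ z : Fin (n + 1) → X, ‖κ x (z j)‖ₑ *
        ‖kminor κ (z j) y fun i => z (j.succAbove i)‖ₑ ∂(Measure.pi fun _ => μ) ≤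
          C * A * kbound μ κ x y := by
      intro j
      rw [lintegral_pi_succAbove (μ := μ) j (hmeas j)]
      calc _ ≤ ∫⁻ w, C * (‖κ x w‖ₑ * kbound μ κ w y) ∂μ := by
            refine lintegral_mono fun w => ?_
            simp only
            rw [lintegral_const_mul' _ _ enorm_ne_top, mul_left_comm]
            gcongr
            exact h w y
        _ ≤ _ := by
            rw [lintegral_const_mul' _ _ hC, mul_assoc]
            gcongr
            exact h' x y
    calc ∫⁻ z : Fin (n + 1) → X, ‖kminor κ x y z‖ₑ ∂(Measure.pi fun _ => μ)
        ≤ ∫⁻ z : Fin (n + 1) → X, (‖κ x y‖ₑ * ‖kdet κ z‖ₑ + ∑ j, ‖κ x (z j)‖ₑ *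
          ‖kminor κ (z j) y fun i => z (j.succAbove i)‖ₑ) ∂(Measure.pi fun _ => μ) := by
          refine lintegral_mono fun z => ?_
          rw [kminor_succ]
          refine enorm_sub_le.trans ?_
          rw [enorm_mul]
          gcongr
          refine (enorm_sum_le _ _).trans (le_of_eq ?_)
          simp only [enorm_mul]
      _ = ‖κ x y‖ₑ * ∫⁻ z : Fin (n + 1) → X, ‖kdet κ z‖ₑ ∂(Measure.pi fun _ => μ) +
          ∑ j, ∫⁻ z : Fin (n + 1) → X, ‖κ x (z j)‖ₑ *
            ‖kminor κ (z j) y fun i => z (j.succAbove i)‖ₑ ∂(Measure.pi fun _ => μ) := by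
          rw [lintegral_add_left ((measurable_kdet hκ.measurable _).enorm.const_mul _),
            lintegral_const_mul' _ _ enorm_ne_top, lintegral_finsetSum]
          intro j _
          have := (hmeas j).comp ((measurable_pi_apply (X := fun _ : Fin (n + 1) => X) j).prodMk
            (measurable_pi_lambda (fun z i => z (j.succAbove i)) fun i => measurable_pi_apply _))
          exact this
      _ ≤ ‖κ x y‖ₑ * (C * I) + ∑ j : Fin (n + 1), C * A * kbound μ κ x y := by
          gcongr with j _
          exact hterm j
      _ ≤ kbound μ κ x y * (C * I) + ∑ j : Fin (n + 1), C * A * kbound μ κ x y := by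
          gcongr
          exact le_self_add
      _ = _ := by
          rw [Finset.sum_const, Finset.card_univ, Fintype.card_fin, nsmul_eq_mul]
          push_cast
          ring

theorem integrable_kminor_diag (n : ℕ) :
    Integrable (fun p : X × (Fin n → X) => kminor κ p.1 p.1 p.2)
      (μ.prod (Measure.pi fun _ => μ)) := by
  obtain ⟨C, hC, h⟩ := hκ.exists_lintegral_kminor_le n
  have hm : Measurable fun p : X × (Fin n → X) => kminor κ p.1 p.1 p.2 :=
    measurable_kminor hκ.measurable measurable_fst measurable_fst measurable_snd
  refine ⟨hm.aestronglyMeasurable, ?_⟩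
  rw [HasFiniteIntegral, lintegral_prod _ hm.enorm.aemeasurable]
  refine (lintegral_mono fun w => h w w).trans_lt ?_
  rw [lintegral_const_mul' _ _ hC]
  exact (ENNReal.mul_ne_top hC hκ.lintegral_diag_kbound).lt_top

theorem integrable_row_mul_kminor (n : ℕ) (x y : X) :
    Integrable (fun p : X × (Fin n → X) => κ x p.1 * kminor κ p.1 y p.2)
      (μ.prod (Measure.pi fun _ => μ)) := by
  obtain ⟨C, hC, h⟩ := hκ.exists_lintegral_kminor_le n
  obtain ⟨A, hA, h'⟩ := hκ.exists_lintegral_row_kbound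
  have hm : Measurable fun p : X × (Fin n → X) => κ x p.1 * kminor κ p.1 y p.2 :=
    ((hκ.measurable_row x).comp measurable_fst).mul
      (measurable_kminor hκ.measurable measurable_fst measurable_const measurable_snd)
  refine ⟨hm.aestronglyMeasurable, ?_⟩
  rw [HasFiniteIntegral, lintegral_prod _ hm.enorm.aemeasurable]
  refine lt_of_le_of_lt ?_ (ENNReal.mul_ne_top hC
    (ENNReal.mul_ne_top hA (hκ.kbound_ne_top x y))).lt_top
  refine le_trans ?_ (mul_le_mul_right (h' x y) C)
  rw [← lintegral_const_mul' _ _ hC]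
  refine lintegral_mono fun w => ?_
  simp only [enorm_mul]
  rw [lintegral_const_mul' _ _ enorm_ne_top, mul_left_comm]
  gcongr
  exact h w y

theorem integrable_kdet (n : ℕ) :
    Integrable (fun z : Fin n → X => kdet κ z) (Measure.pi fun _ => μ) := by
  cases n with
  | zero =>
    have : (fun z : Fin 0 → X => kdet κ z) = fun _ => 1 := by funext z; simp [kdet]
    rw [this, Measure.pi_of_empty]
    exact integrable_const _
  | succ n =>
    simp only [kdet_succ]
    exact integrable_pi_succAbove (μ := μ) 0 (hκ.integrable_kminor_diag n)

/-- The Fredholm coefficients `1 / n! ∫ det [κ(z_i, z_j)]` obey Newton's recursion. -/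
theorem isNewton : IsNewton (fun l => ∫ x, iterKernel μ κ l x x ∂μ)
    (fun n => (n.factorial : ℂ)⁻¹ * ∫ z : Fin n → X, kdet κ z ∂(Measure.pi fun _ => μ)) := by
  set D : ℕ → ℂ := fun n =>
    (n.factorial : ℂ)⁻¹ * ∫ z : Fin n → X, kdet κ z ∂(Measure.pi fun _ => μ) with hD
  have hfac : ∀ n : ℕ, (n.factorial : ℂ) ≠ 0 := fun n => Nat.cast_ne_zero.2 n.factorial_ne_zero
  have hI : ∀ n : ℕ, ∫ z : Fin n → X, kdet κ z ∂(Measure.pi fun _ => μ) = n.factorial * D n :=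
    fun n => by rw [hD, mul_inv_cancel_left₀ (hfac n)]
  have hD0 : D 0 = 1 := by
    have : (fun z : Fin 0 → X => kdet κ z) = fun _ => 1 := by funext z; simp [kdet]
    simp only [hD, this]
    rw [Measure.pi_of_empty]
    simp
  -- Fredholm's series for the integrated minors. Setting y = x and integrating over x then gives
  -- the recursion for D.
  have hminor : ∀ (n : ℕ) (x y : X), ∫ z : Fin n → X, kminor κ x y z ∂(Measure.pi fun _ => μ) =
      n.factorial * ∑ l ∈ Finset.range (n + 1), (-1) ^ l * D (n - l) * iterKernel μ κ l x y := by
    intro n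
    induction n with
    | zero =>
      intro x y
      simp only [kminor_zero]
      rw [Measure.pi_of_empty]
      simp [hD0, iterKernel]
    | succ n ih =>
      intro x y
      -- The value does not depend on j, so the n + 1 terms of the expansion turn n! into (n + 1)!.
      have hterm : ∀ j : Fin (n + 1), ∫ z : Fin (n + 1) → X, κ x (z j) *
          kminor κ (z j) y (fun i => z (j.succAbove i)) ∂(Measure.pi fun _ => μ) =
          n.factorial * ∑ l ∈ Finset.range (n + 1),
            (-1) ^ l * D (n - l) * iterKernel μ κ (l + 1) x y := by
        intro j
        rw [integral_pi_succAbove (μ := μ) j (hκ.integrable_row_mul_kminor n x y)]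
        simp only [integral_const_mul, ih]
        have e : ∀ w, κ x w * (n.factorial * ∑ l ∈ Finset.range (n + 1),
            (-1) ^ l * D (n - l) * iterKernel μ κ l w y) = n.factorial *
            ∑ l ∈ Finset.range (n + 1), (-1) ^ l * D (n - l) * (κ x w * iterKernel μ κ l w y) := by
          intro w
          rw [mul_left_comm, Finset.mul_sum]
          congr 1
          exact Finset.sum_congr rfl fun l _ => by ring
        simp only [e]
        rw [integral_const_mul, integral_finsetSum]
        · simp only [integral_const_mul]
          rfl
        · intro l _
          exact (hκ.integrable_row_mul_iterKernel l x y).const_mul _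
      simp only [kminor_succ]
      rw [integral_sub ((hκ.integrable_kdet _).const_mul _), integral_finsetSum]
      · simp only [hterm, integral_const_mul, hI]
        rw [Finset.sum_const, Finset.card_univ, Fintype.card_fin, nsmul_eq_mul,
          Finset.sum_range_succ' _ (n + 1), Nat.factorial_succ]
        simp only [pow_succ, Nat.add_sub_add_right, mul_neg_one, neg_mul, Finset.sum_neg_distrib]
        simp only [iterKernel, pow_zero, Nat.sub_zero]
        push_cast
        ring
      · intro j _
        exact integrable_pi_succAbove (μ := μ) j (hκ.integrable_row_mul_kminor n x y)
      · exact integrable_finsetSum _ fun j _ =>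
          integrable_pi_succAbove (μ := μ) j (hκ.integrable_row_mul_kminor n x y)
  refine ⟨hD0, fun n => ?_⟩
  have h1 : ((n + 1).factorial : ℂ) * D (n + 1) = n.factorial * ∑ l ∈ Finset.range (n + 1),
      (-1) ^ l * D (n - l) * ∫ x, iterKernel μ κ l x x ∂μ := by
    rw [← hI]
    simp only [kdet_succ]
    rw [integral_pi_succAbove (μ := μ) 0 (hκ.integrable_kminor_diag n)]
    simp only [hminor]
    rw [integral_const_mul, integral_finsetSum]
    · simp only [integral_const_mul]
    · intro l _
      exact (hκ.integrable_iterKernel_diag l).const_mul _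
  rw [Nat.factorial_succ] at h1
  push_cast at h1
  refine mul_left_cancel₀ (hfac n) ?_
  rw [← h1]
  ring

end IsFredholmKernel
end FredholmRecursion

/-! ### Traces on exterior powers, and the determinant as a function of traces. -/

section TraceWedge

variable {H : Type*} [NormedAddCommGroup H] [InnerProductSpace ℂ H] [CompleteSpace H]

/-- Distinct orthonormal vectors are at distance √2 > 1, so the balls of radius 1/2 around them are
disjoint open sets in a separable space. -/
theorem countable_basisIndex [TopologicalSpace.SeparableSpace H] : Countable (BasisIndex H) := by
  refine Pairwise.countable_of_isOpen_disjoint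
    (s := fun i : BasisIndex H => Metric.ball (onBasis H i) (1 / 2)) (fun i j hij => ?_)
    (fun i => Metric.isOpen_ball) (fun i => ⟨_, Metric.mem_ball_self (by norm_num)⟩)
  refine Metric.ball_disjoint_ball ?_
  have h1 : ∀ i, ‖onBasis H i‖ = 1 := (onBasis H).orthonormal.1
  have h := norm_sub_sq (𝕜 := ℂ) (onBasis H i) (onBasis H j)
  rw [(onBasis H).orthonormal.2 hij, h1, h1] at h
  rw [dist_eq_norm]
  simp only [map_zero] at h
  nlinarith [norm_nonneg (onBasis H i - onBasis H j)]

theorem traceWedge_eq (n : ℕ) (A : H →L[ℂ] H) :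
    traceWedge n A = (n.factorial : ℂ)⁻¹ * ∑' f : Fin n → BasisIndex H,
      kdet (fun i j => ⟪onBasis H i, A (onBasis H j)⟫_ℂ) f := by
  unfold traceWedge
  congr 2
  funext f
  rw [wedgeInner, exteriorPower.map_apply_ιMulti, exteriorPower.pairingDual_ιMulti_ιMulti, kdet,
    ← Matrix.det_transpose]
  congr 1

theorem inner_pow_eq_tsum (A : H →L[ℂ] H) (l : ℕ) (x y : H) :
    ⟪x, (A ^ (l + 1)) y⟫_ℂ = ∑' k, ⟪x, A (onBasis H k)⟫_ℂ * ⟪onBasis H k, (A ^ l) y⟫_ℂ := by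
  rw [pow_succ', inner_mul_eq_tsum]

theorem integral_count_eq_tsum {ι E : Type*} [Countable ι] [MeasurableSpace ι]
    [MeasurableSingletonClass ι] [NormedAddCommGroup E] [NormedSpace ℝ E] [CompleteSpace E]
    {f : ι → E} {μ : Measure ι} (hμ : ∀ i, μ {i} = 1) (hf : Integrable f μ) :
    ∫ i, f i ∂μ = ∑' i, f i := by
  rw [integral_countable hf]
  simp [measureReal_def, hμ]

/-- The matrix of A is a Fredholm kernel for counting measure on the basis indices, which is
σ-finite by countability. Its Fredholm coefficients are Tr(∧ⁿ A) and its iterated kernels are the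
matrices of the powers of A. -/
theorem isNewton_traceWedge [Countable (BasisIndex H)] {A : H →L[ℂ] H} (hA : hs A ≠ ∞)
    (hd : ∑' i, ‖⟪onBasis H i, A (onBasis H i)⟫_ℂ‖ₑ ≠ ∞) :
    IsNewton (fun l => trace (A ^ (l + 1))) (fun n => traceWedge n A) := by
  let : MeasurableSpace (BasisIndex H) := ⊤
  set a : BasisIndex H → BasisIndex H → ℂ := fun i j => ⟪onBasis H i, A (onBasis H j)⟫_ℂ with ha
  set μ : Measure (BasisIndex H) := Measure.count with hμ
  have hsq : ∀ Z : H →L[ℂ] H, ∑' i, ∑' j, ‖⟪onBasis H i, Z (onBasis H j)⟫_ℂ‖ₑ ^ 2 = hs Z ^ 2 := by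
    intro Z
    rw [hs_sq_eq_tsum_tsum, ENNReal.tsum_comm]
  have hK : IsFredholmKernel μ a := by
    refine ⟨measurable_of_countable _,
      fun x => ?_, fun y => ?_, ?_, ?_⟩
    · refine ENNReal.rpow_ne_top_of_nonneg (by norm_num) ?_
      rw [lintegral_count]
      simp only [ENNReal.rpow_two]
      exact ENNReal.ne_top_of_tsum_ne_top (by rw [hsq]; exact ENNReal.pow_ne_top hA) x
    · refine ENNReal.rpow_ne_top_of_nonneg (by norm_num) ?_
      rw [lintegral_count]
      simp only [ENNReal.rpow_two]
      exact ENNReal.ne_top_of_tsum_ne_top (by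
        rw [ENNReal.tsum_comm, hsq]; exact ENNReal.pow_ne_top hA) y
    · simp only [hμ, lintegral_count, ENNReal.rpow_two]
      rw [hsq]
      exact ENNReal.pow_ne_top hA
    · simpa only [hμ, lintegral_count] using hd
  have hcount : ∀ i, μ {i} = 1 := fun i => Measure.count_singleton i
  have hiter : ∀ l i j, iterKernel μ a l i j = ⟪onBasis H i, (A ^ (l + 1)) (onBasis H j)⟫_ℂ := by
    intro l
    induction l with
    | zero => intro i j; simp [iterKernel, ha]
    | succ l ih =>
      intro i j
      change ∫ k, a i k * iterKernel μ a l k j ∂μ = _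
      rw [inner_pow_eq_tsum,
        integral_count_eq_tsum hcount (hK.integrable_row_mul_iterKernel l i j)]
      simp only [ih]
      rfl
  have h := hK.isNewton
  convert! h using 1
  · funext l
    rw [integral_count_eq_tsum hcount (hK.integrable_iterKernel_diag l), trace]
    simp only [hiter]
  · funext n
    rw [traceWedge_eq, integral_count_eq_tsum _ (hK.integrable_kdet n)]
    intro f
    rw [Measure.pi_singleton]
    simp [hcount]

/-- The bridge between determinants and traces: any Newton sequence with these data sums to the
determinant. It serves both for comparing two operators and for recognising the series of integrals.
-/
theorem extDet_eq_tsum [Countable (BasisIndex H)] {P₁ P₂ A : H →L[ℂ] H} (hA : hs A ≠ ∞)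
    {τ D : ℕ → ℂ} (h0 : τ 0 = trace (evenPart P₁ P₂ A))
    (hτ : ∀ l, τ (l + 1) = trace (A ^ (l + 2))) (hD : IsNewton τ D) :
    Summable D ∧ extDet P₁ P₂ A = ∑' n, D n := by
  have hX : hs (A * regQuot A) ≠ ∞ := hs_mul_ne_top_right _ hA
  have hF : hs (regExp A) ≠ ∞ := by rw [regExp_eq]; exact hs_mul_ne_top_right _ hA
  have hd : ∑' i, ‖⟪onBasis H i, regExp A (onBasis H i)⟫_ℂ‖ₑ ≠ ∞ := by
    rw [regExp_eq]
    exact ((tsum_enorm_inner_mul_le _ _).trans_lt (ENNReal.mul_lt_top hA.lt_top hX.lt_top)).ne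
  have hN := isNewton_traceWedge hF hd
  obtain ⟨h1, h2, h3⟩ := tsum_newton_eq_mul_exp hA hτ hD hN
  refine ⟨h1, ?_⟩
  have h4 : traceWedge 0 (regExp A) = 1 := hN.1
  rw [h3, extDet, fredholmDet, h0, h2.tsum_eq_zero_add, h4]
  rfl

/-- The solution of Newton's recursion. -/
def newtonCoeff (τ : ℕ → ℂ) : ℕ → ℂ
  | 0 => 1
  | n + 1 => ((n : ℂ) + 1)⁻¹ * ∑ l : Fin (n + 1), (-1) ^ (l : ℕ) * newtonCoeff τ (n - l) * τ l
termination_by n => n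
decreasing_by omega

theorem isNewton_newtonCoeff (τ : ℕ → ℂ) : IsNewton τ (newtonCoeff τ) := by
  refine ⟨by rw [newtonCoeff], fun n => ?_⟩
  rw [newtonCoeff, mul_inv_cancel_left₀ (Nat.cast_add_one_ne_zero n),
    Finset.sum_range fun l => (-1) ^ l * newtonCoeff τ (n - l) * τ l]

theorem extDet_congr [Countable (BasisIndex H)] {P₁ P₂ A B : H →L[ℂ] H} (hA : hs A ≠ ∞)
    (hB : hs B ≠ ∞) (h0 : trace (evenPart P₁ P₂ A) = trace (evenPart P₁ P₂ B))
    (h : ∀ l : ℕ, trace (A ^ (l + 2)) = trace (B ^ (l + 2))) :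
    extDet P₁ P₂ A = extDet P₁ P₂ B := by
  have hD := isNewton_newtonCoeff fun n =>
    Nat.casesOn n (trace (evenPart P₁ P₂ A)) fun l => trace (A ^ (l + 2))
  rw [(extDet_eq_tsum hA rfl (fun l => rfl) hD).2, (extDet_eq_tsum hB h0 h hD).2]

end TraceWedge

/-! ### Square integrable kernels of Hilbert-Schmidt operators. -/

section L2Kernel

theorem summable_of_orthogonal {ι E : Type*} [NormedAddCommGroup E] [InnerProductSpace ℂ E]
    [CompleteSpace E] {w : ι → E} (h : Pairwise fun i j => ⟪w i, w j⟫_ℂ = 0)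
    (hw : Summable fun i => ‖w i‖ ^ 2) : Summable w := by
  have hV : OrthogonalFamily ℂ (fun i => Submodule.span ℂ {w i})
      (fun i => (Submodule.span ℂ {w i}).subtypeₗᵢ) := by
    rintro i j hij ⟨v, hv⟩ ⟨v', hv'⟩
    obtain ⟨c, rfl⟩ := Submodule.mem_span_singleton.1 hv
    obtain ⟨c', rfl⟩ := Submodule.mem_span_singleton.1 hv'
    simp [inner_smul_left, inner_smul_right, h hij]
  exact (hV.summable_iff_norm_sq_summable
    (fun i => ⟨w i, Submodule.mem_span_singleton_self _⟩)).2 hw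

/-- Rectangles form a π-system generating the product σ-algebra, and the sets over which the
integral vanishes are closed under complements and countable disjoint unions. -/
theorem ae_eq_zero_of_forall_setIntegral_prod {X Y E : Type*} [MeasurableSpace X]
    [MeasurableSpace Y] [NormedAddCommGroup E] [NormedSpace ℝ E] [CompleteSpace E]
    {ν : Measure (X × Y)} {u : X × Y → E} (hu : Integrable u ν)
    (h : ∀ S T, MeasurableSet S → MeasurableSet T → ∫ p in S ×ˢ T, u p ∂ν = 0) :
    u =ᵐ[ν] 0 := by
  refine hu.ae_eq_zero_of_forall_setIntegral_eq_zero fun A hA hAf => ?_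
  clear hAf
  have htot : ∫ p, u p ∂ν = 0 := by
    have := h univ univ MeasurableSet.univ MeasurableSet.univ
    rwa [univ_prod_univ, setIntegral_univ] at this
  induction A, hA using MeasurableSpace.induction_on_inter generateFrom_prod.symm
    isPiSystem_prod with
  | empty => simp
  | basic t ht =>
    obtain ⟨S, hS, T, hT, rfl⟩ := ht
    exact h S T hS hT
  | compl t ht ih =>
    have := integral_add_compl ht hu
    rwa [ih, zero_add, htot] at this
  | iUnion f hd hm ih =>
    rw [integral_iUnion hm hd hu.integrableOn]
    simp [ih]

variable {X : Type*} [MeasurableSpace X] {m : Measure X}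

theorem enorm_L2 (f : Lp ℂ 2 m) : ‖f‖ₑ = (∫⁻ x, ‖f x‖ₑ ^ (2 : ℝ) ∂m) ^ (1 / 2 : ℝ) := by
  rw [Lp.enorm_def, eLpNorm_eq_lintegral_rpow_enorm_toReal two_ne_zero ENNReal.ofNat_ne_top]
  simp

theorem memLp_two_of_lintegral {Y : Type*} [MeasurableSpace Y] {μ : Measure Y} {f : Y → ℂ}
    (hf : AEStronglyMeasurable f μ)
    (h : ∫⁻ x, ‖f x‖ₑ ^ (2 : ℝ) ∂μ ≠ ∞) : MemLp f 2 μ := by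
  refine ⟨hf, ?_⟩
  rw [eLpNorm_eq_lintegral_rpow_enorm_toReal two_ne_zero ENNReal.ofNat_ne_top]
  simpa using ENNReal.rpow_lt_top_of_nonneg (by norm_num) (by simpa using h)

theorem inner_L2 (f g : Lp ℂ 2 m) : ⟪f, g⟫_ℂ = ∫ x, (starRingEnd ℂ) (f x) * g x ∂m := by
  rw [L2.inner_def]
  simp only [RCLike.inner_apply, mul_comm]

theorem integrable_conj_mul_L2 (f g : Lp ℂ 2 m) :
    Integrable (fun x => (starRingEnd ℂ) (f x) * g x) m := by
  have := L2.integrable_inner (𝕜 := ℂ) f g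
  simpa only [RCLike.inner_apply, mul_comm] using this

theorem lintegral_enorm_mul_L2_le (f g : Lp ℂ 2 m) :
    ∫⁻ x, ‖f x‖ₑ * ‖g x‖ₑ ∂m ≤ ‖f‖ₑ * ‖g‖ₑ := by
  rw [enorm_L2, enorm_L2]
  exact ENNReal.lintegral_mul_le_Lp_mul_Lq m Real.HolderConjugate.two_two
    (Lp.stronglyMeasurable f).measurable.enorm.aemeasurable
    (Lp.stronglyMeasurable g).measurable.enorm.aemeasurable

section Tensor
variable [SigmaFinite m]

theorem memLp_tensor (u v : Lp ℂ 2 m) :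
    MemLp (fun p : X × X => u p.1 * (starRingEnd ℂ) (v p.2)) 2 (m.prod m) := by
  have hu := (Lp.stronglyMeasurable u).measurable
  have hv := (Lp.stronglyMeasurable v).measurable
  have hm : Measurable fun p : X × X => u p.1 * (starRingEnd ℂ) (v p.2) :=
    (hu.comp measurable_fst).mul (RCLike.continuous_conj.measurable.comp (hv.comp measurable_snd))
  refine memLp_two_of_lintegral hm.aestronglyMeasurable ?_
  have e : ∀ w : Lp ℂ 2 m, ∫⁻ x, ‖w x‖ₑ ^ (2 : ℝ) ∂m ≠ ∞ := by
    intro w h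
    have := enorm_L2 w
    rw [h, ENNReal.top_rpow_of_pos (by norm_num)] at this
    exact enorm_ne_top this
  simp only [enorm_mul, RCLike.enorm_conj, ENNReal.mul_rpow_of_nonneg _ _ (zero_le_two (α := ℝ))]
  rw [lintegral_prod_mul (hu.enorm.pow_const _).aemeasurable (hv.enorm.pow_const _).aemeasurable]
  exact ENNReal.mul_ne_top (e u) (e v)

/-- The kernel `u(x) conj(v(y))`. -/
def tensor (u v : Lp ℂ 2 m) : Lp ℂ 2 (m.prod m) := (memLp_tensor u v).toLp

theorem inner_tensor (u v u' v' : Lp ℂ 2 m) :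
    ⟪tensor u v, tensor u' v'⟫_ℂ = ⟪u, u'⟫_ℂ * ⟪v', v⟫_ℂ := by
  rw [inner_L2, inner_L2, inner_L2, ← integral_prod_mul]
  refine integral_congr_ae ?_
  filter_upwards [(memLp_tensor u v).coeFn_toLp, (memLp_tensor u' v').coeFn_toLp] with p h1 h2
  simp only [tensor]
  rw [h1, h2]
  simp only [map_mul, RCLike.conj_conj]
  ring

/-- The kernel is ∑ (B e_i)(x) conj(e_i(y)), an orthogonal series whose squared norms ‖B e_i‖² are
summable. -/
theorem exists_L2_kernel {B : Lp ℂ 2 m →L[ℂ] Lp ℂ 2 m} (hB : hs B ≠ ∞) :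
    ∃ b : Lp ℂ 2 (m.prod m), ∀ u v, ⟪tensor u v, b⟫_ℂ = ⟪u, B v⟫_ℂ := by
  have ho : Pairwise fun i j => ⟪tensor (B (onBasis _ i)) (onBasis (Lp ℂ 2 m) i),
      tensor (B (onBasis _ j)) (onBasis _ j)⟫_ℂ = 0 := by
    intro i j hij
    rw [inner_tensor, (onBasis (Lp ℂ 2 m)).orthonormal.2 hij.symm, mul_zero]
  have hn : ∀ i, ‖tensor (B (onBasis _ i)) (onBasis (Lp ℂ 2 m) i)‖ ^ 2 =
      ‖B (onBasis _ i)‖ ^ 2 := by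
    intro i
    have h1 : ⟪onBasis (Lp ℂ 2 m) i, onBasis (Lp ℂ 2 m) i⟫_ℂ = 1 := by
      rw [inner_self_eq_norm_sq_to_K, (onBasis (Lp ℂ 2 m)).orthonormal.1 i]; simp
    rw [← inner_self_eq_norm_sq (𝕜 := ℂ), inner_tensor, h1, mul_one, inner_self_eq_norm_sq]
  have hsum := summable_of_orthogonal ho (by
    simp only [hn]; exact isHilbertSchmidt_iff.2 hB)
  refine ⟨∑' i, tensor (B (onBasis _ i)) (onBasis (Lp ℂ 2 m) i), fun u v => ?_⟩
  have h1 := (hsum.hasSum.mapL (innerSL ℂ (tensor u v))).tsum_eq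
  simp only [innerSL_apply_apply, inner_tensor] at h1
  rw [← h1]
  have h2 := inner_mul_eq_tsum B 1 u v
  rw [mul_one] at h2
  rw [h2]
  rfl

end Tensor
end L2Kernel

/-! ### Any localised kernel of a Hilbert-Schmidt operator is square integrable. -/

section SquareIntegrable

variable {X : Type*} [MeasurableSpace X] {m : Measure X}

/-- `κ` is an integral kernel of `B` on the whole of `L²`. -/
def IsKernel (m : Measure X) (κ : X → X → ℂ) (B : Lp ℂ 2 m →L[ℂ] Lp ℂ 2 m) : Prop :=
  ∀ f : Lp ℂ 2 m, ∀ᵐ x ∂m, Integrable (fun y => κ x y * f y) m ∧ B f x = ∫ y, κ x y * f y ∂m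

variable [SigmaFinite m]

theorem indicator_prod_one_ae (S T : Set X) (hS : MeasurableSet S) (hT : MeasurableSet T)
    (hmS : m S ≠ ∞) (hmT : m T ≠ ∞) :
    tensor (indicatorConstLp 2 hS hmS (1 : ℂ)) (indicatorConstLp 2 hT hmT (1 : ℂ))
      =ᵐ[m.prod m] (S ×ˢ T).indicator fun _ => 1 := by
  have h1 : ∀ᵐ p : X × X ∂(m.prod m), indicatorConstLp 2 hS hmS (1 : ℂ) p.1 =
      S.indicator (fun _ => 1) p.1 :=
    Measure.quasiMeasurePreserving_fst.ae indicatorConstLp_coeFn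
  have h2 : ∀ᵐ p : X × X ∂(m.prod m), indicatorConstLp 2 hT hmT (1 : ℂ) p.2 =
      T.indicator (fun _ => 1) p.2 :=
    Measure.quasiMeasurePreserving_snd.ae indicatorConstLp_coeFn
  filter_upwards [(memLp_tensor (indicatorConstLp 2 hS hmS (1 : ℂ))
    (indicatorConstLp 2 hT hmT (1 : ℂ))).coeFn_toLp, h1, h2] with p h h1 h2
  simp only [tensor]
  rw [h, h1, h2]
  by_cases hp1 : p.1 ∈ S <;> by_cases hp2 : p.2 ∈ T <;>
    simp [indicator, hp1, hp2]

/-- The given kernel is compared with the L² kernel b of B: both have the same integrals over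
rectangles, so they agree almost everywhere on the exhausting sets where κ is integrable, and
monotone convergence finishes. -/
theorem IsKernel.lintegral_sq_ne_top {B : Lp ℂ 2 m →L[ℂ] Lp ℂ 2 m} {κ : X → X → ℂ}
    (h : IsKernel m κ B) (hB : hs B ≠ ∞) (hκ : Measurable (Function.uncurry κ)) {D : Set X}
    (hD : MeasurableSet D) (hmD : m D ≠ ∞) (hl : ∀ x y, x ∉ D → κ x y = 0)
    (hr : ∀ x y, y ∉ D → κ x y = 0) :
    ∫⁻ x, ∫⁻ y, ‖κ x y‖ₑ ^ (2 : ℝ) ∂m ∂m ≠ ∞ := by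
  obtain ⟨b, hb⟩ := exists_L2_kernel hB
  set C := ∫⁻ p, ‖b p‖ₑ ^ (2 : ℝ) ∂(m.prod m) with hC
  have hCtop : C ≠ ∞ := by
    intro h'
    have := enorm_L2 b
    rw [← hC, h', ENNReal.top_rpow_of_pos (by norm_num)] at this
    exact enorm_ne_top this
  have hN1 : Measurable fun x => ∫⁻ y, ‖κ x y‖ₑ ∂m :=
    Measurable.lintegral_prod_right' (f := fun p : X × X => ‖κ p.1 p.2‖ₑ) hκ.enorm
  have hF : Measurable fun x => ∫⁻ y, ‖κ x y‖ₑ ^ (2 : ℝ) ∂m :=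
    Measurable.lintegral_prod_right' (f := fun p : X × X => ‖κ p.1 p.2‖ₑ ^ (2 : ℝ))
      (hκ.enorm.pow_const _)
  -- A priori only almost every row of κ is integrable, not κ itself. On E N × D it is, since row
  -- integrals are at most N and E N has finite measure.
  let E : ℕ → Set X := fun N => {x | ∫⁻ y, ‖κ x y‖ₑ ∂m ≤ N} ∩ D
  have hE : ∀ N, MeasurableSet (E N) := fun N => (measurableSet_le hN1 measurable_const).inter hD
  have hEfin : ∀ N, m (E N) ≠ ∞ := fun N =>
    ((measure_mono inter_subset_right).trans_lt hmD.lt_top).ne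
  have hbound : ∀ N, ∫⁻ x in E N, ∫⁻ y, ‖κ x y‖ₑ ^ (2 : ℝ) ∂m ∂m ≤ C := by
    intro N
    set ν := (m.restrict (E N)).prod (m.restrict D) with hν
    have hνm : ν = (m.prod m).restrict (E N ×ˢ D) := Measure.prod_restrict _ _
    have : IsFiniteMeasure (m.restrict (E N)) := ⟨by simpa using (hEfin N).lt_top⟩
    have : IsFiniteMeasure (m.restrict D) := ⟨by simpa using hmD.lt_top⟩
    have hκi : Integrable (Function.uncurry κ) ν := by
      refine ⟨hκ.aestronglyMeasurable, ?_⟩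
      rw [HasFiniteIntegral, lintegral_prod _ hκ.enorm.aemeasurable]
      calc _ ≤ ∫⁻ x in E N, (N : ℝ≥0∞) ∂m := by
            refine setLIntegral_mono measurable_const fun x hx => ?_
            exact (setLIntegral_le_lintegral _ _).trans hx.1
        _ < ∞ := by
            rw [setLIntegral_const]
            exact ENNReal.mul_lt_top (ENNReal.natCast_lt_top N) (hEfin N).lt_top
    have hbi : Integrable (b : X × X → ℂ) ν := by
      have h1 : MemLp (b : X × X → ℂ) 2 ν := by rw [hνm]; exact (Lp.memLp b).restrict _
      exact h1.integrable one_le_two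
    -- Over S × T, cut down to E N × D, both integrals equal ⟨1_S, B 1_T⟩.
    have hzero := ae_eq_zero_of_forall_setIntegral_prod (hκi.sub hbi) (fun S T hS hT => by
      have hS' : MeasurableSet (S ∩ E N) := hS.inter (hE N)
      have hT' : MeasurableSet (T ∩ D) := hT.inter hD
      have hmS : m (S ∩ E N) ≠ ∞ := ((measure_mono inter_subset_right).trans_lt (hEfin N).lt_top).ne
      have hmT : m (T ∩ D) ≠ ∞ := ((measure_mono inter_subset_right).trans_lt hmD.lt_top).ne
      have hνST : ν.restrict (S ×ˢ T) = (m.restrict (S ∩ E N)).prod (m.restrict (T ∩ D)) := by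
        rw [hν, ← Measure.prod_restrict, Measure.restrict_restrict hS, Measure.restrict_restrict hT]
      set u := indicatorConstLp 2 hS' hmS (1 : ℂ) with hu
      set v := indicatorConstLp 2 hT' hmT (1 : ℂ) with hv
      have e1 : ∫ p in S ×ˢ T, b p ∂ν = ⟪u, B v⟫_ℂ := by
        rw [← hb, inner_L2, hνST, Measure.prod_restrict, ← integral_indicator (hS'.prod hT')]
        refine integral_congr_ae ?_
        filter_upwards [indicator_prod_one_ae _ _ hS' hT' hmS hmT] with p hp
        rw [hp]
        by_cases hpm : p ∈ (S ∩ E N) ×ˢ (T ∩ D) <;> simp [hpm, indicator]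
      have e2 : ∫ p in S ×ˢ T, Function.uncurry κ p ∂ν = ⟪u, B v⟫_ℂ := by
        rw [inner_L2, hνST, integral_prod _ (by rw [← hνST]; exact hκi.restrict),
          ← integral_indicator hS']
        refine integral_congr_ae ?_
        filter_upwards [h v,
          indicatorConstLp_coeFn (p := 2) (hs := hS') (hμs := hmS) (c := (1 : ℂ))]
          with x hx hxu
        rw [hu, hxu, hx.2]
        have : ∫ y, κ x y * v y ∂m = ∫ y in T ∩ D, κ x y ∂m := by
          rw [← integral_indicator hT']
          refine integral_congr_ae ?_
          filter_upwards [indicatorConstLp_coeFn (p := 2) (hs := hT') (hμs := hmT) (c := (1 : ℂ))]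
            with y hy
          rw [hv, hy]
          by_cases hyT : y ∈ T ∩ D <;> simp [hyT, indicator]
        rw [this]
        by_cases hxS : x ∈ S ∩ E N <;> simp [hxS, indicator, Function.uncurry]
      simp only [Pi.sub_apply]
      rw [integral_sub hκi.integrableOn hbi.integrableOn, e1, e2, sub_self])
    calc ∫⁻ x in E N, ∫⁻ y, ‖κ x y‖ₑ ^ (2 : ℝ) ∂m ∂m
        = ∫⁻ x in E N, ∫⁻ y in D, ‖κ x y‖ₑ ^ (2 : ℝ) ∂m ∂m := by
          congr 1
          funext x
          rw [← lintegral_indicator hD]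
          congr 1
          funext y
          by_cases hy : y ∈ D
          · simp [hy]
          · simp [hy, hr x y hy]
      _ = ∫⁻ p, ‖Function.uncurry κ p‖ₑ ^ (2 : ℝ) ∂ν :=
          (lintegral_prod _ (hκ.enorm.pow_const _).aemeasurable).symm
      _ = ∫⁻ p, ‖b p‖ₑ ^ (2 : ℝ) ∂ν := by
          refine lintegral_congr_ae ?_
          filter_upwards [hzero] with p hp
          have hp' : Function.uncurry κ p = b p := sub_eq_zero.1 hp
          rw [hp']
      _ ≤ C := by
          rw [hνm]
          exact setLIntegral_le_lintegral _ _
  -- Applying the kernel to the indicator of D shows that almost every row is absolutely integrable.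
  have hcover : ∀ᵐ x ∂m, x ∈ D → x ∈ ⋃ N, E N := by
    filter_upwards [h (indicatorConstLp 2 hD hmD (1 : ℂ))] with x hx hxD
    have h1 : ∫⁻ y, ‖κ x y‖ₑ ∂m < ∞ := by
      refine lt_of_eq_of_lt ?_ hx.1.2
      refine lintegral_congr_ae ?_
      filter_upwards [indicatorConstLp_coeFn (p := 2) (hs := hD) (hμs := hmD) (c := (1 : ℂ))]
        with y hy
      rw [hy]
      by_cases hyD : y ∈ D
      · simp [hyD]
      · simp [hyD, hr x y hyD]
    obtain ⟨N, hN⟩ := ENNReal.exists_nat_gt h1.ne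
    exact mem_iUnion.2 ⟨N, hN.le, hxD⟩
  have hmono : Monotone E := fun N M hNM x hx =>
    ⟨le_trans (show ∫⁻ y, ‖κ x y‖ₑ ∂m ≤ (N : ℝ≥0∞) from hx.1) (by exact_mod_cast hNM), hx.2⟩
  refine ne_top_of_le_ne_top hCtop ?_
  calc ∫⁻ x, ∫⁻ y, ‖κ x y‖ₑ ^ (2 : ℝ) ∂m ∂m
      = ∫⁻ x in ⋃ N, E N, ∫⁻ y, ‖κ x y‖ₑ ^ (2 : ℝ) ∂m ∂m := by
        rw [← lintegral_indicator (MeasurableSet.iUnion hE)]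
        refine lintegral_congr_ae ?_
        filter_upwards [hcover] with x hx
        by_cases hxD : x ∈ D
        · rw [indicator_of_mem (hx hxD)]
        · have : x ∉ ⋃ N, E N := fun h' => by
            obtain ⟨N, hN⟩ := mem_iUnion.1 h'
            exact hxD hN.2
          rw [indicator_of_notMem this]
          simp [hl x _ hxD]
    _ = ⨆ N, ∫⁻ x in E N, ∫⁻ y, ‖κ x y‖ₑ ^ (2 : ℝ) ∂m ∂m :=
        setLIntegral_iUnion_of_directed _ (hmono.directed_le)
    _ ≤ C := iSup_le hbound

end SquareIntegrable

/-! ### Traces of powers as integrals of iterated kernels. -/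

section KernelTrace

variable {X : Type*} [MeasurableSpace X] {m : Measure X} [SigmaFinite m]

/-- A square integrable kernel may be changed on a null set so as to have square integrable rows
and columns. -/
theorem exists_isFredholmKernel {κ : X → X → ℂ} (hκ : Measurable (Function.uncurry κ))
    (hsq : ∫⁻ x, ∫⁻ y, ‖κ x y‖ₑ ^ (2 : ℝ) ∂m ∂m ≠ ∞) (hd : ∫⁻ x, ‖κ x x‖ₑ ∂m ≠ ∞) :
    ∃ (κ' : X → X → ℂ) (G : Set X), IsFredholmKernel m κ' ∧ (∀ᵐ x ∂m, x ∈ G) ∧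
      ∀ x ∈ G, ∀ y ∈ G, κ' x y = κ x y := by
  have hr : Measurable fun x => ∫⁻ y, ‖κ x y‖ₑ ^ (2 : ℝ) ∂m :=
    Measurable.lintegral_prod_right' (f := fun p : X × X => ‖κ p.1 p.2‖ₑ ^ (2 : ℝ))
      (hκ.enorm.pow_const _)
  have hc : Measurable fun y => ∫⁻ x, ‖κ x y‖ₑ ^ (2 : ℝ) ∂m :=
    Measurable.lintegral_prod_left' (f := fun p : X × X => ‖κ p.1 p.2‖ₑ ^ (2 : ℝ))
      (hκ.enorm.pow_const _)
  set G : Set X := {x | ∫⁻ y, ‖κ x y‖ₑ ^ (2 : ℝ) ∂m < ∞} ∩ {y | ∫⁻ x, ‖κ x y‖ₑ ^ (2 : ℝ) ∂m < ∞}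
    with hG
  have hGm : MeasurableSet G :=
    (measurableSet_lt hr measurable_const).inter (measurableSet_lt hc measurable_const)
  classical
  have hle : ∀ x y, ‖(if x ∈ G ∧ y ∈ G then κ x y else 0)‖ₑ ≤ ‖κ x y‖ₑ := by
    intro x y; split_ifs <;> simp
  have hz : (1 / 2 : ℝ) ≥ 0 := by norm_num
  refine ⟨fun x y => if x ∈ G ∧ y ∈ G then κ x y else 0, G, ⟨?_, fun x => ?_, fun y => ?_, ?_, ?_⟩,
    ?_, fun x hx y hy => by simp [hx, hy]⟩
  · exact Measurable.ite ((measurable_fst hGm).inter (measurable_snd hGm)) hκ measurable_const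
  · refine ENNReal.rpow_ne_top_of_nonneg hz ?_
    by_cases hx : x ∈ G
    · refine ne_top_of_le_ne_top hx.1.ne (lintegral_mono fun y => ?_)
      gcongr
      exact hle x y
    · simp [hx]
  · refine ENNReal.rpow_ne_top_of_nonneg hz ?_
    by_cases hy : y ∈ G
    · refine ne_top_of_le_ne_top hy.2.ne (lintegral_mono fun x => ?_)
      gcongr
      exact hle x y
    · simp [hy]
  · refine ne_top_of_le_ne_top hsq (lintegral_mono fun x => lintegral_mono fun y => ?_)
    gcongr
    exact hle x y
  · exact ne_top_of_le_ne_top hd (lintegral_mono fun x => hle x x)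
  · have h1 := ae_lt_top hr hsq
    have h2 := ae_lt_top hc (by
      rwa [lintegral_lintegral_swap (hκ.enorm.pow_const _).aemeasurable] at hsq)
    filter_upwards [h1, h2] with x h1 h2 using ⟨h1, h2⟩

omit [SigmaFinite m] in
theorem IsKernel.congr {κ κ' : X → X → ℂ} {B : Lp ℂ 2 m →L[ℂ] Lp ℂ 2 m} (h : IsKernel m κ B)
    {G : Set X} (hG : ∀ᵐ x ∂m, x ∈ G) (he : ∀ x ∈ G, ∀ y ∈ G, κ' x y = κ x y) :
    IsKernel m κ' B := by
  intro f
  filter_upwards [h f, hG] with x hx hxG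
  have e : (fun y => κ x y * f y) =ᵐ[m] fun y => κ' x y * f y := by
    filter_upwards [hG] with y hy
    rw [he x hxG y hy]
  exact ⟨hx.1.congr e, hx.2.trans (integral_congr_ae e)⟩

theorem kdet_ae_eq {κ κ' : X → X → ℂ} {G : Set X} (hG : ∀ᵐ x ∂m, x ∈ G)
    (he : ∀ x ∈ G, ∀ y ∈ G, κ' x y = κ x y) (n : ℕ) :
    (fun z : Fin n → X => kdet κ' z) =ᵐ[Measure.pi fun _ => m] fun z => kdet κ z := by
  have h : ∀ᵐ z ∂(Measure.pi fun _ : Fin n => m), ∀ i, z i ∈ G := by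
    rw [ae_all_iff]
    intro i
    exact (Measure.quasiMeasurePreserving_eval (μ := fun _ : Fin n => m) i).ae hG
  filter_upwards [h] with z hz
  unfold kdet
  congr 1
  ext i j
  simp [he _ (hz i) _ (hz j)]

namespace IsFredholmKernel

variable {κ : X → X → ℂ} (hκ : IsFredholmKernel m κ)
include hκ

omit [SigmaFinite m] in
theorem memLp_col (y : X) : MemLp (fun x => κ x y) 2 m := by
  refine memLp_two_of_lintegral (hκ.measurable_col y).aestronglyMeasurable fun h => hκ.col y ?_
  rw [colNorm, h, ENNReal.top_rpow_of_pos (by norm_num)]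

omit [SigmaFinite m] in
theorem memLp_row (x : X) : MemLp (κ x) 2 m := by
  refine memLp_two_of_lintegral (hκ.measurable_row x).aestronglyMeasurable fun h => hκ.row x ?_
  rw [rowNorm, h, ENNReal.top_rpow_of_pos (by norm_num)]

theorem lintegral_kernel_L2_le (u f : Lp ℂ 2 m) :
    ∫⁻ z, ∫⁻ x, ‖(starRingEnd ℂ) (u z) * κ z x * f x‖ₑ ∂m ∂m ≠ ∞ := by
  have hA := hκ.lintegral_rowNorm_sq
  have hf := (Lp.stronglyMeasurable f).measurable
  have hu := (Lp.stronglyMeasurable u).measurable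
  have h1 : ∀ z, ∫⁻ x, ‖(starRingEnd ℂ) (u z) * κ z x * f x‖ₑ ∂m ≤
      ‖u z‖ₑ * rowNorm m κ z * ‖f‖ₑ := by
    intro z
    simp only [enorm_mul, RCLike.enorm_conj, mul_assoc]
    rw [lintegral_const_mul' _ _ enorm_ne_top, enorm_L2 f]
    gcongr
    exact hκ.lintegral_row_mul_le z hf.enorm
  refine ne_top_of_le_ne_top ?_ (lintegral_mono h1)
  rw [lintegral_mul_const' _ _ enorm_ne_top]
  refine ENNReal.mul_ne_top (ne_top_of_le_ne_top ?_ (ENNReal.lintegral_mul_le_Lp_mul_Lq m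
    Real.HolderConjugate.two_two hu.enorm.aemeasurable hκ.measurable_rowNorm.aemeasurable))
    enorm_ne_top
  rw [← enorm_L2]
  exact ENNReal.mul_ne_top enorm_ne_top (ENNReal.rpow_ne_top_of_nonneg (by norm_num) hA)

theorem integrable_kernel_L2 (u f : Lp ℂ 2 m) :
    Integrable (fun p : X × X => (starRingEnd ℂ) (u p.1) * κ p.1 p.2 * f p.2) (m.prod m) := by
  have hf := (Lp.stronglyMeasurable f).measurable
  have hu := (Lp.stronglyMeasurable u).measurable
  have hm : Measurable fun p : X × X => (starRingEnd ℂ) (u p.1) * κ p.1 p.2 * f p.2 :=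
    ((RCLike.continuous_conj.measurable.comp (hu.comp measurable_fst)).mul hκ.measurable).mul
      (hf.comp measurable_snd)
  refine ⟨hm.aestronglyMeasurable, ?_⟩
  rw [HasFiniteIntegral, lintegral_prod _ hm.enorm.aemeasurable]
  exact (hκ.lintegral_kernel_L2_le u f).lt_top

/-- Fubini shows that pairing the function on the right with any f gives ⟨u, B f⟩ up to the
convention for the adjoint; square integrability of the column norms puts that function in L². -/
theorem star_apply_ae {B : Lp ℂ 2 m →L[ℂ] Lp ℂ 2 m} (hB : IsKernel m κ B) (u : Lp ℂ 2 m) :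
    ∀ᵐ x ∂m, star B u x = ∫ z, (starRingEnd ℂ) (κ z x) * u z ∂m := by
  have hu := (Lp.stronglyMeasurable u).measurable
  have hmeas : StronglyMeasurable fun x => ∫ z, (starRingEnd ℂ) (κ z x) * u z ∂m := by
    refine StronglyMeasurable.integral_prod_right'
      (f := fun p : X × X => (starRingEnd ℂ) (κ p.2 p.1) * u p.2) ?_
    exact ((RCLike.continuous_conj.measurable.comp (hκ.measurable.comp measurable_swap)).mul
      (hu.comp measurable_snd)).stronglyMeasurable
  have hle : ∀ x, ‖∫ z, (starRingEnd ℂ) (κ z x) * u z ∂m‖ₑ ≤ colNorm m κ x * ‖u‖ₑ := by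
    intro x
    refine (enorm_integral_le_lintegral_enorm _).trans ?_
    simp only [enorm_mul, RCLike.enorm_conj]
    rw [enorm_L2]
    exact ENNReal.lintegral_mul_le_Lp_mul_Lq m Real.HolderConjugate.two_two
      (hκ.measurable_col x).enorm.aemeasurable hu.enorm.aemeasurable
  have hv : MemLp (fun x => ∫ z, (starRingEnd ℂ) (κ z x) * u z ∂m) 2 m := by
    refine memLp_two_of_lintegral hmeas.aestronglyMeasurable (ne_top_of_le_ne_top ?_
      (lintegral_mono fun x => ENNReal.rpow_le_rpow (hle x) zero_le_two))
    simp only [ENNReal.mul_rpow_of_nonneg _ _ (zero_le_two (α := ℝ))]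
    rw [lintegral_mul_const' _ _ (ENNReal.rpow_ne_top_of_nonneg zero_le_two enorm_ne_top)]
    exact ENNReal.mul_ne_top hκ.lintegral_colNorm_sq
      (ENNReal.rpow_ne_top_of_nonneg zero_le_two enorm_ne_top)
  have heq : star B u = hv.toLp := by
    refine ext_inner_right ℂ fun f => ?_
    rw [ContinuousLinearMap.star_eq_adjoint, ContinuousLinearMap.adjoint_inner_left, inner_L2,
      inner_L2]
    have e1 : ∫ z, (starRingEnd ℂ) (u z) * B f z ∂m =
        ∫ z, ∫ x, (starRingEnd ℂ) (u z) * κ z x * f x ∂m ∂m := by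
      refine integral_congr_ae ?_
      filter_upwards [hB f] with z hz
      rw [hz.2, ← integral_const_mul]
      simp only [mul_assoc]
    rw [e1, integral_integral_swap (hκ.integrable_kernel_L2 u f)]
    refine integral_congr_ae ?_
    filter_upwards [hv.coeFn_toLp] with x hx
    rw [hx, ← integral_conj, ← integral_mul_const]
    congr 1
    funext z
    rw [map_mul, RCLike.conj_conj]
    ring
  rw [heq]
  exact hv.coeFn_toLp

-- Each further integration against κ applies B once more to the column at y, which lies in L² for
-- every y. The result can thus be used at the diagonal point y = x.
omit [SigmaFinite m] in
theorem iterKernel_col_ae {B : Lp ℂ 2 m →L[ℂ] Lp ℂ 2 m} (hB : IsKernel m κ B) (l : ℕ) (y : X) :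
    (fun x => iterKernel m κ l x y) =ᵐ[m] (B ^ l) (hκ.memLp_col y).toLp := by
  induction l with
  | zero => exact (hκ.memLp_col y).coeFn_toLp.symm
  | succ l ih =>
    rw [pow_succ', mul_apply_eq_comp]
    filter_upwards [hB ((B ^ l) (hκ.memLp_col y).toLp)] with x hx
    rw [hx.2]
    refine integral_congr_ae ?_
    filter_upwards [ih] with z hz
    rw [hz]

/-- The traces of the powers of an operator with a Fredholm kernel. -/
theorem integral_iterKernel_eq_trace [Countable (BasisIndex (Lp ℂ 2 m))]
    {B : Lp ℂ 2 m →L[ℂ] Lp ℂ 2 m} (hB : IsKernel m κ B) (hBs : hs B ≠ ∞) (l : ℕ) :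
    ∫ x, iterKernel m κ (l + 1) x x ∂m = trace (B ^ (l + 2)) := by
  set e := onBasis (Lp ℂ 2 m) with he
  -- Parseval at a fixed x: the diagonal value is the pairing of row x with B^l applied to column x.
  -- Its expansion in the basis can be integrated term by term, giving ∑ ⟨(B*)^(l+1) e_i, B e_i⟩.
  have hpt : ∀ᵐ x ∂m, iterKernel m κ (l + 1) x x =
      ∑' i, (starRingEnd ℂ) ((star B ^ (l + 1)) (e i) x) * B (e i) x := by
    have h1 : ∀ᵐ x ∂m, ∀ i, B (e i) x = ∫ z, κ x z * e i z ∂m :=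
      ae_all_iff.2 fun i => (hB (e i)).mono fun x hx => hx.2
    have h2 : ∀ᵐ x ∂m, ∀ i, star B ((star B ^ l) (e i)) x =
        ∫ z, (starRingEnd ℂ) (κ z x) * (star B ^ l) (e i) z ∂m :=
      ae_all_iff.2 fun i => hκ.star_apply_ae hB _
    filter_upwards [h1, h2] with x h1 h2
    have hr : MemLp (fun z => (starRingEnd ℂ) (κ x z)) 2 m := by
      exact (hκ.memLp_row x).star
    set c := (hκ.memLp_col x).toLp with hc
    have e1 : iterKernel m κ (l + 1) x x = ⟪hr.toLp, (B ^ l) c⟫_ℂ := by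
      rw [inner_L2]
      change ∫ z, κ x z * iterKernel m κ l z x ∂m = _
      refine integral_congr_ae ?_
      filter_upwards [hκ.iterKernel_col_ae hB l x, hr.coeFn_toLp] with z hz hz2
      rw [hz2, RCLike.conj_conj]
      rw [hz]
    rw [e1, ← e.tsum_inner_mul_inner]
    refine tsum_congr fun i => ?_
    rw [mul_comm]
    congr 1
    · rw [← ContinuousLinearMap.adjoint_inner_left, ← ContinuousLinearMap.star_eq_adjoint,
        star_pow, pow_succ', mul_apply_eq_comp, h2 i, ← integral_conj, inner_L2]
      refine integral_congr_ae ?_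
      filter_upwards [(hκ.memLp_col x).coeFn_toLp] with z hz
      rw [hc, hz, map_mul, RCLike.conj_conj, mul_comm]
    · rw [h1 i, inner_L2]
      refine integral_congr_ae ?_
      filter_upwards [hr.coeFn_toLp] with z hz
      rw [hz, RCLike.conj_conj]
  rw [integral_congr_ae hpt, integral_tsum]
  · rw [trace]
    refine tsum_congr fun i => ?_
    rw [← inner_L2, ← star_pow, ContinuousLinearMap.star_eq_adjoint,
      ContinuousLinearMap.adjoint_inner_left, ← mul_apply_eq_comp, ← pow_succ]
  · exact fun i => (integrable_conj_mul_L2 _ _).aestronglyMeasurable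
  · have hstar : hs (star B ^ (l + 1)) ≠ ∞ := by
      rw [pow_succ]
      exact hs_mul_ne_top_left _ (by rwa [hs_star])
    refine ne_top_of_le_ne_top (ENNReal.mul_ne_top hstar hBs) (le_trans ?_ (tsum_mul_le_L2 _ _))
    refine ENNReal.tsum_le_tsum fun i => ?_
    simp only [enorm_mul, RCLike.enorm_conj]
    exact lintegral_enorm_mul_L2_le _ _

end IsFredholmKernel
end KernelTrace

/-! ### Moving multipliers around the trace and the determinant. -/

section Sandwich

variable {H : Type*} [NormedAddCommGroup H] [InnerProductSpace ℂ H] [CompleteSpace H]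
variable {P₁ P₂ A R s g : H →L[ℂ] H}

omit [CompleteSpace H] in
theorem evenPart_mul_mul (A : H →L[ℂ] H) (hs₁ : Commute s P₁) (hs₂ : Commute s P₂)
    (hg₁ : Commute g P₁) (hg₂ : Commute g P₂) :
    evenPart P₁ P₂ (s * A * g) = s * evenPart P₁ P₂ A * g := by
  simp only [evenPart, mul_add, add_mul, mul_assoc, hg₁.eq, hg₂.eq]
  simp only [← mul_assoc, hs₁.eq, hs₂.eq]

omit [CompleteSpace H] in
theorem oddPart_mul_mul (A : H →L[ℂ] H) (hs₁ : Commute s P₁) (hs₂ : Commute s P₂)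
    (hg₁ : Commute g P₁) (hg₂ : Commute g P₂) :
    oddPart P₁ P₂ (s * A * g) = s * oddPart P₁ P₂ A * g := by
  simp only [oddPart, mul_add, add_mul, mul_assoc, hg₁.eq, hg₂.eq]
  simp only [← mul_assoc, hs₁.eq, hs₂.eq]

omit [CompleteSpace H] in
theorem evenPart_add_oddPart (h : P₁ + P₂ = 1) (A : H →L[ℂ] H) :
    evenPart P₁ P₂ A + oddPart P₁ P₂ A = A := by
  calc _ = (P₁ + P₂) * A * (P₁ + P₂) := by simp only [evenPart, oddPart]; noncomm_ring
    _ = A := by rw [h, one_mul, mul_one]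

theorem hs_ne_top_of_sqrt (h : P₁ + P₂ = 1) (hR : R * R = evenPart P₁ P₂ A) (hRs : hs R ≠ ∞)
    (hA : IsHilbertSchmidt (oddPart P₁ P₂ A)) : hs A ≠ ∞ := by
  rw [← evenPart_add_oddPart h A, ← hR]
  exact hs_add_ne_top (hs_mul_ne_top_left R hRs) (isHilbertSchmidt_iff.1 hA)

theorem memL12_mul_mul (hs₁ : Commute s P₁) (hs₂ : Commute s P₂) (hg₁ : Commute g P₁)
    (hg₂ : Commute g P₂) (hR : R * R = evenPart P₁ P₂ A) (hRs : hs R ≠ ∞)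
    (hA : IsHilbertSchmidt (oddPart P₁ P₂ A)) : MemL12 P₁ P₂ (s * A * g) := by
  refine ⟨?_, ?_⟩
  · rw [evenPart_mul_mul A hs₁ hs₂ hg₁ hg₂, ← hR,
      show s * (R * R) * g = (s * R) * (R * g) by simp only [mul_assoc]]
    exact isTraceClass_mul (hs_mul_ne_top_left s hRs) (hs_mul_ne_top_right g hRs)
  · rw [oddPart_mul_mul A hs₁ hs₂ hg₁ hg₂, isHilbertSchmidt_iff]
    exact hs_mul_ne_top_right g (hs_mul_ne_top_left s (isHilbertSchmidt_iff.1 hA))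

/-- Factoring the operator as R · R leaves a Hilbert-Schmidt factor on each side, so cyclicity for
Hilbert-Schmidt pairs lets s and g meet in the middle. -/
theorem trace_sandwich (s g : H →L[ℂ] H) (hRs : hs R ≠ ∞) :
    trace (s * (R * R) * g) = trace (R * (g * s) * R) := by
  rw [show s * (R * R) * g = (s * R) * (R * g) by simp only [mul_assoc],
    trace_mul_comm (hs_mul_ne_top_left s hRs) (hs_mul_ne_top_right g hRs)]
  simp only [mul_assoc]

theorem trace_evenPart_mul_mul (hs₁ : Commute s P₁) (hs₂ : Commute s P₂) (hg₁ : Commute g P₁)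
    (hg₂ : Commute g P₂) (hR : R * R = evenPart P₁ P₂ A) (hRs : hs R ≠ ∞) :
    trace (evenPart P₁ P₂ (s * A * g)) = trace (R * (g * s) * R) := by
  rw [evenPart_mul_mul A hs₁ hs₂ hg₁ hg₂, ← hR, trace_sandwich s g hRs]

/-- With at least two factors Y, one can be split off while the rest stays Hilbert-Schmidt; this is
why the exponent starts at 2. -/
theorem trace_pow_mul_comm {Y : H →L[ℂ] H} (s : H →L[ℂ] H) (hY : hs Y ≠ ∞) (l : ℕ) :
    trace ((Y * s) ^ (l + 2)) = trace ((s * Y) ^ (l + 2)) := by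
  have h1 : (Y * s) ^ (l + 2) = Y * ((s * Y) ^ (l + 1) * s) := by
    rw [pow_succ, ← mul_assoc, mul_pow_mul, mul_assoc]
  have h2 : (s * Y) ^ (l + 2) = (s * Y) ^ (l + 1) * s * Y := by
    rw [pow_succ, mul_assoc]
  have h3 : hs ((s * Y) ^ (l + 1) * s) ≠ ∞ := by
    rw [pow_succ]
    exact hs_mul_ne_top_right s (hs_mul_ne_top_left _ (hs_mul_ne_top_left s hY))
  rw [h1, h2, trace_mul_comm hY h3]

theorem extDet_mul_mul_eq [TopologicalSpace.SeparableSpace H] (hs₁ : Commute s P₁)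
    (hs₂ : Commute s P₂) (hg₁ : Commute g P₁) (hg₂ : Commute g P₂) (h : P₁ + P₂ = 1)
    (hR : R * R = evenPart P₁ P₂ A) (hRs : hs R ≠ ∞) (hA : IsHilbertSchmidt (oddPart P₁ P₂ A)) :
    extDet P₁ P₂ (A * (g * s)) = extDet P₁ P₂ (s * A * g) := by
  have := countable_basisIndex (H := H)
  have hAs := hs_ne_top_of_sqrt h hR hRs hA
  refine extDet_congr (hs_mul_ne_top_right _ hAs)
    (hs_mul_ne_top_right _ (hs_mul_ne_top_left _ hAs)) ?_ fun l => ?_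
  · have := trace_evenPart_mul_mul (s := 1) (A := A) (Commute.one_left P₁) (Commute.one_left P₂)
      (hg₁.mul_left hs₁) (hg₂.mul_left hs₂) hR hRs
    rw [one_mul, mul_one] at this
    rw [this, trace_evenPart_mul_mul hs₁ hs₂ hg₁ hg₂ hR hRs]
  · rw [← mul_assoc, trace_pow_mul_comm s (hs_mul_ne_top_right g hAs), mul_assoc]

end Sandwich

/-! ### Multiplication operators and the projections P^S. -/

section MulOp

variable {X : Type*} [MeasurableSpace X] {m : Measure X} {f h : X → ℂ}

theorem mulOp_mul (hf : MemLp f ∞ m) (hh : MemLp h ∞ m) :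
    mulOp m f * mulOp m h = mulOp m fun x => f x * h x := by
  have hfh : MemLp (fun x => f x * h x) ∞ m := hh.mul' hf
  ext1 u
  apply Lp.ext
  rw [mul_apply_eq_comp]
  filter_upwards [coeFn_mulOp hf (mulOp m h u), coeFn_mulOp hh u, coeFn_mulOp hfh u]
    with x h1 h2 h3
  rw [h1, h2, h3, mul_assoc]

theorem mulOp_commute (hf : MemLp f ∞ m) (hh : MemLp h ∞ m) :
    Commute (mulOp m f) (mulOp m h) := by
  rw [Commute, SemiconjBy, mulOp_mul hf hh, mulOp_mul hh hf]
  simp only [mul_comm]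

theorem star_mulOp (hf : MemLp f ∞ m) (hr : ∀ x, (starRingEnd ℂ) (f x) = f x) :
    star (mulOp m f) = mulOp m f := by
  rw [ContinuousLinearMap.star_eq_adjoint, eq_comm, ContinuousLinearMap.eq_adjoint_iff]
  intro u v
  rw [inner_L2, inner_L2]
  refine integral_congr_ae ?_
  filter_upwards [coeFn_mulOp hf u, coeFn_mulOp hf v] with x h1 h2
  rw [h1, h2, map_mul, hr]
  ring

theorem memLp_top_ofReal {φ : X → ℝ} (hφ : Measurable φ) {C : ℝ} (hC : ∀ x, |φ x| ≤ C) :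
    MemLp (fun x => (φ x : ℂ)) ∞ m := by
  refine memLp_top_of_bound (Complex.measurable_ofReal.comp hφ).aestronglyMeasurable C
    (ae_of_all _ fun x => ?_)
  simpa using hC x

theorem memLp_top_indicator {S : Set X} (hS : MeasurableSet S) :
    MemLp (S.indicator fun _ => (1 : ℂ)) ∞ m :=
  (memLp_top_const 1).indicator hS

theorem proj_mul_proj {S T : Set X} (hS : MeasurableSet S) (hT : MeasurableSet T) :
    proj m S * proj m T = proj m (S ∩ T) := by
  rw [proj, proj, mulOp_mul (memLp_top_indicator hS) (memLp_top_indicator hT), proj]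
  congr 1
  ext x
  by_cases h1 : x ∈ S <;> by_cases h2 : x ∈ T <;> simp [h1, h2]

theorem proj_mul_mulOp {S : Set X} (hS : MeasurableSet S) (hf : MemLp f ∞ m)
    (h0 : ∀ x, x ∉ S → f x = 0) : proj m S * mulOp m f = mulOp m f := by
  rw [proj, mulOp_mul (memLp_top_indicator hS) hf]
  congr 1
  ext x
  by_cases h1 : x ∈ S <;> simp [h1, h0]

theorem proj_commute_mulOp {S : Set X} (hS : MeasurableSet S) (hf : MemLp f ∞ m) :
    Commute (mulOp m f) (proj m S) :=
  mulOp_commute hf (memLp_top_indicator hS)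

theorem star_proj {S : Set X} (hS : MeasurableSet S) : star (proj m S) = proj m S := by
  refine star_mulOp (memLp_top_indicator hS) fun x => ?_
  by_cases h : x ∈ S <;> simp [h]

theorem proj_add_proj_compl {S : Set X} (hS : MeasurableSet S) :
    proj m S + proj m Sᶜ = 1 := by
  ext1 u
  apply Lp.ext
  filter_upwards [Lp.coeFn_add (proj m S u) (proj m Sᶜ u),
    coeFn_mulOp (memLp_top_indicator hS) u, coeFn_mulOp (memLp_top_indicator hS.compl) u]
    with x h1 h2 h3
  change (proj m S u + proj m Sᶜ u : Lp ℂ 2 m) x = u x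
  rw [h1, Pi.add_apply, proj, proj, h2, h3]
  by_cases h : x ∈ S <;> simp [h]

/-- P^D commutes with both P_i, so the even part of K^D is P^D K_even P^D, which inherits positivity
from the two diagonal blocks. -/
theorem exists_sqrt_evenPart_compress {X₁ D : Set X} (hX₁ : MeasurableSet X₁)
    (hD : MeasurableSet D) {K : Lp ℂ 2 m →L[ℂ] Lp ℂ 2 m}
    (hK₁ : (proj m X₁ * K * proj m X₁).IsPositive)
    (hK₂ : (proj m X₁ᶜ * K * proj m X₁ᶜ).IsPositive)
    (hK : IsTraceClass (evenPart (proj m X₁) (proj m X₁ᶜ) (compress m D K))) :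
    ∃ R : Lp ℂ 2 m →L[ℂ] Lp ℂ 2 m, star R = R ∧
      R * R = evenPart (proj m X₁) (proj m X₁ᶜ) (compress m D K) ∧ hs R ≠ ∞ := by
  refine hK.exists_sqrt ?_
  have hc₁ := proj_commute_mulOp hX₁ (memLp_top_indicator (m := m) hD)
  have hc₂ := proj_commute_mulOp hX₁.compl (memLp_top_indicator (m := m) hD)
  rw [compress, evenPart_mul_mul (s := proj m D) (g := proj m D) K hc₁ hc₂ hc₁ hc₂]
  have h := star_left_conjugate_nonneg (a := evenPart (proj m X₁) (proj m X₁ᶜ) K)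
    (add_nonneg ((ContinuousLinearMap.nonneg_iff_isPositive _).2 hK₁)
      ((ContinuousLinearMap.nonneg_iff_isPositive _).2 hK₂)) (proj m D)
  rwa [star_proj hD] at h

end MulOp

/-! ### The density x ↦ ∑ |(R e_i)(x)|² and traces against multipliers. -/

section Diagonal

variable {X : Type*} [MeasurableSpace X] {m : Measure X} {f : X → ℂ}
  {R : Lp ℂ 2 m →L[ℂ] Lp ℂ 2 m}

/-- The diagonal `∑ |(R e_i)(x)|²` of the kernel of `R R*`. -/
def hsDensity (R : Lp ℂ 2 m →L[ℂ] Lp ℂ 2 m) (x : X) : ℂ :=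
  ∑' i, (starRingEnd ℂ) (R (onBasis _ i) x) * R (onBasis _ i) x

theorem tsum_lintegral_enorm_mul_ne_top {U V : Lp ℂ 2 m →L[ℂ] Lp ℂ 2 m} (hU : hs U ≠ ∞)
    (hV : hs V ≠ ∞) :
    ∑' i, ∫⁻ x, ‖(starRingEnd ℂ) (U (onBasis _ i) x) * V (onBasis _ i) x‖ₑ ∂m ≠ ∞ := by
  refine ne_top_of_le_ne_top (ENNReal.mul_ne_top hU hV) ?_
  refine le_trans (ENNReal.tsum_le_tsum fun i => ?_) (tsum_mul_le_L2 _ _)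
  refine le_trans (le_of_eq ?_) (lintegral_enorm_mul_L2_le _ _)
  simp only [enorm_mul, RCLike.enorm_conj]

variable [Countable (BasisIndex (Lp ℂ 2 m))]

theorem integrable_hsDensity (hR : hs R ≠ ∞) : Integrable (hsDensity R) m := by
  have hm : ∀ i, Measurable
      (fun x => (starRingEnd ℂ) (R (onBasis _ i) x) * R (onBasis _ i) x) := fun i =>
    (RCLike.continuous_conj.measurable.comp (Lp.stronglyMeasurable _).measurable).mul
      (Lp.stronglyMeasurable _).measurable
  refine ⟨(Measurable.tsum hm).aestronglyMeasurable, ?_⟩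
  refine lt_of_le_of_lt ?_ (tsum_lintegral_enorm_mul_ne_top hR hR).lt_top
  rw [← lintegral_tsum fun i => (hm i).enorm.aemeasurable]
  exact lintegral_mono fun x => enorm_tsum_le_tsum_enorm

/-- Self-adjointness of R turns the trace into ∑ ⟨R e_i, f R e_i⟩; sum and integral may be exchanged
because R is Hilbert-Schmidt. -/
theorem trace_mul_mulOp_mul (hR : hs R ≠ ∞) (hsa : star R = R) (hf : MemLp f ∞ m) :
    trace (R * mulOp m f * R) = ∫ x, f x * hsDensity R x ∂m := by
  have hV : hs (mulOp m f * R) ≠ ∞ := hs_mul_ne_top_left _ hR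
  have h1 := integral_tsum (fun i => (integrable_conj_mul_L2 (R (onBasis _ i))
    ((mulOp m f * R) (onBasis _ i))).aestronglyMeasurable) (tsum_lintegral_enorm_mul_ne_top hR hV)
  calc trace (R * mulOp m f * R)
      = ∑' i, ⟪R (onBasis _ i), (mulOp m f * R) (onBasis _ i)⟫_ℂ := by
        refine tsum_congr fun i => ?_
        rw [mul_assoc, mul_apply_eq_comp, ← ContinuousLinearMap.adjoint_inner_left,
          ← ContinuousLinearMap.star_eq_adjoint, hsa]
    _ = _ := by
        simp only [inner_L2]
        rw [← h1]
        refine integral_congr_ae ?_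
        filter_upwards [ae_all_iff.2 fun i => coeFn_mulOp hf (R (onBasis _ i))] with x hx
        rw [hsDensity, ← tsum_mul_left]
        refine tsum_congr fun i => ?_
        rw [mul_apply_eq_comp, hx]
        ring

theorem trace_mul_proj_mul (hR : hs R ≠ ∞) (hsa : star R = R) {S : Set X} (hS : MeasurableSet S) :
    trace (R * proj m S * R) = ∫ x in S, hsDensity R x ∂m := by
  rw [proj, trace_mul_mulOp_mul hR hsa (memLp_top_indicator hS), ← integral_indicator hS]
  refine integral_congr_ae (ae_of_all _ fun x => ?_)
  by_cases h : x ∈ S <;> simp [h]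

end Diagonal

/-! ### The kernel of sgn(φ)√|φ| K √|φ|. -/

section Kernel

variable {X : Type*} [MeasurableSpace X] {m : Measure X} {φ : X → ℝ}

/-- The kernel of `a K b`. -/
def sandwichKernel (a b : X → ℝ) (k : X → X → ℂ) (x y : X) : ℂ := a x * k x y * b y

/-- The function `√|φ|`. -/
def sqrtAbs (φ : X → ℝ) (x : X) : ℝ := √|φ x|

/-- The function `sgn(φ) √|φ|`. -/
def signSqrt (φ : X → ℝ) (x : X) : ℝ := Real.sign (φ x) * √|φ x|

omit [MeasurableSpace X] in
theorem signSqrt_mul_sqrtAbs (φ : X → ℝ) (x : X) : signSqrt φ x * sqrtAbs φ x = φ x := by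
  rw [signSqrt, sqrtAbs, mul_assoc, Real.mul_self_sqrt (abs_nonneg _)]
  rcases lt_trichotomy (φ x) 0 with h | h | h
  · rw [Real.sign_of_neg h, abs_of_neg h]; ring
  · simp [h]
  · rw [Real.sign_of_pos h, abs_of_pos h]; ring

theorem measurable_sqrtAbs (hφ : Measurable φ) : Measurable (sqrtAbs φ) := by
  unfold sqrtAbs
  fun_prop

theorem measurable_signSqrt (hφ : Measurable φ) : Measurable (signSqrt φ) := by
  have h : Measurable Real.sign :=
    (Measurable.ite measurableSet_Iio measurable_const
      (Measurable.ite measurableSet_Ioi measurable_const measurable_const))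
  exact (h.comp hφ).mul (measurable_sqrtAbs hφ)

omit [MeasurableSpace X] in
theorem abs_sqrtAbs_le {C : ℝ} (hφ : ∀ x, |φ x| ≤ C) (x : X) : |sqrtAbs φ x| ≤ √C := by
  rw [sqrtAbs, abs_of_nonneg (Real.sqrt_nonneg _)]
  exact Real.sqrt_le_sqrt (hφ x)

omit [MeasurableSpace X] in
theorem abs_signSqrt_le {C : ℝ} (hφ : ∀ x, |φ x| ≤ C) (x : X) : |signSqrt φ x| ≤ √C := by
  refine le_trans ?_ (abs_sqrtAbs_le hφ x)
  rw [signSqrt, abs_mul, sqrtAbs]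
  refine mul_le_of_le_one_left (abs_nonneg _) ?_
  rcases Real.sign_apply_eq (φ x) with h | h | h <;> simp [h]

-- Row factors and column factors come out of the determinant, and at each point their product is φ.
omit [MeasurableSpace X] in
theorem kdet_sandwichKernel (φ : X → ℝ) (k : X → X → ℂ) {n : ℕ} (z : Fin n → X) :
    kdet (sandwichKernel (signSqrt φ) (sqrtAbs φ) k) z = detIntegrand φ k n z := by
  have h : (Matrix.of fun i j : Fin n =>
      sandwichKernel (signSqrt φ) (sqrtAbs φ) k (z i) (z j)) = Matrix.of fun i j =>
        (signSqrt φ (z i) : ℂ) * (Matrix.of fun i j =>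
          (sqrtAbs φ (z j) : ℂ) * (Matrix.of fun i j => k (z i) (z j)) i j) i j := by
    ext i j
    simp only [sandwichKernel, Matrix.of_apply]
    ring
  rw [kdet, h, Matrix.det_mul_column, Matrix.det_mul_row, detIntegrand, ← mul_assoc,
    ← Finset.prod_mul_distrib]
  congr 1
  refine Finset.prod_congr rfl fun i _ => ?_
  rw [← Complex.ofReal_mul, signSqrt_mul_sqrtAbs]

theorem isKernel_sandwich [TopologicalSpace X] {K : Lp ℂ 2 m →L[ℂ] Lp ℂ 2 m} {k : X → X → ℂ}
    (hk : IsIntegralKernel m K k) {D : Set X} (hD : IsPrecompactBorel D) {a b : X → ℝ}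
    (ha : MemLp (fun x => (a x : ℂ)) ∞ m) (hb : MemLp (fun x => (b x : ℂ)) ∞ m)
    (h0 : ∀ x, x ∉ D → b x = 0) :
    IsKernel m (sandwichKernel a b k)
      (mulOp m (fun x => (a x : ℂ)) * K * mulOp m fun x => (b x : ℂ)) := by
  intro f
  have hbf := coeFn_mulOp hb f
  have h1 := hk.2 D hD (mulOp m (fun x => (b x : ℂ)) f) (by
    filter_upwards [hbf] with x hx hxD
    rw [hx, h0 x hxD, Complex.ofReal_zero, zero_mul])
  filter_upwards [h1, coeFn_mulOp ha (K (mulOp m (fun x => (b x : ℂ)) f))] with x hx hx2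
  have he : (fun y => sandwichKernel a b k x y * f y) =ᵐ[m]
      fun y => (a x : ℂ) * (k x y * mulOp m (fun x => (b x : ℂ)) f y) := by
    filter_upwards [hbf] with y hy
    rw [hy, sandwichKernel]
    ring
  refine ⟨(integrable_congr he).2 (hx.1.const_mul _), ?_⟩
  rw [integral_congr_ae he, integral_const_mul, ← hx.2, ← hx2]
  rfl

/-- Since `φ` vanishes outside `D`, the operator `sgn(φ) √|φ| K √|φ|` only depends on `K^D`. -/
theorem sqrtOp_eq {D : Set X} (hD : MeasurableSet D) {K : Lp ℂ 2 m →L[ℂ] Lp ℂ 2 m} {φ : X → ℝ}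
    (hs : MemLp (fun x => (signSqrt φ x : ℂ)) ∞ m) (hg : MemLp (fun x => (sqrtAbs φ x : ℂ)) ∞ m)
    (hφD : ∀ x, x ∉ D → φ x = 0) :
    sqrtOp m K φ = mulOp m (fun x => (signSqrt φ x : ℂ)) * compress m D K *
      mulOp m fun x => (sqrtAbs φ x : ℂ) := by
  have h1 := proj_mul_mulOp hD hs fun x hx => by simp [signSqrt, hφD x hx]
  have h2 := proj_mul_mulOp hD hg fun x hx => by simp [sqrtAbs, hφD x hx]
  rw [← (proj_commute_mulOp hD hs).eq] at h1
  calc sqrtOp m K φ = mulOp m (fun x => (signSqrt φ x : ℂ)) * K *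
        mulOp m fun x => (sqrtAbs φ x : ℂ) := rfl
    _ = (mulOp m (fun x => (signSqrt φ x : ℂ)) * proj m D) * K *
        (proj m D * mulOp m fun x => (sqrtAbs φ x : ℂ)) := by rw [h1, h2]
    _ = _ := by simp only [compress, mul_assoc]

theorem mulOp_sqrtAbs_mul_signSqrt {φ : X → ℝ} (hs : MemLp (fun x => (signSqrt φ x : ℂ)) ∞ m)
    (hg : MemLp (fun x => (sqrtAbs φ x : ℂ)) ∞ m) :
    mulOp m (fun x => (sqrtAbs φ x : ℂ)) * mulOp m (fun x => (signSqrt φ x : ℂ)) =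
      mulOp m fun x => (φ x : ℂ) := by
  rw [mulOp_mul hg hs]
  congr 1
  ext x
  rw [← Complex.ofReal_mul, mul_comm, signSqrt_mul_sqrtAbs]

end Kernel

/-! ### Identification of the diagonal, the series of integrals, and the theorem. -/

section Main

variable {X : Type*} [TopologicalSpace X] [PolishSpace X] [LocallyCompactSpace X]
    [MeasurableSpace X] [BorelSpace X] {m : Measure X} [IsFiniteMeasureOnCompacts m]

theorem separableSpace_L2 : TopologicalSpace.SeparableSpace (Lp ℂ 2 m) := by
  have : Fact ((2 : ℝ≥0∞) ≠ ∞) := ⟨by simp⟩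
  infer_instance

omit [PolishSpace X] [LocallyCompactSpace X] [BorelSpace X] in
theorem IsPrecompactBorel.subset {D S : Set X} (hD : IsPrecompactBorel D) (hS : MeasurableSet S)
    (h : S ⊆ D) : IsPrecompactBorel S :=
  ⟨hS, hD.2.of_isClosed_subset isClosed_closure (closure_mono h)⟩

omit [PolishSpace X] [LocallyCompactSpace X] [BorelSpace X] in
theorem IsPrecompactBorel.measure_ne_top {D : Set X} (hD : IsPrecompactBorel D) : m D ≠ ∞ :=
  ne_top_of_le_ne_top hD.2.measure_lt_top.ne (measure_mono subset_closure)

-- For every measurable S the integrals of both functions over S ∩ D equal the trace of the even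
-- part of K^(S ∩ D): on one side by condition (iii), on the other because that trace is Tr(R P^(S ∩
-- D) R).
omit [PolishSpace X] [LocallyCompactSpace X] [BorelSpace X] [IsFiniteMeasureOnCompacts m] in
theorem diag_ae_eq_hsDensity [Countable (BasisIndex (Lp ℂ 2 m))] {X₁ D : Set X}
    (hX₁ : MeasurableSet X₁) (hD : IsPrecompactBorel D)
    {K R : Lp ℂ 2 m →L[ℂ] Lp ℂ 2 m} {k : X → X → ℂ} (hk : IsGoodKernel m X₁ K k)
    (hR : R * R = evenPart (proj m X₁) (proj m X₁ᶜ) (compress m D K)) (hRs : hs R ≠ ∞)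
    (hsa : star R = R) : ∀ᵐ x ∂m, x ∈ D → hsDensity R x = k x x := by
  rw [← ae_restrict_iff' hD.1]
  refine Integrable.ae_eq_of_forall_setIntegral_eq _ _ (integrable_hsDensity hRs).restrict
    (hk.integrableOn_diag D hD) fun S hS _ => ?_
  have hSD := hS.inter hD.1
  rw [Measure.restrict_restrict hS, ← hk.trace_eq _ (hD.subset hSD inter_subset_right),
    ← trace_mul_proj_mul hRs hsa hSD]
  have e : compress m (S ∩ D) K = proj m (S ∩ D) * compress m D K * proj m (S ∩ D) := by
    have h1 := proj_mul_proj (m := m) hSD hD.1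
    have h2 := proj_mul_proj (m := m) hD.1 hSD
    rw [inter_assoc, inter_self] at h1
    rw [inter_comm D, inter_assoc, inter_self] at h2
    calc _ = (proj m (S ∩ D) * proj m D) * K * (proj m D * proj m (S ∩ D)) := by
          rw [h1, h2, compress]
      _ = _ := by simp only [compress, mul_assoc]
  have hc₁ := proj_commute_mulOp hX₁ (memLp_top_indicator (m := m) hSD)
  have hc₂ := proj_commute_mulOp hX₁.compl (memLp_top_indicator (m := m) hSD)
  rw [e, trace_evenPart_mul_mul (s := proj m (S ∩ D)) (g := proj m (S ∩ D)) hc₁ hc₂ hc₁ hc₂ hR hRs,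
    proj_mul_proj hSD hSD, inter_self]

omit [BorelSpace X] in
theorem extDet_sqrtOp_eq_tsum [Countable (BasisIndex (Lp ℂ 2 m))] {X₁ D : Set X}
    (hX₁ : MeasurableSet X₁) (hD : IsPrecompactBorel D)
    {K R : Lp ℂ 2 m →L[ℂ] Lp ℂ 2 m} {k : X → X → ℂ} (hk : IsGoodKernel m X₁ K k)
    (hR : R * R = evenPart (proj m X₁) (proj m X₁ᶜ) (compress m D K)) (hRs : hs R ≠ ∞)
    (hsa : star R = R) {φ : X → ℝ} (hφ : Measurable φ) {C : ℝ} (hφb : ∀ x, |φ x| ≤ C)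
    (hφD : ∀ x, x ∉ D → φ x = 0) (hBs : hs (sqrtOp m K φ) ≠ ∞) :
    (∀ n : ℕ, Integrable (detIntegrand φ k n) (Measure.pi fun _ : Fin n => m)) ∧
      Summable (fun n : ℕ => detTerm m φ k (n + 1)) ∧
      extDet (proj m X₁) (proj m X₁ᶜ) (sqrtOp m K φ) = 1 + ∑' n : ℕ, detTerm m φ k (n + 1) := by
  have hsm := measurable_signSqrt hφ
  have hgm := measurable_sqrtAbs hφ
  have hsp : MemLp (fun x => (signSqrt φ x : ℂ)) ∞ m := memLp_top_ofReal hsm (abs_signSqrt_le hφb)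
  have hgp : MemLp (fun x => (sqrtAbs φ x : ℂ)) ∞ m := memLp_top_ofReal hgm (abs_sqrtAbs_le hφb)
  have hs0 : ∀ x, x ∉ D → signSqrt φ x = 0 := fun x hx => by simp [signSqrt, hφD x hx]
  have hg0 : ∀ x, x ∉ D → sqrtAbs φ x = 0 := fun x hx => by simp [sqrtAbs, hφD x hx]
  set s := signSqrt φ with hs
  set g := sqrtAbs φ with hg
  have hsg : ∀ x, s x * g x = φ x := signSqrt_mul_sqrtAbs φ
  have hκ : Measurable (Function.uncurry (sandwichKernel s g k)) :=
    ((Complex.measurable_ofReal.comp (hsm.comp measurable_fst)).mul hk.isIntegralKernel.1).mul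
      (Complex.measurable_ofReal.comp (hgm.comp measurable_snd))
  have hker : IsKernel m (sandwichKernel s g k) (sqrtOp m K φ) :=
    isKernel_sandwich hk.isIntegralKernel hD hsp hgp hg0
  have hdiag : ∀ x, sandwichKernel s g k x x = φ x * k x x := fun x => by
    rw [← hsg, sandwichKernel, Complex.ofReal_mul]; ring
  have hφk : Integrable (fun x => (φ x : ℂ) * k x x) m := by
    refine IntegrableOn.integrable_of_forall_notMem_eq_zero (s := D) ?_
      fun x hx => by simp [hφD x hx]
    exact (hk.integrableOn_diag D hD).bdd_mul (c := C)
      (Complex.measurable_ofReal.comp hφ).aestronglyMeasurable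
      (ae_of_all _ fun x => by simpa using hφb x)
  -- The change concerns only points outside the conull set G. Almost every tuple has all its
  -- entries in G, repeated ones included, so neither the determinants nor the diagonal integral is
  -- affected.
  obtain ⟨κ', G, hF, hG, he⟩ := exists_isFredholmKernel hκ
    (hker.lintegral_sq_ne_top hBs hκ hD.1 hD.measure_ne_top
      (fun x y hx => by simp [sandwichKernel, hs0 x hx])
      (fun x y hy => by simp [sandwichKernel, hg0 y hy]))
    (by simpa only [hdiag] using hφk.2.ne)
  have hdet : ∀ n, (fun z : Fin n → X => kdet κ' z) =ᵐ[Measure.pi fun _ => m]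
      detIntegrand φ k n := fun n => by
    refine (kdet_ae_eq hG he n).trans (ae_of_all _ fun z => ?_)
    exact kdet_sandwichKernel φ k z
  have hterm : ∀ n, (n.factorial : ℂ)⁻¹ * ∫ z : Fin n → X, kdet κ' z ∂(Measure.pi fun _ => m) =
      detTerm m φ k n := fun n => by rw [detTerm, integral_congr_ae (hdet n)]
  have hN := hF.isNewton
  simp only [hterm] at hN
  -- The first trace is the only one not given by `integral_iterKernel_eq_trace`; it rests on the
  -- identification of k(x,x) with the density of R.
  have h0 : ∫ x, iterKernel m κ' 0 x x ∂m =
      trace (evenPart (proj m X₁) (proj m X₁ᶜ) (sqrtOp m K φ)) := by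
    have hcs₁ := proj_commute_mulOp hX₁ hsp
    have hcs₂ := proj_commute_mulOp hX₁.compl hsp
    have hcg₁ := proj_commute_mulOp hX₁ hgp
    have hcg₂ := proj_commute_mulOp hX₁.compl hgp
    rw [sqrtOp_eq hD.1 hsp hgp hφD, trace_evenPart_mul_mul hcs₁ hcs₂ hcg₁ hcg₂ hR hRs,
      mulOp_sqrtAbs_mul_signSqrt hsp hgp,
      trace_mul_mulOp_mul hRs hsa (memLp_top_ofReal hφ hφb)]
    refine integral_congr_ae ?_
    filter_upwards [hG, diag_ae_eq_hsDensity hX₁ hD hk hR hRs hsa] with x hx hxD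
    change κ' x x = _
    rw [he x hx x hx, hdiag]
    by_cases h : x ∈ D
    · rw [hxD h]
    · simp [hφD x h]
  obtain ⟨h1, h2⟩ := extDet_eq_tsum hBs h0
    (fun l => hF.integral_iterKernel_eq_trace (hker.congr hG he) hBs l) hN
  refine ⟨fun n => (integrable_congr (hdet n)).1 (hF.integrable_kdet n),
    (summable_nat_add_iff 1).2 h1, ?_⟩
  rw [h2, h1.tsum_eq_zero_add]
  congr 1
  simp [detTerm, detIntegrand, Measure.real]
end Main

end JDet

end

theorem mainTheorem8 {X : Type*} [TopologicalSpace X] [PolishSpace X] [LocallyCompactSpace X]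
    [MeasurableSpace X] [BorelSpace X] (m : Measure X) [IsFiniteMeasureOnCompacts m]
    (X₁ : Set X) (hX₁ : MeasurableSet X₁)
    (K : Lp ℂ 2 m →L[ℂ] Lp ℂ 2 m)
    (hJ : JDet.IsJSelfAdjoint (JDet.proj m X₁) (JDet.proj m X₁ᶜ) K)
    (hK₁ : (JDet.proj m X₁ * K * JDet.proj m X₁).IsPositive)
    (hK₂ : (JDet.proj m X₁ᶜ * K * JDet.proj m X₁ᶜ).IsPositive)
    (hK : ∀ S : Set X, JDet.IsPrecompactBorel S →
      JDet.MemL12 (JDet.proj m X₁) (JDet.proj m X₁ᶜ) (JDet.compress m S K))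
    (D : Set X) (hD : JDet.IsPrecompactBorel D)
    (φ : X → ℝ) (hφ : Measurable φ) (hφb : ∃ C : ℝ, ∀ x, |φ x| ≤ C)
    (hφD : ∀ x, x ∉ D → φ x = 0) :
    JDet.MemL12 (JDet.proj m X₁) (JDet.proj m X₁ᶜ) (JDet.localOp m D K φ) ∧
    JDet.MemL12 (JDet.proj m X₁) (JDet.proj m X₁ᶜ) (JDet.sqrtOp m K φ) ∧
    JDet.extDet (JDet.proj m X₁) (JDet.proj m X₁ᶜ) (JDet.localOp m D K φ) =
      JDet.extDet (JDet.proj m X₁) (JDet.proj m X₁ᶜ) (JDet.sqrtOp m K φ) ∧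
    ∀ k : X → X → ℂ, JDet.IsGoodKernel m X₁ K k →
      (∀ n : ℕ, Integrable (JDet.detIntegrand φ k n) (Measure.pi fun _ : Fin n => m)) ∧
      Summable (fun n : ℕ => JDet.detTerm m φ k (n + 1)) ∧
      JDet.extDet (JDet.proj m X₁) (JDet.proj m X₁ᶜ) (JDet.sqrtOp m K φ) =
        1 + ∑' n : ℕ, JDet.detTerm m φ k (n + 1) := by
  obtain ⟨C, hC⟩ := hφb
  have := JDet.separableSpace_L2 (m := m)
  have := JDet.countable_basisIndex (H := Lp ℂ 2 m)
  have hs : MemLp (fun x => (JDet.signSqrt φ x : ℂ)) ∞ m :=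
    JDet.memLp_top_ofReal (JDet.measurable_signSqrt hφ) (JDet.abs_signSqrt_le hC)
  have hg : MemLp (fun x => (JDet.sqrtAbs φ x : ℂ)) ∞ m :=
    JDet.memLp_top_ofReal (JDet.measurable_sqrtAbs hφ) (JDet.abs_sqrtAbs_le hC)
  have hs₁ := JDet.proj_commute_mulOp hX₁ hs
  have hs₂ := JDet.proj_commute_mulOp hX₁.compl hs
  have hg₁ := JDet.proj_commute_mulOp hX₁ hg
  have hg₂ := JDet.proj_commute_mulOp hX₁.compl hg
  have hP := JDet.proj_add_proj_compl (m := m) hX₁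
  obtain ⟨hKe, hKo⟩ := hK D hD
  obtain ⟨R, hsa, hR, hRs⟩ := JDet.exists_sqrt_evenPart_compress hX₁ hD.1 hK₁ hK₂ hKe
  -- Splitting φ = √|φ| · sgn(φ)√|φ| exhibits the two operators as A g s and s A g for the same A =
  -- K^D.
  have hlocal : JDet.localOp m D K φ = JDet.compress m D K *
      (JDet.mulOp m (fun x => (JDet.sqrtAbs φ x : ℂ)) *
        JDet.mulOp m fun x => (JDet.signSqrt φ x : ℂ)) := by
    rw [JDet.mulOp_sqrtAbs_mul_signSqrt hs hg, JDet.localOp]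
  have hsqrt := JDet.sqrtOp_eq (K := K) hD.1 hs hg hφD
  have hB : JDet.hs (JDet.sqrtOp m K φ) ≠ ∞ := by
    rw [hsqrt]
    exact JDet.hs_mul_ne_top_right _
      (JDet.hs_mul_ne_top_left _ (JDet.hs_ne_top_of_sqrt hP hR hRs hKo))
  refine ⟨?_, ?_, ?_, fun k hk => JDet.extDet_sqrtOp_eq_tsum hX₁ hD hk hR hRs hsa hφ hC hφD hB⟩
  · rw [hlocal, ← one_mul (JDet.compress m D K)]
    exact JDet.memL12_mul_mul (Commute.one_left _) (Commute.one_left _) (hg₁.mul_left hs₁)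
      (hg₂.mul_left hs₂) hR hRs hKo
  · rw [hsqrt]
    exact JDet.memL12_mul_mul hs₁ hs₂ hg₁ hg₂ hR hRs hKo
  · rw [hlocal, hsqrt]
    exact JDet.extDet_mul_mul_eq hs₁ hs₂ hg₁ hg₂ hP hR hRs hKo
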